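/- Consider $$\partial_t^2u+\gamma(-\Delta_x)^{1/2}\partial_tu+\alpha\,\partial_tu-\Delta_xu+f(u)=g,\qquad u|_{t=0}=u_0,\quad \partial_tu|_{t=0}=u_1, \tag{1}$$ either in a bounded domain $\Omega\subset\mathbb R^3$ with smooth boundary, with Dirichlet boundary conditions, or on the torus $\Omega=\mathbb T^3=\mathbb R^3/2\pi\mathbb Z^3$ (periodic boundary conditions). Here $\gamma,\alpha>0$, $g\in L^2(\Omega)$, and $f\in C^1(\mathbb R)$ satisfies, for some constants $C,\kappa,K>0$, $$f(r)r\ge -C+\kappa|r|^2,\qquad f'(r)\ge -K,\qquad |f'(r)|\le C(1+|r|^4)\qquad (r\in\mathbb R).$$ Let $\mathcal E=H^1_0(\Omega)\times L^2(\Omega)$ (in the periodic case $H^1(\mathbb T^3)\times L^2(\mathbb T^3)$). Let $\lambda_i$, $e_i$ be the eigenvalues and an orthonormal basis of eigenfunctions of $-\Delta_x$ with the given boundary conditions; put $(-\Delta_x)^\theta w=\sum_i\lambda_i^\theta(w,e_i)e_i$ and $\|w\|^2_{H^s_\Delta}=\sum_i(1+\lambda_i)^s(w,e_i)^2$. Let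 $T>0$, $(u_0,u_1)\in\mathcal E$, and let $\xi_u=(u,\partial_tu)$ be a weak energy solution of (1) on $(0,T)$, that is: $\xi_u\in L^\infty(0,T;\mathcal E)$ and $\partial_tu\in L^2(0,T;H^{1/2}_\Delta)$; for every $\phi\in C_0^\infty((0,T)\times\Omega)$, $$-\int_0^T(\partial_tu,\partial_t\phi)\,dt+\int_0^T(\nabla u,\nabla\phi)\,dt+\alpha\int_0^T(\partial_tu,\phi)\,dt+\gamma\int_0^T(\partial_tu,(-\Delta_x)^{1/2}\phi)\,dt+\int_0^T(f(u),\phi)\,dt=\int_0^T(g,\phi)\,dt;$$ and $\xi_u(0)=(u_0,u_1)$, where $u$ and $\partial_tu$ are evaluated at $0$ through their continuous representatives with values in $L^2(\Omega)$ and in $H^{-1}(\Omega)$, the dual space of $H^1_0(\Omega)$ (of $H^1(\mathbb T^3)$ in the periodic case). Assume in addition that $u\in L^2(0,T;H^{3/2}(\Omega))$, where $$\|w\|^2_{H^{3/2}(\Omega)}=\|w\|^2_{H^1(\Omega)}+\int_\Omega\int_\Omega\frac{|\nabla w(x)-\nabla w(y)|^2}{|x-y|^{4}}\,dx\,dy$$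 and $|x-y|$ denotes the distance on the torus in the periodic case. Then, after modification on a null set of times, $\xi_u\in C([0,T],\mathcal E)$, with $\xi_u(0)=(u_0,u_1)$. For this representative, with $F(r)=\int_0^rf(s)\,ds$, the function $F(u(t))$ is integrable over $\Omega$ for every $t\in[0,T]$, the energy $$E(u(t),\partial_tu(t))=\tfrac12\|\partial_tu(t)\|^2_{L^2(\Omega)}+\tfrac12\|\nabla u(t)\|^2_{L^2(\Omega)}+(F(u(t)),1)-(g,u(t))$$ is absolutely continuous on $[0,T]$, and for almost every $t\in(0,T)$ $$\frac{d}{dt}E(u(t),\partial_tu(t))+\alpha\|\partial_tu(t)\|^2_{L^2(\Omega)}+\gamma\|(-\Delta_x)^{1/4}\partial_tu(t)\|^2_{L^2(\Omega)}=0.$$ -/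

import Mathlib

open MeasureTheory Set Filter Topology
open scoped ENNReal NNReal ContDiff

noncomputable section

namespace DampedWave

/-- Physical space `ℝ³` with its Euclidean norm. -/
abbrev E3 : Type := EuclideanSpace ℝ (Fin 3)

/-- The two boundary value problems: homogeneous Dirichlet conditions in a set `Ω ⊆ ℝ³`, or periodic
conditions on the torus `𝕋³ = ℝ³ / 2πℤ³`, whose functions are identified with functions on the
fundamental cell `[0, 2π]³`. -/
inductive Geometry : Type
  | dirichlet (Ω : Set E3)
  | torus

/-- The lattice vector `2πk`, `k ∈ ℤ³`. -/
def latticeVec (k : Fin 3 → ℤ) : E3 := WithLp.toLp 2 fun i => 2 * Real.pi * (k i : ℝ)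

/-- A bounded domain (open connected nonempty set) with smooth boundary: near each of its boundary
points it is a strict sublevel set of a smooth function that is regular at that point. -/
structure IsSmoothBoundedDomain (Ω : Set E3) : Prop where
  isOpen : IsOpen Ω
  isConnected : IsConnected Ω
  isBounded : Bornology.IsBounded Ω
  smooth_boundary : ∀ x ∈ frontier Ω, ∃ U ∈ 𝓝 x, ∃ ρ : E3 → ℝ,
    ContDiff ℝ ∞ ρ ∧ fderiv ℝ ρ x ≠ 0 ∧ ∀ y ∈ U, y ∈ Ω ↔ ρ y < 0

namespace Geometry

/-- The domain of a Dirichlet problem has to be smooth and bounded; the torus is always allowed. -/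
def Admissible : Geometry → Prop
  | dirichlet Ω => IsSmoothBoundedDomain Ω
  | torus => True

/-- The set on which functions live: `Ω`, or the cell `[0, 2π]³`. -/
def region : Geometry → Set E3
  | dirichlet Ω => Ω
  | torus => {x | ∀ i, x i ∈ Icc 0 (2 * Real.pi)}

/-- The distance of `Ω` (Euclidean), or of the torus. -/
def distance : Geometry → E3 → E3 → ℝ
  | dirichlet _ => fun x y => ‖x - y‖
  | torus => fun x y => ⨅ k : Fin 3 → ℤ, ‖x - y + latticeVec k‖

/-- Smooth functions of `x`: the class `C₀^∞(Ω)`, or `C^∞(𝕋³)`. -/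
def IsTest : Geometry → (E3 → ℝ) → Prop
  | dirichlet Ω => fun φ => ContDiff ℝ ∞ φ ∧ HasCompactSupport φ ∧ tsupport φ ⊆ Ω
  | torus => fun φ => ContDiff ℝ ∞ φ ∧ ∀ k x, φ (x + latticeVec k) = φ x

/-- Space-time test functions `φ(t, x)`: the class `C₀^∞((0,T) × Ω)`, or `C₀^∞((0,T) × 𝕋³)`. -/
def IsSpaceTimeTest : Geometry → ℝ → (ℝ → E3 → ℝ) → Prop
  | dirichlet Ω => fun T φ =>
      ContDiff ℝ ∞ (fun p : ℝ × E3 => φ p.1 p.2) ∧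
      HasCompactSupport (fun p : ℝ × E3 => φ p.1 p.2) ∧
      tsupport (fun p : ℝ × E3 => φ p.1 p.2) ⊆ Ioo 0 T ×ˢ Ω
  | torus => fun T φ =>
      ContDiff ℝ ∞ (fun p : ℝ × E3 => φ p.1 p.2) ∧
      (∃ a b, 0 < a ∧ b < T ∧ ∀ t, t ∉ Icc a b → ∀ x, φ t x = 0) ∧
      ∀ t k x, φ t (x + latticeVec k) = φ t x

variable (G : Geometry)

/-- Lebesgue measure on the region. -/
def μ : Measure E3 := volume.restrict G.region

/-- Real `L²(Ω)`. -/
abbrev L2 : Type := Lp ℝ 2 G.μ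

/-- `L²(Ω; ℝ³)`. -/
abbrev L2Vec : Type := Lp E3 2 G.μ

open Classical in
/-- The `L²`-class of a square integrable function (it is only used for such functions). -/
def toL2 {F : Type} [NormedAddCommGroup F] (φ : E3 → F) : Lp F 2 G.μ :=
  if h : MemLp φ 2 G.μ then h.toLp φ else 0

/-- The space `H¹₀(Ω)`, or `H¹(𝕋³)`: the closure of the smooth functions above in the `H¹`-norm
`(‖u‖² + ‖∇u‖²)^{1/2}`. A member is stored as the pair `(u, ∇u)` in `L²(Ω) × L²(Ω; ℝ³)`. -/
def H1 : Submodule ℝ (WithLp 2 (G.L2 × G.L2Vec)) :=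
  (Submodule.span ℝ {p | ∃ φ, G.IsTest φ ∧
    p = WithLp.toLp 2 (G.toL2 φ, G.toL2 (gradient φ))}).topologicalClosure

/-- The energy space `𝓔 = H¹₀(Ω) × L²(Ω)`, or `H¹(𝕋³) × L²(𝕋³)`. -/
abbrev EnergySpace : Type := G.H1 × G.L2

variable {G}

/-- The `L²`-function underlying a member of `H¹`. -/
def val (u : G.H1) : G.L2 := (u : WithLp 2 (G.L2 × G.L2Vec)).fst

/-- The weak gradient of a member of `H¹`. -/
def grad (u : G.H1) : G.L2Vec := (u : WithLp 2 (G.L2 × G.L2Vec)).snd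

variable (G)

/-- Functions `w ∈ L²` that belong to `H¹₀(Ω)` (or `H¹(𝕋³)`) and satisfy `-Δw = lam w` weakly, with the
given boundary conditions. -/
def eigenspace (lam : ℝ) : Submodule ℝ G.L2 where
  carrier := {w | ∃ p : G.H1, val p = w ∧
    ∀ q : G.H1, inner ℝ (grad p) (grad q) = lam * inner ℝ (val p) (val q)}
  add_mem' := by
    rintro _ _ ⟨p, rfl, hp⟩ ⟨p', rfl, hp'⟩
    refine ⟨p + p', rfl, fun q => ?_⟩
    have h1 : grad (p + p') = grad p + grad p' := rfl
    have h2 : val (p + p') = val p + val p' := rfl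
    rw [h1, h2, inner_add_left, inner_add_left, hp, hp', mul_add]
  zero_mem' := by
    refine ⟨0, rfl, fun q => ?_⟩
    have h1 : grad (0 : G.H1) = 0 := rfl
    have h2 : val (0 : G.H1) = 0 := rfl
    rw [h1, h2, inner_zero_left, inner_zero_left, mul_zero]
  smul_mem' := by
    rintro c _ ⟨p, rfl, hp⟩
    refine ⟨c • p, rfl, fun q => ?_⟩
    have h1 : grad (c • p) = c • grad p := rfl
    have h2 : val (c • p) = c • val p := rfl
    rw [h1, h2, inner_smul_left, inner_smul_left, hp]
    ring

/-- The orthogonal projection of `L²` onto the eigenspace (which is closed; passing to the closure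
only serves to have the projection available without proof). It vanishes unless `lam` is an
eigenvalue. -/
def spectralProj (lam : ℝ) : G.L2 →L[ℝ] G.L2 :=
  (G.eigenspace lam).topologicalClosure.starProjection

/-- The spectral fractional Laplacian `(-Δ)^θ w = ∑ lam^θ P_lam w`, the sum running over the
eigenvalues `lam` of `-Δ`; it is meant for `θ ≥ 0` and `w` in the domain `H^{2θ}_Δ`, for which the sum
converges in `L²`. -/
def fracLap (θ : ℝ) (w : G.L2) : G.L2 := ∑' lam : ℝ, lam ^ θ • G.spectralProj lam w

/-- The square of the norm of `H^s_Δ`, namely `∑ (1 + lam)^s ‖P_lam w‖²`, for `s ≥ 0` and `w ∈ L²`; it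
is `∞` when `w ∉ H^s_Δ`. -/
def hDeltaNormSq (s : ℝ) (w : G.L2) : ℝ≥0∞ :=
  ∑' lam : ℝ, ENNReal.ofReal ((1 + lam) ^ s) * ‖G.spectralProj lam w‖ₑ ^ 2

/-- The square of the Sobolev-Slobodeckij norm of `H^{3/2}(Ω)` for `u ∈ H¹`,
`‖u‖²_{H¹} + ∬ |∇u(x) - ∇u(y)|² / |x - y|^{3 + 2 (1/2)} dx dy`; it is `∞` when `u ∉ H^{3/2}(Ω)`. -/
def hThreeHalvesNormSq (u : G.H1) : ℝ≥0∞ :=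
  ‖u‖ₑ ^ 2 + ∫⁻ x, ∫⁻ y, ‖grad u x - grad u y‖ₑ ^ 2 / ENNReal.ofReal (G.distance x y) ^ 4 ∂G.μ ∂G.μ

/-- The embedding of `L²` in `H^{-1}`, the dual space of `H¹₀(Ω)` (or of `H¹(𝕋³)`), by `w ↦ (w, ·)`. -/
def toHneg1 (w : G.L2) : G.H1 →L[ℝ] ℝ :=
  (innerSL ℝ w).comp ((WithLp.fstL 2 ℝ G.L2 G.L2Vec).comp G.H1.subtypeL)

/-- Lebesgue measure on the time interval `(0,T)`. -/
def timeMeasure (T : ℝ) : Measure ℝ := volume.restrict (Ioo 0 T)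

/-- For `w : (0,T) → L²`: membership in `L²(0,T; H^s_Δ)`. -/
def MemL2HDelta (s T : ℝ) (w : ℝ → G.L2) : Prop :=
  AEStronglyMeasurable w (timeMeasure T) ∧
  AEMeasurable (fun t => G.hDeltaNormSq s (w t)) (timeMeasure T) ∧
  ∫⁻ t, G.hDeltaNormSq s (w t) ∂(timeMeasure T) < ⊤

/-- For `w : (0,T) → H¹`: membership in `L²(0,T; H^{3/2}(Ω))`. -/
def MemL2HThreeHalves (T : ℝ) (w : ℝ → G.H1) : Prop :=
  AEStronglyMeasurable w (timeMeasure T) ∧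
  AEMeasurable (fun t => G.hThreeHalvesNormSq (w t)) (timeMeasure T) ∧
  ∫⁻ t, G.hThreeHalvesNormSq (w t) ∂(timeMeasure T) < ⊤

/-- `v = ∂ₜu` on `(0,T)` in the sense of distributions. -/
def IsTimeDeriv (T : ℝ) (u v : ℝ → G.L2) : Prop :=
  ∀ η : ℝ → ℝ, ContDiff ℝ ∞ η → HasCompactSupport η → tsupport η ⊆ Ioo 0 T →
    ∫ t, deriv η t • u t ∂(timeMeasure T) = -∫ t, η t • v t ∂(timeMeasure T)

/-- The equation `∂ₜ²u + γ(-Δ)^{1/2}∂ₜu + α∂ₜu - Δu + f(u) = g` on `(0,T)` in the sense of distributions,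
for `ξ = (u, ∂ₜu)`. -/
def IsWeakEquation (γ α : ℝ) (f : ℝ → ℝ) (g : G.L2) (T : ℝ) (ξ : ℝ → G.EnergySpace) : Prop :=
  ∀ φ : ℝ → E3 → ℝ, G.IsSpaceTimeTest T φ →
    -(∫ t, inner ℝ (ξ t).2 (G.toL2 fun x => deriv (fun s => φ s x) t) ∂(timeMeasure T))
      + (∫ t, inner ℝ (grad (ξ t).1) (G.toL2 (gradient (φ t))) ∂(timeMeasure T))
      + α * (∫ t, inner ℝ (ξ t).2 (G.toL2 (φ t)) ∂(timeMeasure T))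
      + γ * (∫ t, inner ℝ (ξ t).2 (G.fracLap (1 / 2) (G.toL2 (φ t))) ∂(timeMeasure T))
      + (∫ t, (∫ x, f (val (ξ t).1 x) * φ t x ∂G.μ) ∂(timeMeasure T))
      = ∫ t, inner ℝ g (G.toL2 (φ t)) ∂(timeMeasure T)

/-- `ξ = (u, ∂ₜu)`, given up to equality for almost every `t`, is a weak energy solution on `(0,T)` with
initial data `ξ₀ = (u₀, u₁)`. The initial data are attained by the continuous representatives of `u` in
`L²` and of `∂ₜu` in `H^{-1}`, that is, as essential limits for `t → 0+`. -/
structure IsEnergySolution (γ α : ℝ) (f : ℝ → ℝ) (g : G.L2) (T : ℝ) (ξ₀ : G.EnergySpace)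
    (ξ : ℝ → G.EnergySpace) : Prop where
  memLp_top : MemLp ξ ⊤ (timeMeasure T)
  isTimeDeriv : G.IsTimeDeriv T (fun t => val (ξ t).1) (fun t => (ξ t).2)
  memL2_half : G.MemL2HDelta (1 / 2) T (fun t => (ξ t).2)
  weak_equation : G.IsWeakEquation γ α f g T ξ
  initial_fst : Tendsto (fun t => val (ξ t).1) (𝓝[>] 0 ⊓ ae volume) (𝓝 (val ξ₀.1))
  initial_snd : Tendsto (fun t => G.toHneg1 (ξ t).2) (𝓝[>] 0 ⊓ ae volume) (𝓝 (G.toHneg1 ξ₀.2))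

/-- The primitive `F(u) = ∫₀ᵘ f(s) ds`. -/
def potential (f : ℝ → ℝ) (r : ℝ) : ℝ := ∫ s in (0 : ℝ)..r, f s

/-- The energy `E(u,v) = ½‖v‖² + ½‖∇u‖² + (F(u), 1) - (g, u)`. -/
def energy (f : ℝ → ℝ) (g : G.L2) (ξ : G.EnergySpace) : ℝ :=
  1 / 2 * ‖ξ.2‖ ^ 2 + 1 / 2 * ‖grad ξ.1‖ ^ 2 + (∫ x, potential f (val ξ.1 x) ∂G.μ)
    - inner ℝ g (val ξ.1)

end Geometry

/-- The growth and dissipativity assumptions on the nonlinearity `f ∈ C¹(ℝ)`. -/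
structure IsAdmissibleNonlinearity (f : ℝ → ℝ) (C κ K : ℝ) : Prop where
  contDiff : ContDiff ℝ 1 f
  C_pos : 0 < C
  κ_pos : 0 < κ
  K_pos : 0 < K
  dissipative : ∀ r, -C + κ * |r| ^ 2 ≤ f r * r
  deriv_lower : ∀ r, -K ≤ deriv f r
  deriv_growth : ∀ r, |deriv f r| ≤ C * (1 + |r| ^ 4)

end DampedWave

end

open MeasureTheory Set Filter Topology
open scoped ENNReal NNReal ContDiff

noncomputable section

/-! The quintic growth of `f` is critical for the energy space: H¹ embeds in L⁶, which does not put
f(u) in L². The H^{3/2} hypothesis supplies what is missing. On bounded subsets of H¹ one has ‖u‖⁵ ≤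
C (1 + ‖u‖²_{H^{3/2}}) with the L¹⁰ norm on the left, so f(u) lies in L¹(0,T; L²) and can be paired
with the bounded velocity ∂ₜu. After that, the problem is an energy identity with forcing in L¹(0,T;
L²).

The L¹⁰ bound has two steps. Near each point of the region, at each small scale s, there is a ball
of radius s/4 inside the region. Averaging ∇u(x) − ∇u(y) over it and optimizing s bounds
|∇u(x)|^{8/3} by the inner integral of the Slobodeckij seminorm at x, up to constants
(`exists_lintegral_grad_rpow_le`). Sobolev's inequality for |u|^{2/3}u then bounds ∫|u|¹⁰ by the
cube of ∫|u|^{4/3}|∇u|² plus lower order terms, and Hölder's inequality closes the estimate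
(`exists_lintegral_val_pow_ten_le`).

The velocity is not regular enough to be used as a multiplier. The equation is therefore smoothed
with R = (1 − εΔ)⁻¹, a symmetric contraction of L² that acts as a scalar on each eigenspace. The
smoothed velocity is absolutely continuous in L², so its quadratic energy obeys an exact balance. As
ε → 0 every term converges, with majorants integrable in time. This gives the balance at every time
for the weakly continuous representatives (`quadratic_energy_eq`).

The potential energy is treated separately: for bounded Lipschitz truncations of `f` it is a
differentiable functional on L², along which u is absolutely continuous, and the truncation is
removed by dominated convergence (`integral_potential_eq`). In the sum the contributions of f(u) and
g cancel and only the dissipation remains. Finally, the quadratic energy is a primitive, hence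
continuous; together with weak continuity this yields strong continuity in the energy space
(`continuousOn_energySpace`). -/

namespace DampedWave

/-! ### Absolutely continuous and weakly differentiable vector valued functions of time -/

section TimeCalculus

variable {E : Type*} [NormedAddCommGroup E] [NormedSpace ℝ E]

/-- The indefinite Bochner integral is absolutely continuous. -/
lemma absolutelyContinuousOnInterval_integral {h : ℝ → E} {a b : ℝ}
    (hh : IntervalIntegrable h volume a b) (c : E) :
    AbsolutelyContinuousOnInterval (fun x => c + ∫ s in a..x, h s) a b := by
  -- The increments of the primitive of h are dominated by those of the real primitive of ‖h‖.
  have H := hh.norm.absolutelyContinuousOnInterval_intervalIntegral (c := a) (by simp)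
  rw [absolutelyContinuousOnInterval_iff] at H ⊢
  intro ε hε
  obtain ⟨δ, hδ, H⟩ := H ε hε
  refine ⟨δ, hδ, fun I hI hlt => lt_of_le_of_lt (Finset.sum_le_sum fun i hi => ?_) (H I hI hlt)⟩
  obtain ⟨h1, h2⟩ := hI.1 i hi
  have i1 : IntervalIntegrable h volume a (I.2 i).1 :=
    hh.mono_set (uIcc_subset_uIcc_left h1)
  have i2 : IntervalIntegrable h volume a (I.2 i).2 :=
    hh.mono_set (uIcc_subset_uIcc_left h2)
  rw [dist_eq_norm, dist_eq_norm, add_sub_add_left_eq_sub,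
    intervalIntegral.integral_interval_sub_left i1 i2,
    intervalIntegral.integral_interval_sub_left i1.norm i2.norm]
  exact intervalIntegral.norm_integral_le_abs_integral_norm

/-- Fundamental theorem of calculus for absolutely continuous vector valued functions. -/
lemma integral_eq_sub_of_absolutelyContinuous [CompleteSpace E] {w h : ℝ → E} {a b : ℝ}
    (hw : AbsolutelyContinuousOnInterval w a b)
    (hd : ∀ᵐ x, x ∈ uIcc a b → HasDerivAt w (h x) x) (hh : IntervalIntegrable h volume a b)
    {t : ℝ} (ht : t ∈ uIcc a b) : w t = w a + ∫ s in a..t, h s := by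
  -- The difference of w and the primitive of h is absolutely continuous with derivative zero almost
  -- everywhere, hence constant.
  have hac := hw.fun_sub (absolutelyContinuousOnInterval_integral hh 0)
  obtain ⟨C, hC⟩ := hac.const_of_ae_hasDerivAt_zero (by
    filter_upwards [hd, hh.ae_hasDerivAt_integral] with x h1 h2 hx
    simpa using! (h1 hx).fun_sub ((h2 hx a left_mem_uIcc).const_add 0))
  have e1 := hC t ht
  have e2 := hC a left_mem_uIcc
  simp only [zero_add, intervalIntegral.integral_same, sub_zero] at e1 e2
  rw [e2, ← e1]; abel

lemma absolutelyContinuousOnInterval_comp {E X : Type*} [NormedAddCommGroup E] [PseudoMetricSpace X]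
    {w : ℝ → E} {a b : ℝ} (hw : AbsolutelyContinuousOnInterval w a b) {Φ : E → X} {S : Set E}
    {k : ℝ≥0} (hΦ : LipschitzOnWith k Φ S) (hS : ∀ t ∈ uIcc a b, w t ∈ S) :
    AbsolutelyContinuousOnInterval (fun t => Φ (w t)) a b := by
  rw [absolutelyContinuousOnInterval_iff] at hw ⊢
  intro ε hε
  -- The 1 added to k avoids division by zero for a constant Φ.
  obtain ⟨δ, hδ, H⟩ := hw (ε / (k + 1)) (by positivity)
  refine ⟨δ, hδ, fun I hI hlt => ?_⟩
  have h1 := H I hI hlt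
  rw [lt_div_iff₀ (by positivity)] at h1
  refine lt_of_le_of_lt ?_ h1
  rw [Finset.sum_mul]
  refine Finset.sum_le_sum fun i hi => ?_
  obtain ⟨h2, h3⟩ := hI.1 i hi
  refine (hΦ.dist_le_mul _ (hS _ h2) _ (hS _ h3)).trans ?_
  rw [mul_comm]
  gcongr
  simp

/-- Chain rule, in integrated form, for a locally Lipschitz differentiable functional along an
absolutely continuous curve. -/
lemma functional_eq_add_integral [CompleteSpace E] {h : ℝ → E} {b : ℝ} (w₀ : E)
    (hh : IntervalIntegrable h volume 0 b) {Φ : E → ℝ} {Φ' : E → E →L[ℝ] ℝ}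
    (hΦ : ∀ x, HasFDerivAt Φ (Φ' x) x)
    (hlip : ∀ R : ℝ, ∃ k : ℝ≥0, LipschitzOnWith k Φ (Metric.closedBall 0 R))
    {w : ℝ → E} (hw : ∀ t ∈ uIcc 0 b, w t = w₀ + ∫ s in (0 : ℝ)..t, h s)
    (hint : IntervalIntegrable (fun s => Φ' (w s) (h s)) volume 0 b) {t : ℝ} (ht : t ∈ uIcc 0 b) :
    Φ (w t) = Φ w₀ + ∫ s in (0 : ℝ)..t, Φ' (w s) (h s) := by
  set W : ℝ → E := fun t => w₀ + ∫ s in (0 : ℝ)..t, h s with hW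
  have hac := absolutelyContinuousOnInterval_integral hh w₀
  -- The curve is bounded, so the Lipschitz constant on a single ball suffices.
  obtain ⟨R, hR⟩ := hac.exists_bound
  obtain ⟨k, hk⟩ := hlip R
  have h1 := absolutelyContinuousOnInterval_comp hac hk
    (fun t ht => by simpa using hR t ht)
  have h2 : ∀ t ∈ uIcc 0 b, w t = W t := hw
  rw [h2 t ht]
  have h0 : W 0 = w₀ := by simp [hW]
  have := integral_eq_sub_of_absolutelyContinuous h1 (h := fun s => Φ' (w s) (h s)) (by
    filter_upwards [hh.ae_hasDerivAt_integral] with x hx hxm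
    have h3 := (hx hxm 0 left_mem_uIcc).const_add w₀
    rw [h2 x hxm]
    exact (hΦ (W x)).comp_hasDerivAt x h3) hint ht
  rw [← h0]
  exact this

/-- A vector valued integrable function with an integrable weak derivative is almost everywhere
equal to an indefinite integral of the latter. -/
lemma exists_eq_const_add_integral [CompleteSpace E] {T : ℝ} (hT : 0 < T) {w h : ℝ → E}
    (hw : IntegrableOn w (Ioo 0 T)) (hh : IntegrableOn h (Ioo 0 T))
    (hweak : ∀ η : ℝ → ℝ, ContDiff ℝ ∞ η → HasCompactSupport η → tsupport η ⊆ Ioo 0 T →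
      ∫ t in Ioo 0 T, deriv η t • w t = -∫ t in Ioo 0 T, η t • h t) :
    ∃ c : E, ∀ᵐ t ∂(volume.restrict (Ioo 0 T)), w t = c + ∫ s in (0 : ℝ)..t, h s := by
  have hhi : IntervalIntegrable h volume 0 T := by
    rwa [intervalIntegrable_iff_integrableOn_Ioo_of_le hT.le]
  set H : ℝ → E := fun t => 0 + ∫ s in (0 : ℝ)..t, h s with hH
  have hHac : AbsolutelyContinuousOnInterval H 0 T := absolutelyContinuousOnInterval_integral hhi 0
  have hHc : ContinuousOn H (Icc 0 T) := by simpa [uIcc_of_le hT.le] using hHac.continuousOn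
  have hHint : IntegrableOn H (Ioo 0 T) :=
    (hHc.integrableOn_compact isCompact_Icc).mono_set Ioo_subset_Icc_self
  have hbd : ∀ η : ℝ → ℝ, Continuous η → HasCompactSupport η → ∀ k : ℝ → E,
      IntegrableOn k (Ioo 0 T) → IntegrableOn (fun t => η t • k t) (Ioo 0 T) := by
    intro η hη hηc k hk
    obtain ⟨C, hC⟩ := hηc.exists_bound_of_continuous hη
    exact Integrable.bdd_smul hk C hη.aestronglyMeasurable (ae_of_all _ hC)
  have hconv : ∀ k : ℝ → E, ∫ t in Ioo 0 T, k t = ∫ t in (0 : ℝ)..T, k t := fun k => by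
    rw [intervalIntegral.integral_of_le hT.le, integral_Ioc_eq_integral_Ioo]
  have hparts : ∀ η : ℝ → ℝ, ContDiff ℝ ∞ η → HasCompactSupport η → tsupport η ⊆ Ioo 0 T →
      ∫ t in Ioo 0 T, deriv η t • H t = -∫ t in Ioo 0 T, η t • h t := by
    intro η hη hηc hηs
    have hη1 : ContDiff ℝ 1 η := hη.of_le (by exact_mod_cast le_top)
    have hac : AbsolutelyContinuousOnInterval (fun t => η t • H t) 0 T :=
      hη1.contDiffOn.absolutelyContinuousOnInterval.fun_smul hHac
    have i1 : IntegrableOn (fun t => η t • h t) (Ioo 0 T) := hbd η hη.continuous hηc h hh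
    have i2 : IntegrableOn (fun t => deriv η t • H t) (Ioo 0 T) :=
      hbd _ (hη1.continuous_deriv le_rfl) hηc.deriv H hHint
    have key := integral_eq_sub_of_absolutelyContinuous hac
      (h := fun t => η t • h t + deriv η t • H t) (by
        filter_upwards [hhi.ae_hasDerivAt_integral] with x hx hxm
        exact ((hη1.differentiable (by simp)) x).hasDerivAt.smul
          ((hx hxm 0 left_mem_uIcc).const_add 0))
      (by rw [intervalIntegrable_iff_integrableOn_Ioo_of_le hT.le]; exact i1.add i2)
      (right_mem_uIcc (a := (0 : ℝ)) (b := T))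
    have e0 : η 0 = 0 := image_eq_zero_of_notMem_tsupport fun h => (lt_irrefl _ (hηs h).1)
    have eT : η T = 0 := image_eq_zero_of_notMem_tsupport fun h => (lt_irrefl _ (hηs h).2)
    rw [e0, eT, zero_smul, zero_smul, zero_add, ← hconv, integral_add i1 i2] at key
    rw [eq_neg_iff_add_eq_zero, add_comm]
    exact key.symm
  -- Thus w − H has vanishing weak derivative; what follows is the du Bois-Reymond argument that it
  -- is constant.
  have hD : ∀ η : ℝ → ℝ, ContDiff ℝ ∞ η → HasCompactSupport η → tsupport η ⊆ Ioo 0 T →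
      ∫ t in Ioo 0 T, deriv η t • (w t - H t) = 0 := by
    intro η hη hηc hηs
    have hη1 : ContDiff ℝ 1 η := hη.of_le (by exact_mod_cast le_top)
    simp only [smul_sub]
    rw [integral_sub (hbd _ (hη1.continuous_deriv le_rfl) hηc.deriv w hw)
      (hbd _ (hη1.continuous_deriv le_rfl) hηc.deriv H hHint), hweak η hη hηc hηs,
      hparts η hη hηc hηs, sub_self]
  -- A fixed bump of mass one; the constant will be the average of w − H against it.
  obtain ⟨η₀, hη₀s, hη₀c, hη₀, hη₀n, hη₀1⟩ : ∃ η₀ : ℝ → ℝ, tsupport η₀ ⊆ Ioo 0 T ∧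
      HasCompactSupport η₀ ∧ ContDiff ℝ ∞ η₀ ∧ (∀ x, 0 ≤ η₀ x) ∧ ∫ x, η₀ x = 1 := by
    let φ : ContDiffBump (T / 2) := ⟨T / 8, T / 4, by positivity, by linarith⟩
    refine ⟨φ.normed volume, ?_, φ.hasCompactSupport_normed, φ.contDiff_normed, φ.nonneg_normed,
      φ.integral_normed⟩
    rw [φ.tsupport_normed_eq, Real.closedBall_eq_Icc]
    intro x hx
    simp only [φ, mem_Icc, mem_Ioo] at hx ⊢
    constructor <;> linarith [hx.1, hx.2]
  set D : ℝ → E := fun t => w t - H t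
  have hDint : IntegrableOn D (Ioo 0 T) := hw.sub hHint
  set c : E := ∫ t in Ioo 0 T, η₀ t • D t
  have hsupp : ∀ η : ℝ → ℝ, tsupport η ⊆ Ioo 0 T → ∫ x in Ioo 0 T, η x = ∫ x, η x := by
    intro η hη
    exact setIntegral_eq_integral_of_forall_compl_eq_zero fun x hx =>
      image_eq_zero_of_notMem_tsupport fun h => hx (hη h)
  have hz : ∀ θ : ℝ → ℝ, ContDiff ℝ ∞ θ → HasCompactSupport θ → tsupport θ ⊆ Ioo 0 T →
      ∫ t, θ t • (D t - c) ∂(volume.restrict (Ioo 0 T)) = 0 := by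
    intro θ hθ hθc hθs
    set m := ∫ x, θ x with hm
    -- Removing the mass of θ makes σ the derivative of a compactly supported function.
    set σ : ℝ → ℝ := fun x => θ x - m * η₀ x with hσ
    have hσd : ContDiff ℝ ∞ σ := hθ.sub (contDiff_const.mul hη₀)
    obtain ⟨a, b, ha, hb, hab⟩ : ∃ a b : ℝ, 0 < a ∧ b < T ∧ ∀ x, x ∉ Icc a b → σ x = 0 := by
      have hK : IsCompact (tsupport θ ∪ tsupport η₀) := hθc.isCompact.union hη₀c.isCompact
      have hKs : tsupport θ ∪ tsupport η₀ ⊆ Ioo 0 T := union_subset hθs hη₀s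
      rcases (tsupport θ ∪ tsupport η₀).eq_empty_or_nonempty with he | hne
      · refine ⟨T / 2, T / 2, by linarith, by linarith, fun x _ => ?_⟩
        have h1 : x ∉ tsupport θ ∪ tsupport η₀ := by simp [he]
        rw [mem_union, not_or] at h1
        simp [hσ, image_eq_zero_of_notMem_tsupport h1.1, image_eq_zero_of_notMem_tsupport h1.2]
      · obtain ⟨a, ha, ha'⟩ := hK.exists_isLeast hne
        obtain ⟨b, hb, hb'⟩ := hK.exists_isGreatest hne
        refine ⟨a, b, (hKs ha).1, (hKs hb).2, fun x hx => ?_⟩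
        have h1 : x ∉ tsupport θ ∪ tsupport η₀ := fun h => hx ⟨ha' h, hb' h⟩
        rw [mem_union, not_or] at h1
        simp [hσ, image_eq_zero_of_notMem_tsupport h1.1, image_eq_zero_of_notMem_tsupport h1.2]
    have hσi : Integrable σ := (hθ.continuous.integrable_of_hasCompactSupport hθc).sub
      ((hη₀.continuous.integrable_of_hasCompactSupport hη₀c).const_mul m)
    have hσ0 : ∫ x, σ x = 0 := by
      rw [integral_sub (hθ.continuous.integrable_of_hasCompactSupport hθc)
        ((hη₀.continuous.integrable_of_hasCompactSupport hη₀c).const_mul m),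
        integral_const_mul, hη₀1, ← hm]; ring
    set η : ℝ → ℝ := fun t => ∫ s in (0 : ℝ)..t, σ s with hηdef
    have hder : ∀ t, HasDerivAt η (σ t) t := fun t =>
      intervalIntegral.integral_hasDerivAt_right (hσd.continuous.intervalIntegrable _ _)
        (hσd.continuous.stronglyMeasurableAtFilter _ _) hσd.continuous.continuousAt
    have hηd : deriv η = σ := funext fun t => (hder t).deriv
    have hηs : ContDiff ℝ ∞ η := by
      rw [contDiff_infty_iff_deriv, hηd]
      exact ⟨fun t => (hder t).differentiableAt, hσd⟩
    -- To the left of a nothing has been integrated yet; to the right of b the whole integral of σ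
    -- has been collected, and it is zero.
    have hη0 : ∀ t, t ∉ Icc a b → η t = 0 := by
      intro t ht
      rw [mem_Icc, not_and_or, not_le, not_le] at ht
      rcases ht with ht | ht
      · rw [hηdef]
        refine intervalIntegral.integral_zero_ae (ae_of_all _ fun s hs => hab s fun h => ?_)
        have : s ≤ max 0 t := (mem_uIoc.1 hs).elim (fun h => h.2.trans (le_max_right _ _))
          (fun h => h.2.trans (le_max_left _ _))
        exact absurd (h.1.trans this) (not_le.2 (max_lt ha ht))
      · have : ∫ s, σ s = η t := by
          rw [hηdef]
          refine (intervalIntegral.integral_eq_integral_of_support_subset fun s hs => ?_).symm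
          by_contra hcon
          refine hs (hab s fun h => hcon ⟨ha.trans_le h.1, h.2.trans ht.le⟩)
        rw [← this, hσ0]
    have hsub : tsupport η ⊆ Icc a b := closure_minimal (fun t ht => by
      by_contra h; exact ht (hη0 t h)) isClosed_Icc
    have h1 := hD η hηs (HasCompactSupport.of_support_subset_isCompact isCompact_Icc
      ((subset_tsupport _).trans hsub)) (hsub.trans (Icc_subset_Ioo ha hb))
    rw [hηd] at h1
    have i1 := hbd θ hθ.continuous hθc D hDint
    have i2 := hbd η₀ hη₀.continuous hη₀c D hDint
    -- The relation ∫ σ D = 0 says ∫ θ D = (∫ θ) c, that is, D − c annihilates θ.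
    have h2 : ∫ t in Ioo 0 T, θ t • D t = m • c := by
      have : (fun t => σ t • (w t - H t)) = fun t => θ t • D t - m • (η₀ t • D t) := by
        funext t; simp only [hσ, D, sub_smul, mul_smul]
      rw [this] at h1
      have h3 := integral_sub i1 (i2.smul m)
      simp only [Pi.smul_apply] at h3
      rw [h1, integral_smul] at h3
      exact sub_eq_zero.1 h3.symm
    simp only [smul_sub]
    rw [integral_sub i1, h2, integral_smul_const, hsupp θ hθs, ← hm, sub_self]
    exact ((hθ.continuous.integrable_of_hasCompactSupport hθc).smul_const c).integrableOn
  refine ⟨c, ?_⟩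
  have := isOpen_Ioo.ae_eq_zero_of_integral_contDiff_smul_eq_zero (U := Ioo 0 T)
    (μ := volume.restrict (Ioo 0 T)) (f := fun t => D t - c)
    (Integrable.locallyIntegrable (hDint.sub (integrable_const c)) |>.locallyIntegrableOn _) hz
  filter_upwards [this, ae_restrict_mem measurableSet_Ioo] with t ht htm
  have := ht htm
  simp only [D, hH, zero_add] at this
  rw [sub_eq_zero, sub_eq_iff_eq_add] at this
  exact this

end TimeCalculus

/-! ### Weak compactness and weakly continuous representatives in Hilbert spaces -/

section WeakLimits

variable {X Y : Type*} [NormedAddCommGroup X] [InnerProductSpace ℝ X] [CompleteSpace X]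
  [NormedAddCommGroup Y] [InnerProductSpace ℝ Y] [CompleteSpace Y]

/-- Weak compactness of balls of a Hilbert space, in terms of ultrafilters. -/
lemma exists_weak_limit {ι : Type*} (U : Ultrafilter ι) {w : ι → X} {R : ℝ}
    (hw : ∀ᶠ i in (U : Filter ι), ‖w i‖ ≤ R) :
    ∃ x : X, ‖x‖ ≤ R ∧ ∀ z : X, Tendsto (fun i => inner ℝ (w i) z) U (𝓝 (inner ℝ x z)) := by
  -- The Riesz isometry turns weak convergence into weak-* convergence, where the Banach-Alaoglu
  -- theorem applies.
  let Λ : ι → WeakDual ℝ X := fun i => StrongDual.toWeakDual (InnerProductSpace.toDual ℝ X (w i))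
  have hK := WeakDual.isCompact_closedBall (𝕜 := ℝ) (E := X) 0 R
  obtain ⟨ℓ, hℓ, hlim⟩ := hK.ultrafilter_le_nhds (U.map Λ) (by
    rw [le_principal_iff, Ultrafilter.coe_map, mem_map]
    filter_upwards [hw] with i hi
    simpa [Λ] using hi)
  refine ⟨(InnerProductSpace.toDual ℝ X).symm (WeakDual.toStrongDual ℓ), ?_, fun z => ?_⟩
  · simpa using hℓ
  · rw [InnerProductSpace.toDual_symm_apply]
    have h1 : Tendsto Λ U (𝓝 ℓ) := hlim
    exact (WeakDual.eval_continuous z).continuousAt.tendsto.comp h1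

/-- A bounded function of time with values in a Hilbert space whose image under an injective operator
is continuous has a weakly continuous representative. -/
lemma exists_weakly_continuous_representative {T R : ℝ} (hT : 0 < T) (A : X →L[ℝ] Y)
    (hA : Function.Injective A) {w : ℝ → X} {y : ℝ → Y} (hy : ContinuousOn y (Icc 0 T))
    (hwy : ∀ᵐ t ∂(volume.restrict (Ioo 0 T)), A (w t) = y t)
    (hR : ∀ᵐ t ∂(volume.restrict (Ioo 0 T)), ‖w t‖ ≤ R) :
    ∃ v : ℝ → X, (∀ t ∈ Icc 0 T, A (v t) = y t ∧ ‖v t‖ ≤ R) ∧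
      (∀ᵐ t ∂(volume.restrict (Ioo 0 T)), v t = w t) ∧
      ∀ z, ContinuousOn (fun t => inner ℝ (v t) z) (Icc 0 T) := by
  -- Along any ultrafilter of times tending to t a weak limit exists. Strong convergence of A(k s)
  -- to y t, moved through the adjoint of A, forces the image of that limit to be y t.
  have hlim : ∀ (U : Ultrafilter ℝ) (k : ℝ → X) (t : ℝ), t ∈ Icc 0 T → (U : Filter ℝ) ≤ 𝓝[Icc 0 T] t →
      (∀ᶠ s in (U : Filter ℝ), A (k s) = y s ∧ ‖k s‖ ≤ R) →
      ∃ x : X, ‖x‖ ≤ R ∧ A x = y t ∧ ∀ z, Tendsto (fun s => inner ℝ (k s) z) U (𝓝 (inner ℝ x z)) := by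
    intro U k t ht hU hk
    obtain ⟨x, hx, hxz⟩ := exists_weak_limit U (hk.mono fun s hs => hs.2)
    refine ⟨x, hx, ?_, hxz⟩
    have h1 : Tendsto y U (𝓝 (y t)) := (hy t ht).mono_left hU
    refine ext_inner_right ℝ fun z => ?_
    have h2 : Tendsto (fun s => inner ℝ (y s) z) U (𝓝 (inner ℝ (y t) z)) := h1.inner tendsto_const_nhds
    have h3 := hxz (ContinuousLinearMap.adjoint A z)
    rw [ContinuousLinearMap.adjoint_inner_right] at h3
    refine tendsto_nhds_unique (h3.congr' ?_) h2
    filter_upwards [hk] with s hs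
    rw [ContinuousLinearMap.adjoint_inner_right, hs.1]
  have hgood : ∀ᵐ t, t ∈ Ioo 0 T → A (w t) = y t ∧ ‖w t‖ ≤ R := by
    rw [← ae_restrict_iff' measurableSet_Ioo]
    exact hwy.and hR
  have hex : ∀ t ∈ Icc 0 T, ∃ x : X, A x = y t ∧ ‖x‖ ≤ R := by
    intro t ht
    -- The good times have full measure, so they are dense and every t in [0,T], endpoints included,
    -- is a limit of them.
    set S := {t | t ∈ Ioo 0 T → A (w t) = y t ∧ ‖w t‖ ≤ R}
    have hd : Dense S := Measure.dense_of_ae hgood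
    have htc : t ∈ closure (Ioo 0 T ∩ S) := by
      rw [← closure_Ioo hT.ne] at ht
      exact closure_minimal (hd.open_subset_closure_inter isOpen_Ioo) isClosed_closure ht
    have : (𝓝[Ioo 0 T ∩ S] t).NeBot := mem_closure_iff_nhdsWithin_neBot.1 htc
    have hle := Ultrafilter.of_le (𝓝[Ioo 0 T ∩ S] t)
    obtain ⟨x, hx, hx', -⟩ := hlim (Ultrafilter.of (𝓝[Ioo 0 T ∩ S] t)) w t ht
      (hle.trans (nhdsWithin_mono _ (inter_subset_left.trans Ioo_subset_Icc_self)))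
      (hle (eventually_mem_nhdsWithin.mono fun s hs => hs.2 hs.1))
    exact ⟨x, hx', hx⟩
  choose! v hv using hex
  refine ⟨v, hv, ?_, fun z t ht => ?_⟩
  · filter_upwards [hwy, ae_restrict_mem measurableSet_Ioo] with t h1 h2
    exact hA ((hv t (Ioo_subset_Icc_self h2)).1.trans h1.symm)
  · rw [ContinuousWithinAt, tendsto_iff_ultrafilter]
    intro U hU
    obtain ⟨x, -, hx', hxz⟩ := hlim U v t ht hU (hU (eventually_mem_nhdsWithin.mono hv))
    -- Injectivity of A identifies each weak limit point with v t; hence the full weak limit exists.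
    rw [hA ((hv t ht).1.trans hx'.symm)]
    exact hxz z

/-- Weak convergence and convergence of the norms give strong convergence. -/
lemma tendsto_of_weak_of_norm {X : Type*} [NormedAddCommGroup X] [InnerProductSpace ℝ X] {ι : Type*}
    {l : Filter ι} {w : ι → X} {x : X}
    (h1 : Tendsto (fun i => inner ℝ (w i) x) l (𝓝 (inner ℝ x x)))
    (h2 : Tendsto (fun i => ‖w i‖ ^ 2) l (𝓝 (‖x‖ ^ 2))) : Tendsto w l (𝓝 x) := by
  rw [tendsto_iff_norm_sub_tendsto_zero]
  have h3 : Tendsto (fun i => ‖w i - x‖ ^ 2) l (𝓝 0) := by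
    have := (h2.sub (h1.const_mul 2)).add_const (‖x‖ ^ 2)
    rw [real_inner_self_eq_norm_sq] at this
    convert this using 2
    · rw [norm_sub_sq_real]
    · ring
  simpa using h3.sqrt

end WeakLimits

namespace Geometry

/-! ### Corkscrew balls, test functions and the space H¹ -/

section Region

/-- Near a boundary point the set is {ρ < 0}, and ρ decreases at a definite rate in the direction e
= −∇ρ(x₀)/|∇ρ(x₀)|. Moving from x by s along e therefore leaves room for a ball of radius s/4. Near
an interior point x itself serves as the centre. -/
lemma isOpen_corkscrew {Ω : Set E3} (hΩ : IsSmoothBoundedDomain Ω) {x₀ : E3} (hx₀ : x₀ ∈ closure Ω) :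
    ∃ δ > 0, ∀ x ∈ Ω, dist x x₀ < δ → ∀ s, 0 < s → s ≤ δ →
      ∃ z, Metric.ball z (s / 4) ⊆ Ω ∩ Metric.ball x (2 * s) := by
  by_cases hin : x₀ ∈ Ω
  · obtain ⟨ε, hε, hball⟩ := Metric.isOpen_iff.1 hΩ.isOpen x₀ hin
    refine ⟨ε / 2, by positivity, fun x _ hxd s hs hsδ => ⟨x, fun y hy => ⟨hball ?_, ?_⟩⟩⟩
    · rw [Metric.mem_ball] at hy ⊢
      linarith [dist_triangle y x x₀]
    · rw [Metric.mem_ball] at hy ⊢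
      linarith
  have hfr : x₀ ∈ frontier Ω := ⟨hx₀, by rwa [hΩ.isOpen.interior_eq]⟩
  obtain ⟨U, hU, ρ, hρ, hρ0, hUρ⟩ := hΩ.smooth_boundary x₀ hfr
  set L := fderiv ℝ ρ x₀ with hL
  set n := ‖L‖ with hn
  have hnpos : 0 < n := norm_pos_iff.2 hρ0
  set g := (InnerProductSpace.toDual ℝ E3).symm L with hg
  have hgn : ‖g‖ = n := by simp [hg, hn]
  set e : E3 := -(n⁻¹ • g) with he
  have hen : ‖e‖ = 1 := by
    rw [he, norm_neg, norm_smul, hgn, norm_inv, Real.norm_of_nonneg hnpos.le,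
      inv_mul_cancel₀ hnpos.ne']
  have hLe : L e = -n := by
    have h1 : L g = n ^ 2 := by
      have : L g = inner ℝ g g := by rw [hg, InnerProductSpace.toDual_symm_apply]
      rw [this, real_inner_self_eq_norm_sq, hgn]
    rw [he, map_neg, map_smul, h1, smul_eq_mul]
    field_simp
  have hcont : Continuous (fderiv ℝ ρ) := hρ.continuous_fderiv (by simp)
  obtain ⟨δ₁, hδ₁, h1⟩ := Metric.continuous_iff.1 hcont x₀ (n / 4) (by positivity)
  obtain ⟨δ₂, hδ₂, h2⟩ := Metric.mem_nhds_iff.1 hU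
  set δ := min δ₁ δ₂ with hδ
  have hδpos : 0 < δ := lt_min hδ₁ hδ₂
  -- With |x − x₀| < δ/4, s ≤ δ/4 and |y − x| ≤ 5s/4, all points stay in the ball of radius δ, where
  -- Dρ differs from L by at most n/4.
  refine ⟨δ / 4, by positivity, fun x hx hxd s hs hsδ => ⟨x + s • e, fun y hy => ?_⟩⟩
  rw [Metric.mem_ball, dist_eq_norm] at hy
  have hyx : y - x = s • e + (y - (x + s • e)) := by abel
  have hse : ‖s • e‖ = s := by rw [norm_smul, hen, mul_one, Real.norm_of_nonneg hs.le]
  have hyxn : ‖y - x‖ ≤ 5 / 4 * s := by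
    rw [hyx]
    refine (norm_add_le _ _).trans ?_
    rw [hse]; linarith
  have hxb : x ∈ Metric.ball x₀ δ := by rw [Metric.mem_ball]; linarith
  have hyb : y ∈ Metric.ball x₀ δ := by
    rw [Metric.mem_ball]
    have := dist_triangle y x x₀
    rw [dist_eq_norm y x] at this
    linarith
  obtain ⟨c, hc, hceq⟩ := domain_mvt (f := ρ) (f' := fderiv ℝ ρ) (s := Metric.ball x₀ δ)
    (fun z _ => (hρ.differentiable (by simp) z).hasFDerivAt.hasFDerivWithinAt)
    (convex_ball x₀ δ) hxb hyb
  have hcb : c ∈ Metric.ball x₀ δ := (convex_ball x₀ δ).segment_subset hxb hyb hc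
  have hcd : ‖fderiv ℝ ρ c - L‖ ≤ n / 4 := by
    rw [← dist_eq_norm]
    exact (h1 c (lt_of_lt_of_le hcb (min_le_left _ _))).le
  have e1 : fderiv ℝ ρ c (y - x) = (fderiv ℝ ρ c - L) (y - x) + L (y - x) := by
    simp
  have e2 : L (y - x) = - (s * n) + L (y - (x + s • e)) := by
    conv_lhs => rw [hyx]
    rw [map_add, map_smul, hLe, smul_eq_mul]; ring
  have e3 : (fderiv ℝ ρ c - L) (y - x) ≤ n / 4 * (5 / 4 * s) :=
    (Real.le_norm_self _).trans ((ContinuousLinearMap.le_opNorm _ _).trans (by gcongr))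
  have e4 : L (y - (x + s • e)) ≤ n * (s / 4) :=
    (Real.le_norm_self _).trans ((ContinuousLinearMap.le_opNorm _ _).trans (by gcongr))
  have hbU : Metric.ball x₀ δ ⊆ U := (Metric.ball_subset_ball (min_le_right _ _)).trans h2
  have hρx : ρ x < 0 := (hUρ x (hbU hxb)).1 hx
  refine ⟨(hUρ y (hbU hyb)).2 ?_, ?_⟩
  -- Altogether ρ y − ρ x ≤ (5/16 − 1 + 1/4) s n = −(7/16) s n < 0.
  · have : 0 < s * n := by positivity
    nlinarith
  · rw [Metric.mem_ball, dist_eq_norm]; linarith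

/-- Moving x towards the centre of the cell by the fraction τ = s/(4π) puts every coordinate at
distance at least τπ = s/4 from the faces. The displacement is at most 2πτ = s/2, because the half
diagonal √3 π is below 2π. -/
lemma torus_corkscrew {x : E3} (hx : x ∈ torus.region) {s : ℝ} (hs : 0 < s) (hs1 : s ≤ 1) :
    ∃ z, Metric.ball z (s / 4) ⊆ torus.region ∩ Metric.ball x (2 * s) := by
  have hπ := Real.pi_pos
  have hπ3 := Real.pi_gt_three
  set τ := s / (4 * Real.pi) with hτ
  have hτπ : τ * Real.pi = s / 4 := by rw [hτ]; field_simp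
  have hτ0 : 0 < τ := by positivity
  have hτ1 : τ ≤ 1 := by rw [hτ, div_le_one (by positivity)]; linarith
  set c : E3 := WithLp.toLp 2 fun _ => Real.pi with hc
  have hci : ∀ i, c i = Real.pi := fun i => rfl
  have hx' : ∀ i, 0 ≤ x i ∧ x i ≤ 2 * Real.pi := fun i => hx i
  have hcx : ‖c - x‖ ≤ 2 * Real.pi := by
    rw [EuclideanSpace.norm_eq]
    refine Real.sqrt_le_iff.2 ⟨by positivity, ?_⟩
    have : ∀ i, ‖(c - x) i‖ ^ 2 ≤ Real.pi ^ 2 := fun i => by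
      rw [Real.norm_eq_abs, sq_abs, PiLp.sub_apply, hci]
      have := hx' i
      nlinarith
    rw [Fin.sum_univ_three]
    nlinarith [this 0, this 1, this 2]
  refine ⟨x + τ • (c - x), fun y hy => ⟨fun i => ?_, ?_⟩⟩
  · rw [Metric.mem_ball, dist_eq_norm] at hy
    have h1 : |y i - (x i + τ * (Real.pi - x i))| ≤ s / 4 := by
      have := (PiLp.norm_apply_le (y - (x + τ • (c - x))) i).trans hy.le
      simpa [hci] using this
    rw [abs_le] at h1
    have h2 : 0 ≤ (1 - τ) * x i := mul_nonneg (by linarith) (hx' i).1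
    have h3 : (1 - τ) * x i ≤ (1 - τ) * (2 * Real.pi) :=
      mul_le_mul_of_nonneg_left (hx' i).2 (by linarith)
    constructor <;> nlinarith
  · rw [Metric.mem_ball, dist_eq_norm] at hy ⊢
    have h1 : y - x = (y - (x + τ • (c - x))) + τ • (c - x) := by abel
    rw [h1]
    refine (norm_add_le _ _).trans_lt ?_
    rw [norm_smul, Real.norm_of_nonneg hτ0.le]
    nlinarith

variable {G : Geometry}

lemma isBounded_region (hG : G.Admissible) : Bornology.IsBounded G.region := by
  cases G with
  | dirichlet Ω => exact hG.isBounded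
  | torus =>
    refine (Metric.isBounded_closedBall (x := (0 : E3)) (r := 4 * Real.pi)).subset fun x hx => ?_
    rw [mem_closedBall_zero_iff, EuclideanSpace.norm_eq]
    refine Real.sqrt_le_iff.2 ⟨by positivity, ?_⟩
    have : ∀ i, ‖x i‖ ^ 2 ≤ (2 * Real.pi) ^ 2 := fun i => by
      rw [Real.norm_eq_abs, sq_abs]
      exact pow_le_pow_left₀ (hx i).1 (hx i).2 2
    rw [Fin.sum_univ_three]
    nlinarith [this 0, this 1, this 2, Real.pi_pos]

lemma measurableSet_region (hG : G.Admissible) : MeasurableSet G.region := by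
  cases G with
  | dirichlet Ω => exact hG.isOpen.measurableSet
  | torus =>
    have : torus.region = ⋂ i : Fin 3, (fun x : E3 => x i) ⁻¹' Icc 0 (2 * Real.pi) := by
      ext x; simp [region]
    rw [this]
    exact MeasurableSet.iInter fun i => (by fun_prop : Measurable fun x : E3 => x i) measurableSet_Icc

/-- Interior corkscrew condition for the region, at all small scales. -/
lemma exists_corkscrew (hG : G.Admissible) : ∃ s₀ > 0, ∀ x ∈ G.region, ∀ s, 0 < s → s ≤ s₀ →
    ∃ z, Metric.ball z (s / 4) ⊆ G.region ∩ Metric.ball x (2 * s) := by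
  cases G with
  | dirichlet Ω =>
    have hK : IsCompact (closure Ω) := hG.isBounded.isCompact_closure
    -- The admissible scale is only local; compactness of the closure makes it uniform.
    have := hK.induction_on (p := fun S => ∃ s₀ > 0, ∀ x ∈ Ω, x ∈ S → ∀ s, 0 < s → s ≤ s₀ →
      ∃ z, Metric.ball z (s / 4) ⊆ Ω ∩ Metric.ball x (2 * s))
      ⟨1, one_pos, by simp⟩
      (fun S S' hSS' ⟨s₀, h0, h⟩ => ⟨s₀, h0, fun x hx hxS => h x hx (hSS' hxS)⟩)
      (fun S S' ⟨s₀, h0, h⟩ ⟨s₁, h1, h'⟩ => ⟨min s₀ s₁, lt_min h0 h1, fun x hx hxS s hs hsle =>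
        hxS.elim (fun hxS => h x hx hxS s hs (hsle.trans (min_le_left _ _)))
          (fun hxS => h' x hx hxS s hs (hsle.trans (min_le_right _ _)))⟩)
      (fun x₀ hx₀ => by
        obtain ⟨δ, hδ, h⟩ := isOpen_corkscrew hG hx₀
        exact ⟨Metric.ball x₀ δ, mem_nhdsWithin_of_mem_nhds (Metric.ball_mem_nhds _ hδ), δ, hδ,
          fun x hx hxS => h x hx hxS⟩)
    obtain ⟨s₀, h0, h⟩ := this
    exact ⟨s₀, h0, fun x hx => h x hx (subset_closure hx)⟩
  | torus => exact ⟨1, one_pos, fun x hx s hs hs1 => torus_corkscrew hx hs hs1⟩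

lemma isFiniteMeasure_μ (hG : G.Admissible) : IsFiniteMeasure G.μ :=
  ⟨by rw [μ, Measure.restrict_apply_univ]; exact (isBounded_region hG).measure_lt_top⟩

lemma memLp_of_continuous (hG : G.Admissible) {F : Type*} [NormedAddCommGroup F]
    [SecondCountableTopologyEither E3 F] {φ : E3 → F}
    (hφ : Continuous φ) (p : ℝ≥0∞) : MemLp φ p G.μ := by
  have := isFiniteMeasure_μ hG
  obtain ⟨C, hC⟩ := (isBounded_region hG).isCompact_closure.exists_bound_of_continuousOn
    hφ.continuousOn
  refine MemLp.of_bound hφ.aestronglyMeasurable C ?_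
  rw [μ]
  filter_upwards [ae_restrict_mem (measurableSet_region hG)] with x hx
  exact hC x (subset_closure hx)

lemma continuous_gradient {φ : E3 → ℝ} (hφ : ContDiff ℝ 1 φ) : Continuous (gradient φ) :=
  (InnerProductSpace.toDual ℝ E3).symm.continuous.comp (hφ.continuous_fderiv one_ne_zero)

lemma IsTest.contDiff {φ : E3 → ℝ} (hφ : G.IsTest φ) : ContDiff ℝ ∞ φ := by
  cases G <;> exact hφ.1

lemma toL2_eq {F : Type} [NormedAddCommGroup F] {φ : E3 → F} (h : MemLp φ 2 G.μ) :
    G.toL2 φ = h.toLp φ := by rw [toL2, dif_pos h]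

lemma coeFn_toL2 {F : Type} [NormedAddCommGroup F] {φ : E3 → F} (h : MemLp φ 2 G.μ) :
    G.toL2 φ =ᵐ[G.μ] φ := by rw [toL2_eq h]; exact h.coeFn_toLp

lemma IsTest.memLp (hG : G.Admissible) {φ : E3 → ℝ} (hφ : G.IsTest φ) : MemLp φ 2 G.μ :=
  memLp_of_continuous hG hφ.contDiff.continuous 2

lemma IsTest.memLp_gradient (hG : G.Admissible) {φ : E3 → ℝ} (hφ : G.IsTest φ) :
    MemLp (gradient φ) 2 G.μ :=
  memLp_of_continuous hG (continuous_gradient (hφ.contDiff.of_le (by simp))) 2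

lemma gradient_add {φ ψ : E3 → ℝ} (hφ : Differentiable ℝ φ) (hψ : Differentiable ℝ ψ) :
    gradient (φ + ψ) = gradient φ + gradient ψ := by
  funext x
  simp [gradient, fderiv_add (hφ x) (hψ x)]

lemma gradient_smul {φ : E3 → ℝ} (hφ : Differentiable ℝ φ) (c : ℝ) :
    gradient (c • φ) = c • gradient φ := by
  funext x
  simp [gradient, fderiv_const_smul (hφ x) c]

lemma IsTest.add {φ ψ : E3 → ℝ} (hφ : G.IsTest φ) (hψ : G.IsTest ψ) : G.IsTest (φ + ψ) := by
  cases G with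
  | dirichlet Ω =>
    exact ⟨hφ.1.add hψ.1, hφ.2.1.add hψ.2.1,
      (tsupport_add φ ψ).trans (union_subset hφ.2.2 hψ.2.2)⟩
  | torus => exact ⟨hφ.1.add hψ.1, fun k x => by simp [hφ.2 k x, hψ.2 k x]⟩

lemma IsTest.smul {φ : E3 → ℝ} (hφ : G.IsTest φ) (c : ℝ) : G.IsTest (c • φ) := by
  cases G with
  | dirichlet Ω =>
    exact ⟨contDiff_const.smul hφ.1, hφ.2.1.smul_left (f := fun _ => c),
      (tsupport_smul_subset_right (fun _ => c) φ).trans hφ.2.2⟩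
  | torus => exact ⟨contDiff_const.smul hφ.1, fun k x => by simp [hφ.2 k x]⟩

lemma isTest_zero : G.IsTest 0 := by
  cases G with
  | dirichlet Ω => exact ⟨contDiff_const, HasCompactSupport.zero, by simp⟩
  | torus => exact ⟨contDiff_const, fun k x => rfl⟩

/-- The pair `(φ, ∇φ)` in `L² × L²`. -/
def testPair (G : Geometry) (φ : E3 → ℝ) : WithLp 2 (G.L2 × G.L2Vec) :=
  WithLp.toLp 2 (G.toL2 φ, G.toL2 (gradient φ))

lemma toL2_add {F : Type} [NormedAddCommGroup F] {φ ψ : E3 → F} (hφ : MemLp φ 2 G.μ)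
    (hψ : MemLp ψ 2 G.μ) : G.toL2 (φ + ψ) = G.toL2 φ + G.toL2 ψ := by
  rw [toL2_eq hφ, toL2_eq hψ, toL2_eq (hφ.add hψ), MemLp.toLp_add]

lemma toL2_smul {F : Type} [NormedAddCommGroup F] [NormedSpace ℝ F] {φ : E3 → F}
    (hφ : MemLp φ 2 G.μ) (c : ℝ) : G.toL2 (c • φ) = c • G.toL2 φ := by
  rw [toL2_eq hφ, toL2_eq (hφ.const_smul c), MemLp.toLp_const_smul]

lemma toL2_zero {F : Type} [NormedAddCommGroup F] : G.toL2 (0 : E3 → F) = 0 := by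
  have h : MemLp (0 : E3 → F) 2 G.μ := MemLp.zero
  rw [toL2_eq h]
  exact MemLp.toLp_zero h

lemma testPair_zero : G.testPair 0 = 0 := by
  have h1 : gradient (0 : E3 → ℝ) = 0 := by funext x; simp [gradient]
  rw [testPair, h1, toL2_zero, toL2_zero, ← Prod.zero_eq_mk, WithLp.toLp_zero]

lemma testPair_add (hG : G.Admissible) {φ ψ : E3 → ℝ} (hφ : G.IsTest φ) (hψ : G.IsTest ψ) :
    G.testPair (φ + ψ) = G.testPair φ + G.testPair ψ := by
  have h1 := toL2_add (hφ.memLp hG) (hψ.memLp hG)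
  have h2 := toL2_add (hφ.memLp_gradient hG) (hψ.memLp_gradient hG)
  rw [testPair, gradient_add (hφ.contDiff.differentiable (by simp))
    (hψ.contDiff.differentiable (by simp)), h1, h2]
  exact WithLp.toLp_add 2 (G.toL2 φ, G.toL2 (gradient φ)) (G.toL2 ψ, G.toL2 (gradient ψ))

lemma testPair_smul (hG : G.Admissible) {φ : E3 → ℝ} (hφ : G.IsTest φ) (c : ℝ) :
    G.testPair (c • φ) = c • G.testPair φ := by
  have h1 := toL2_smul (hφ.memLp hG) c
  have h2 := toL2_smul (hφ.memLp_gradient hG) c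
  rw [testPair, gradient_smul (hφ.contDiff.differentiable (by simp)), h1, h2]
  exact WithLp.toLp_smul 2 c (G.toL2 φ, G.toL2 (gradient φ))

/-- Test functions form a vector space on which φ ↦ (φ, ∇φ) is linear, so taking the span adds
nothing. -/
lemma mem_span_test (hG : G.Admissible) {p : WithLp 2 (G.L2 × G.L2Vec)}
    (hp : p ∈ Submodule.span ℝ {p | ∃ φ, G.IsTest φ ∧
      p = WithLp.toLp 2 (G.toL2 φ, G.toL2 (gradient φ))}) :
    ∃ φ, G.IsTest φ ∧ p = G.testPair φ := by
  induction hp using Submodule.span_induction with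
  | mem p h => exact h
  | zero => exact ⟨0, isTest_zero, testPair_zero.symm⟩
  | add p q _ _ hp hq =>
    obtain ⟨φ, hφ, rfl⟩ := hp
    obtain ⟨ψ, hψ, rfl⟩ := hq
    exact ⟨φ + ψ, hφ.add hψ, (testPair_add hG hφ hψ).symm⟩
  | smul c p _ hp =>
    obtain ⟨φ, hφ, rfl⟩ := hp
    exact ⟨c • φ, hφ.smul c, (testPair_smul hG hφ c).symm⟩

lemma testPair_mem_H1 {φ : E3 → ℝ} (hφ : G.IsTest φ) : G.testPair φ ∈ G.H1 :=
  Submodule.le_topologicalClosure _ (Submodule.subset_span ⟨φ, hφ, rfl⟩)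

/-- Members of `H¹` are limits of test functions. -/
lemma exists_seq_test (hG : G.Admissible) (u : G.H1) : ∃ φ : ℕ → E3 → ℝ, (∀ n, G.IsTest (φ n)) ∧
    Tendsto (fun n => G.testPair (φ n)) atTop (𝓝 (u : WithLp 2 (G.L2 × G.L2Vec))) := by
  have h : (u : WithLp 2 (G.L2 × G.L2Vec)) ∈ closure (Submodule.span ℝ {p | ∃ φ, G.IsTest φ ∧
      p = WithLp.toLp 2 (G.toL2 φ, G.toL2 (gradient φ))} : Set (WithLp 2 (G.L2 × G.L2Vec))) := u.2
  obtain ⟨p, hp, hlim⟩ := mem_closure_iff_seq_limit.1 h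
  choose φ hφ hpφ using fun n => mem_span_test hG (hp n)
  exact ⟨φ, hφ, (funext hpφ : p = _) ▸ hlim⟩

/-- Inclusion of `H¹` in `L²`. -/
def valL (G : Geometry) : G.H1 →L[ℝ] G.L2 := (WithLp.fstL 2 ℝ G.L2 G.L2Vec).comp G.H1.subtypeL

/-- The gradient as an operator on `H¹`. -/
def gradL (G : Geometry) : G.H1 →L[ℝ] G.L2Vec :=
  (WithLp.sndL 2 ℝ G.L2 G.L2Vec).comp G.H1.subtypeL

lemma valL_apply (u : G.H1) : G.valL u = val u := rfl
lemma gradL_apply (u : G.H1) : G.gradL u = grad u := rfl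

lemma inner_H1 (u q : G.H1) : inner ℝ u q = inner ℝ (val u) (val q) + inner ℝ (grad u) (grad q) := by
  rw [Submodule.coe_inner, WithLp.prod_inner_apply]; rfl

lemma norm_sq_H1 (u : G.H1) : ‖u‖ ^ 2 = ‖val u‖ ^ 2 + ‖grad u‖ ^ 2 := by
  rw [← real_inner_self_eq_norm_sq, inner_H1, real_inner_self_eq_norm_sq, real_inner_self_eq_norm_sq]

lemma norm_val_le (u : G.H1) : ‖val u‖ ≤ ‖u‖ :=
  abs_le_of_sq_le_sq' (by rw [norm_sq_H1]; nlinarith [sq_nonneg ‖grad u‖]) (norm_nonneg _) |>.2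

lemma norm_grad_le (u : G.H1) : ‖grad u‖ ≤ ‖u‖ :=
  abs_le_of_sq_le_sq' (by rw [norm_sq_H1]; nlinarith [sq_nonneg ‖val u‖]) (norm_nonneg _) |>.2

instance : CompleteSpace G.H1 :=
  (Submodule.isClosed_topologicalClosure _).completeSpace_coe

end Region

end Geometry

namespace Geometry

variable {G : Geometry}

/-! ### From H^{3/2} to integrability of |∇u|^{8/3} -/

section GradientIntegrability

lemma lintegral_enorm_sq {F : Type*} [NormedAddCommGroup F] (w : Lp F 2 G.μ) :
    ∫⁻ x, ‖w x‖ₑ ^ 2 ∂G.μ = ‖w‖ₑ ^ 2 := by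
  rw [Lp.enorm_def, eLpNorm_eq_lintegral_rpow_enorm_toReal (by simp) (by simp)]
  simp only [ENNReal.toReal_ofNat, ENNReal.rpow_ofNat, one_div]
  rw [← ENNReal.rpow_natCast, ← ENNReal.rpow_mul]
  norm_num

lemma ae_mem_region (hG : G.Admissible) : ∀ᵐ x ∂G.μ, x ∈ G.region :=
  ae_restrict_mem (measurableSet_region hG)

/-- Only this direction is needed: it bounds the kernel 1/d⁴ from below on Euclidean balls, for the
torus as well. -/
lemma distance_le (x y : E3) : G.distance x y ≤ ‖x - y‖ := by
  cases G with
  | dirichlet Ω => exact le_rfl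
  | torus =>
    refine (ciInf_le ⟨0, ?_⟩ 0).trans (le_of_eq ?_)
    · rintro _ ⟨k, rfl⟩; exact norm_nonneg _
    · have : latticeVec 0 = 0 := by ext i; simp [latticeVec]
      rw [this, add_zero]

/-- The inner integral in the Slobodeckij seminorm of the gradient. -/
def slobodeckijDensity (u : G.H1) (x : E3) : ℝ≥0∞ :=
  ∫⁻ y, ‖grad u x - grad u y‖ₑ ^ 2 / ENNReal.ofReal (G.distance x y) ^ 4 ∂G.μ

/-- The bound survives d ≤ 0, where the quotient is `⊤` unless a = 0. -/
lemma le_pow_mul_div (a : ℝ≥0∞) {d b : ℝ} (hb : 0 < b) (hd : d ≤ b) :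
    a ≤ ENNReal.ofReal b ^ 4 * (a / ENNReal.ofReal d ^ 4) := by
  have hb0 : ENNReal.ofReal b ≠ 0 := by simpa using hb
  rcases le_or_gt d 0 with h | h
  · rw [ENNReal.ofReal_of_nonpos h]
    rcases eq_or_ne a 0 with rfl | ha
    · simp
    · simp [ENNReal.div_zero ha, ENNReal.mul_top (pow_ne_zero 4 hb0)]
  · have hd0 : ENNReal.ofReal d ≠ 0 := by simpa using h
    calc a = ENNReal.ofReal d ^ 4 * (a / ENNReal.ofReal d ^ 4) := by
          rw [ENNReal.mul_div_cancel (pow_ne_zero 4 hd0) (by simp)]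
      _ ≤ _ := by gcongr

/-- Comparison of the value of the gradient at a point with its average over a nearby ball. -/
lemma ball_mul_enorm_sq_le (u : G.H1) {x z : E3} {s : ℝ} (hs : 0 < s)
    (hz : Metric.ball z (s / 4) ⊆ G.region ∩ Metric.ball x (2 * s)) :
    volume (Metric.ball z (s / 4)) * ‖grad u x‖ₑ ^ 2 ≤
      ENNReal.ofReal 2 *
        (ENNReal.ofReal (2 * s) ^ 4 * slobodeckijDensity u x + ‖grad u‖ₑ ^ 2) := by
  rw [ENNReal.ofReal_ofNat]
  set B := Metric.ball z (s / 4)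
  have hBμ : G.μ.restrict B = volume.restrict B := by
    rw [μ, Measure.restrict_restrict measurableSet_ball,
      inter_eq_left.2 (hz.trans inter_subset_left)]
  have hm : AEMeasurable (fun y => ‖grad u y‖ₑ ^ 2) (G.μ.restrict B) :=
    ((Lp.aestronglyMeasurable (grad u)).enorm.pow_const 2).restrict
  calc volume B * ‖grad u x‖ₑ ^ 2 = ∫⁻ _ in B, ‖grad u x‖ₑ ^ 2 ∂G.μ := by
        rw [hBμ, setLIntegral_const, mul_comm]
    -- The inequality (a + b)² ≤ 2(a² + b²) is applied to ∇u(x) = (∇u(x) − ∇u(y)) + ∇u(y); on B the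
    -- distance from x to y is at most 2s.
    _ ≤ ∫⁻ y in B, 2 * (ENNReal.ofReal (2 * s) ^ 4 *
          (‖grad u x - grad u y‖ₑ ^ 2 / ENNReal.ofReal (G.distance x y) ^ 4) + ‖grad u y‖ₑ ^ 2)
          ∂G.μ := by
        refine setLIntegral_mono_ae' measurableSet_ball (ae_of_all _ fun y hy => ?_)
        have h1 : ‖grad u x‖ₑ ≤ ‖grad u x - grad u y‖ₑ + ‖grad u y‖ₑ := by
          simpa using enorm_add_le (grad u x - grad u y) (grad u y)
        have h2 : (‖grad u x - grad u y‖ₑ + ‖grad u y‖ₑ) ^ 2 ≤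
            2 * (‖grad u x - grad u y‖ₑ ^ 2 + ‖grad u y‖ₑ ^ 2) := by
          have := ENNReal.rpow_add_le_mul_rpow_add_rpow ‖grad u x - grad u y‖ₑ ‖grad u y‖ₑ
            (p := 2) (by norm_num)
          norm_num at this
          simpa using this
        refine (pow_le_pow_left₀ (by positivity) h1 2).trans (h2.trans ?_)
        gcongr
        refine le_pow_mul_div _ (by positivity) ((distance_le x y).trans ?_)
        have := (hz hy).2
        rw [Metric.mem_ball, dist_comm, dist_eq_norm] at this
        exact this.le
    _ = 2 * (ENNReal.ofReal (2 * s) ^ 4 * (∫⁻ y in B, ‖grad u x - grad u y‖ₑ ^ 2 /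
          ENNReal.ofReal (G.distance x y) ^ 4 ∂G.μ) + ∫⁻ y in B, ‖grad u y‖ₑ ^ 2 ∂G.μ) := by
        rw [lintegral_const_mul' _ _ (by simp), lintegral_add_right' _ hm,
          lintegral_const_mul' _ _ (ENNReal.pow_ne_top ENNReal.ofReal_ne_top)]
    _ ≤ _ := by
        rw [← lintegral_enorm_sq (grad u), slobodeckijDensity]
        gcongr <;> exact Measure.restrict_le_self

/-- The scale is optimized: s proportional to (1 + g)^{−1/4} balances s⁴g against the constant and
leaves a² ≤ C (1 + g)^{3/4}. The power 4/3 of this is the claim, which is where the exponent 8/3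
comes from. -/
lemma rpow_bound_of_scales {κ s₀ R g a : ℝ} (hκ : 0 < κ) (hs₀ : 0 < s₀) (hg : 0 ≤ g) (ha : 0 ≤ a)
    (h : ∀ s, 0 < s → s ≤ s₀ → κ * s ^ 3 * a ^ 2 ≤ 32 * s ^ 4 * g + 2 * R ^ 2) :
    a ^ (8 / 3 : ℝ) ≤ ((32 * s₀ + 2 * R ^ 2 * (s₀ ^ 3)⁻¹) / κ) ^ (4 / 3 : ℝ) * (1 + g) := by
  set q : ℝ := (1 + g) ^ (1 / 4 : ℝ) with hq
  have hg1 : 0 < 1 + g := by linarith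
  have hqpos : 0 < q := Real.rpow_pos_of_pos hg1 _
  have hq1 : 1 ≤ q := Real.one_le_rpow (by linarith) (by norm_num)
  have hq4 : q ^ 4 = 1 + g := by
    rw [hq, ← Real.rpow_natCast, ← Real.rpow_mul hg1.le]; norm_num
  -- At the scale s₀/q the term s⁴g is at most s₀⁴, and q ≥ 1 keeps the scale admissible.
  have h1 := h (s₀ / q) (by positivity) (div_le_self hs₀.le hq1)
  have h2 : a ^ 2 ≤ (32 * s₀ + 2 * R ^ 2 * (s₀ ^ 3)⁻¹) / κ * q ^ 3 := by
    have e1 : κ * (s₀ / q) ^ 3 * a ^ 2 = (κ * a ^ 2) * (s₀ ^ 3 / q ^ 3) := by rw [div_pow]; ring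
    have e2 : 32 * (s₀ / q) ^ 4 * g + 2 * R ^ 2 ≤
        ((32 * s₀ + 2 * R ^ 2 * (s₀ ^ 3)⁻¹) * q ^ 3) * (s₀ ^ 3 / q ^ 3) := by
      have : ((32 * s₀ + 2 * R ^ 2 * (s₀ ^ 3)⁻¹) * q ^ 3) * (s₀ ^ 3 / q ^ 3) =
        32 * s₀ ^ 4 + 2 * R ^ 2 := by field_simp
      rw [this, div_pow, hq4]
      have hle : s₀ ^ 4 / (1 + g) * g ≤ s₀ ^ 4 := by
        rw [div_mul_eq_mul_div, div_le_iff₀ hg1]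
        have : 0 < s₀ ^ 4 := by positivity
        nlinarith
      linarith
    rw [e1] at h1
    have h3 := le_of_mul_le_mul_right (h1.trans e2) (by positivity)
    rw [div_mul_eq_mul_div, le_div_iff₀ hκ]
    linarith
  have hC : 0 ≤ (32 * s₀ + 2 * R ^ 2 * (s₀ ^ 3)⁻¹) / κ := by positivity
  calc a ^ (8 / 3 : ℝ) = (a ^ 2) ^ (4 / 3 : ℝ) := by
        rw [← Real.rpow_natCast, ← Real.rpow_mul ha]; norm_num
    _ ≤ ((32 * s₀ + 2 * R ^ 2 * (s₀ ^ 3)⁻¹) / κ * q ^ 3) ^ (4 / 3 : ℝ) := by gcongr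
    _ = _ := by
        rw [Real.mul_rpow hC (by positivity), ← hq4]
        congr 1
        rw [← Real.rpow_natCast, ← Real.rpow_mul hqpos.le, ← Real.rpow_natCast]
        norm_num

/-- The embedding of `H^{3/2} ∩ H¹` in `W^{1,8/3}`, with the scaling of the Slobodeckij norm. -/
lemma exists_lintegral_grad_rpow_le (hG : G.Admissible) (R : ℝ) : ∃ C : ℝ≥0, ∀ u : G.H1, ‖u‖ ≤ R →
    ∫⁻ x, ‖grad u x‖ₑ ^ (8 / 3 : ℝ) ∂G.μ ≤ C * (1 + G.hThreeHalvesNormSq u) := by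
  have := isFiniteMeasure_μ hG
  obtain ⟨s₀, hs₀, hcork⟩ := exists_corkscrew hG
  set κ₀ : ℝ := (volume (Metric.ball (0 : E3) 1)).toReal with hκ₀
  have hκ₀pos : 0 < κ₀ := ENNReal.toReal_pos (Metric.measure_ball_pos _ _ one_pos).ne'
    measure_ball_lt_top.ne
  have hvol : ∀ z s, 0 < s → volume (Metric.ball (z : E3) (s / 4)) =
      ENNReal.ofReal (κ₀ / 64 * s ^ 3) := by
    intro z s hs
    rw [Measure.addHaar_ball _ _ (by positivity), finrank_euclideanSpace_fin,
      ← ENNReal.ofReal_toReal (measure_ball_lt_top (μ := volume) (x := (0 : E3)) (r := 1)).ne, ← hκ₀,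
      ← ENNReal.ofReal_mul (by positivity)]
    congr 1; ring
  set C₀ : ℝ := ((32 * s₀ + 2 * R ^ 2 * (s₀ ^ 3)⁻¹) / (κ₀ / 64)) ^ (4 / 3 : ℝ) with hC₀
  have hC₀n : 0 ≤ C₀ := by positivity
  refine ⟨C₀.toNNReal * ((G.μ univ).toNNReal + 1), fun u hu => ?_⟩
  have hpt : ∀ x ∈ G.region, ‖grad u x‖ₑ ^ (8 / 3 : ℝ) ≤
      ENNReal.ofReal C₀ * (1 + slobodeckijDensity u x) := by
    intro x hx
    rcases eq_or_ne (slobodeckijDensity u x) ⊤ with ht | ht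
    · rw [ht]
      have : 0 < C₀ := by
        have : 0 < (32 * s₀ + 2 * R ^ 2 * (s₀ ^ 3)⁻¹) / (κ₀ / 64) := by positivity
        exact Real.rpow_pos_of_pos this _
      simp [ENNReal.mul_top, this]
    set g := (slobodeckijDensity u x).toReal with hg
    have hgof : slobodeckijDensity u x = ENNReal.ofReal g := (ENNReal.ofReal_toReal ht).symm
    -- The ball of radius s/4 has volume (κ₀/64) s³, and 2(2s)⁴ = 32 s⁴ accounts for the other
    -- constant.
    have hreal := rpow_bound_of_scales (κ := κ₀ / 64) (s₀ := s₀) (R := R) (g := g)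
      (a := ‖grad u x‖) (by positivity) hs₀ ENNReal.toReal_nonneg (norm_nonneg _) (by
        intro s hs hss
        obtain ⟨z, hz⟩ := hcork x hx s hs hss
        have h1 := ball_mul_enorm_sq_le u hs hz
        rw [hvol z s hs, hgof, ← ofReal_norm, ← ofReal_norm,
          ← ENNReal.ofReal_pow (norm_nonneg _), ← ENNReal.ofReal_pow (norm_nonneg _),
          ← ENNReal.ofReal_pow (by positivity), ← ENNReal.ofReal_mul (by positivity),
          ← ENNReal.ofReal_mul (by positivity),
          ← ENNReal.ofReal_add (mul_nonneg (by positivity) ENNReal.toReal_nonneg) (by positivity),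
          ← ENNReal.ofReal_mul (by positivity),
          ENNReal.ofReal_le_ofReal_iff (mul_nonneg (by norm_num)
            (add_nonneg (mul_nonneg (by positivity) ENNReal.toReal_nonneg) (by positivity)))] at h1
        have h2 : ‖grad u‖ ^ 2 ≤ R ^ 2 :=
          pow_le_pow_left₀ (norm_nonneg _) ((norm_grad_le u).trans hu) 2
        calc _ ≤ _ := h1
          _ ≤ _ := by ring_nf; ring_nf at h2; linarith)
    rw [← hC₀] at hreal
    rw [hgof, ← ENNReal.ofReal_one, ← ENNReal.ofReal_add zero_le_one ENNReal.toReal_nonneg,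
      ← ENNReal.ofReal_mul hC₀n, ← ofReal_norm,
      ENNReal.ofReal_rpow_of_nonneg (norm_nonneg _) (by norm_num)]
    exact ENNReal.ofReal_le_ofReal hreal
  have hS : ∫⁻ x, slobodeckijDensity u x ∂G.μ ≤ G.hThreeHalvesNormSq u := le_add_self
  calc ∫⁻ x, ‖grad u x‖ₑ ^ (8 / 3 : ℝ) ∂G.μ
      ≤ ∫⁻ x, ENNReal.ofReal C₀ * (1 + slobodeckijDensity u x) ∂G.μ := by
        refine lintegral_mono_ae ?_
        filter_upwards [ae_mem_region hG] with x hx using hpt x hx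
    _ = ENNReal.ofReal C₀ * (G.μ univ + ∫⁻ x, slobodeckijDensity u x ∂G.μ) := by
        rw [lintegral_const_mul' _ _ (by simp), lintegral_add_left measurable_const,
          lintegral_const, one_mul]
    _ ≤ ENNReal.ofReal C₀ * ((G.μ univ + 1) * (1 + G.hThreeHalvesNormSq u)) := by
        gcongr
        calc G.μ univ + ∫⁻ x, slobodeckijDensity u x ∂G.μ
            ≤ G.μ univ + G.hThreeHalvesNormSq u := by gcongr
          _ ≤ (G.μ univ + G.hThreeHalvesNormSq u) +
              (G.μ univ * G.hThreeHalvesNormSq u + 1) := le_self_add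
          _ = _ := by ring
    _ = _ := by
        rw [← mul_assoc]
        congr 1
        push_cast
        rw [ENNReal.coe_toNNReal (measure_ne_top _ _)]
        rfl

end GradientIntegrability

end Geometry

namespace Geometry

variable {G : Geometry}

/-! ### Sobolev's inequality on H¹ and the L¹⁰ bound -/

section Sobolev

/-- The Gagliardo-Nirenberg-Sobolev inequality `‖w‖₆ ≤ C ‖∇w‖₂`, with powers. -/
lemma exists_lintegral_pow_six_le : ∃ C : ℝ≥0, ∀ w : E3 → ℝ, ContDiff ℝ 1 w → HasCompactSupport w →
    ∫⁻ x, ‖w x‖ₑ ^ 6 ≤ (C * ∫⁻ x, ‖fderiv ℝ w x‖ₑ ^ 2) ^ 3 := by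
  refine ⟨(eLpNormLESNormFDerivOfEqInnerConst (volume : Measure E3) (2 : ℝ≥0)) ^ 2,
    fun w hw hwc => ?_⟩
  have h := eLpNorm_le_eLpNorm_fderiv_of_eq_inner (volume : Measure E3) hw hwc
    (p := 2) (p' := 6) (by norm_num) (by simp) (by simp; norm_num)
  set C := eLpNormLESNormFDerivOfEqInnerConst (volume : Measure E3) (2 : ℝ≥0)
  rw [eLpNorm_eq_lintegral_rpow_enorm_toReal (by simp) (by simp),
    eLpNorm_eq_lintegral_rpow_enorm_toReal (by simp) (by simp)] at h
  simp only [ENNReal.coe_toReal, NNReal.coe_ofNat, ENNReal.rpow_ofNat] at h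
  have h6 := pow_le_pow_left₀ (by positivity) h 6
  rw [← ENNReal.rpow_natCast, ← ENNReal.rpow_mul, mul_pow] at h6
  norm_num at h6
  refine h6.trans (le_of_eq ?_)
  rw [mul_pow, ENNReal.coe_pow, ← pow_mul]
  congr 1
  rw [← ENNReal.rpow_natCast, ← ENNReal.rpow_mul, ← ENNReal.rpow_natCast]
  norm_num

/-- A bounded neighbourhood of the cell is covered by finitely many translates of it. -/
lemma setLIntegral_periodic_le {F : E3 → ℝ≥0∞} (hF : ∀ k x, F (x + latticeVec k) = F x) {B : Set E3}
    (hB : ∀ x ∈ B, ∀ i, x i ∈ Icc (-(2 * Real.pi)) (4 * Real.pi)) :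
    ∫⁻ x in B, F x ≤ 27 * ∫⁻ x, F x ∂torus.μ := by
  -- Three shifts in each coordinate direction cover [−2π, 4π]³, whence 3³ = 27 translates.
  set S : Finset (Fin 3 → ℤ) := Fintype.piFinset fun _ => {-1, 0, 1} with hS
  have hcard : S.card = 27 := by rw [hS, Fintype.card_piFinset]; rfl
  have hcov : B ⊆ ⋃ k ∈ S, (fun x => x - latticeVec k) ⁻¹' torus.region := by
    intro x hx
    have : ∀ i, ∃ k : ℤ, k ∈ ({-1, 0, 1} : Finset ℤ) ∧ x i - 2 * Real.pi * k ∈ Icc 0 (2 * Real.pi) := by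
      intro i
      have h := hB x hx i
      rw [mem_Icc] at h
      rcases lt_or_ge (x i) 0 with h1 | h1
      · exact ⟨-1, by simp, by push_cast; constructor <;> linarith⟩
      rcases le_or_gt (x i) (2 * Real.pi) with h2 | h2
      · exact ⟨0, by simp, by push_cast; constructor <;> linarith⟩
      · exact ⟨1, by simp, by push_cast; constructor <;> linarith⟩
    choose k hk hkx using this
    simp only [mem_iUnion]
    exact ⟨k, Fintype.mem_piFinset.2 hk, fun i => by simpa [latticeVec] using hkx i⟩
  calc ∫⁻ x in B, F x ≤ ∫⁻ x in ⋃ k ∈ S, (fun x => x - latticeVec k) ⁻¹' torus.region, F x :=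
        lintegral_mono_set hcov
    _ ≤ ∑ k ∈ S, ∫⁻ x in (fun x => x - latticeVec k) ⁻¹' torus.region, F x := by
        have hle : volume.restrict (⋃ k ∈ S, (fun x => x - latticeVec k) ⁻¹' torus.region) ≤
            ∑ k ∈ S, volume.restrict ((fun x : E3 => x - latticeVec k) ⁻¹' torus.region) := by
          refine Measure.le_iff.2 fun A hA => ?_
          rw [Measure.restrict_apply hA, Measure.finsetSum_apply, inter_iUnion₂]
          refine (measure_biUnion_finset_le S _).trans (le_of_eq ?_)
          simp only [Measure.restrict_apply hA]
        refine (lintegral_mono' hle le_rfl).trans (le_of_eq ?_)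
        rw [lintegral_finsetSum_measure]
    _ = ∑ k ∈ S, ∫⁻ x, F x ∂torus.μ := by
        refine Finset.sum_congr rfl fun k _ => ?_
        have := (measurePreserving_sub_right (volume : Measure E3)
          (latticeVec k)).setLIntegral_comp_preimage_emb
          (MeasurableEquiv.subRight (latticeVec k)).measurableEmbedding F torus.region
        rw [μ, ← this]
        refine lintegral_congr fun x => ?_
        rw [← hF k (x - latticeVec k), sub_add_cancel]
    _ = _ := by rw [Finset.sum_const, hcard, nsmul_eq_mul]; norm_num

lemma fderiv_comp_norm_sq {φ : E3 → ℝ} {ψ : ℝ → ℝ} (hφ : Differentiable ℝ φ)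
    (hψ : Differentiable ℝ ψ) (x : E3) :
    ‖fderiv ℝ (fun x => ψ (φ x)) x‖ₑ ^ 2 = ‖deriv ψ (φ x)‖ₑ ^ 2 * ‖gradient φ x‖ₑ ^ 2 := by
  have h := (hψ (φ x)).hasDerivAt.comp_hasFDerivAt x (hφ x).hasFDerivAt
  have h2 : ‖gradient φ x‖ₑ = ‖fderiv ℝ φ x‖ₑ := by
    rw [gradient, LinearIsometryEquiv.enorm_map]
  rw [HasFDerivAt.fderiv (f := fun x => ψ (φ x)) h, enorm_smul, mul_pow, h2]

lemma enorm_add_sq_le {F : Type*} [NormedAddCommGroup F] (a b : F) :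
    ‖a + b‖ₑ ^ 2 ≤ 2 * (‖a‖ₑ ^ 2 + ‖b‖ₑ ^ 2) := by
  refine (pow_le_pow_left₀ (by positivity) (enorm_add_le a b) 2).trans ?_
  have := ENNReal.rpow_add_le_mul_rpow_add_rpow ‖a‖ₑ ‖b‖ₑ (p := 2) (by norm_num)
  norm_num at this
  simpa using this

/-- A bump at the centre of the cell with radii 2π and 3π. The inner ball contains the cell since √3
π ≤ 2π, and the outer one lies in [−2π, 4π]³. -/
lemma exists_torus_cutoff : ∃ χ : E3 → ℝ, ContDiff ℝ 1 χ ∧ HasCompactSupport χ ∧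
    (∀ x, 0 ≤ χ x ∧ χ x ≤ 1) ∧ (∀ x ∈ torus.region, χ x = 1) ∧
    (∀ x ∈ tsupport χ, ∀ i, x i ∈ Icc (-(2 * Real.pi)) (4 * Real.pi)) := by
  have hπ := Real.pi_pos
  set c : E3 := WithLp.toLp 2 fun _ => Real.pi with hc
  have hci : ∀ i, c i = Real.pi := fun i => rfl
  let χ : ContDiffBump c := ⟨2 * Real.pi, 3 * Real.pi, by positivity, by linarith⟩
  refine ⟨χ, χ.contDiff, χ.hasCompactSupport, fun x => ⟨χ.nonneg, χ.le_one⟩, fun x hx => ?_,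
    fun x hx i => ?_⟩
  · refine χ.one_of_mem_closedBall ?_
    rw [mem_closedBall_iff_norm, EuclideanSpace.norm_eq]
    refine Real.sqrt_le_iff.2 ⟨by positivity, ?_⟩
    have : ∀ i, ‖(x - c) i‖ ^ 2 ≤ Real.pi ^ 2 := fun i => by
      rw [Real.norm_eq_abs, sq_abs, PiLp.sub_apply, hci]
      have := hx i
      rw [mem_Icc] at this
      nlinarith
    rw [Fin.sum_univ_three]
    nlinarith [this 0, this 1, this 2]
  · rw [χ.tsupport_eq, mem_closedBall_iff_norm] at hx
    have h1 := (PiLp.norm_apply_le (x - c) i).trans hx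
    rw [PiLp.sub_apply, hci, Real.norm_eq_abs, abs_le] at h1
    simp only [χ] at h1
    constructor <;> linarith [h1.1, h1.2]

/-- Sobolev's inequality for compositions of test functions with `C¹` functions. -/
lemma exists_sobolev_test (hG : G.Admissible) : ∃ C : ℝ≥0, ∀ φ : E3 → ℝ, G.IsTest φ → ∀ ψ : ℝ → ℝ,
    ContDiff ℝ 1 ψ → ψ 0 = 0 → ∫⁻ x, ‖ψ (φ x)‖ₑ ^ 6 ∂G.μ ≤
      (C * (∫⁻ x, ‖deriv ψ (φ x)‖ₑ ^ 2 * ‖gradient φ x‖ₑ ^ 2 ∂G.μ +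
        ∫⁻ x, ‖ψ (φ x)‖ₑ ^ 2 ∂G.μ)) ^ 3 := by
  obtain ⟨C, hC⟩ := exists_lintegral_pow_six_le
  cases G with
  | dirichlet Ω =>
    refine ⟨C, fun φ hφ ψ hψ hψ0 => ?_⟩
    have hw : ContDiff ℝ 1 (fun x => ψ (φ x)) := hψ.comp (hφ.1.of_le (by simp))
    -- Because ψ vanishes at 0, the composition keeps compact support and the whole space inequality
    -- applies to it.
    have hwc : HasCompactSupport (fun x => ψ (φ x)) := hφ.2.1.comp_left hψ0
    refine (lintegral_mono' Measure.restrict_le_self le_rfl).trans ((hC _ hw hwc).trans ?_)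
    gcongr
    refine le_trans (le_of_eq ?_) le_self_add
    rw [μ, ← lintegral_indicator (measurableSet_region hG)]
    refine lintegral_congr fun x => ?_
    by_cases hx : x ∈ Ω
    · rw [indicator_of_mem (by exact hx), fderiv_comp_norm_sq (hφ.1.differentiable (by simp))
        (hψ.differentiable (by simp))]
    · rw [indicator_of_notMem (by exact hx), fderiv_comp_norm_sq (hφ.1.differentiable (by simp))
        (hψ.differentiable (by simp))]
      have : fderiv ℝ φ x = 0 := image_eq_zero_of_notMem_tsupport fun h =>
        hx (hφ.2.2 (tsupport_fderiv_subset ℝ h))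
      simp [gradient, this]
  | torus =>
    obtain ⟨χ, hχ, hχc, hχ01, hχ1, hχs⟩ := exists_torus_cutoff
    obtain ⟨M, hM⟩ := hχc.fderiv (𝕜 := ℝ) |>.exists_bound_of_continuous (hχ.continuous_fderiv one_ne_zero)
    have hM0 : 0 ≤ M := (norm_nonneg _).trans (hM 0)
    -- A periodic function is cut off before the whole space inequality is used. The 2 comes from
    -- squaring the product rule, 1 + M² from the size of χ and ∇χ, and 27 from the cells met by the
    -- support of χ.
    refine ⟨C * (2 * 27 * (1 + M.toNNReal ^ 2)), fun φ hφ ψ hψ hψ0 => ?_⟩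
    have hφ1 : ContDiff ℝ 1 φ := hφ.1.of_le (by simp)
    set w : E3 → ℝ := fun x => ψ (φ x) with hwdef
    have hw : ContDiff ℝ 1 w := hψ.comp hφ1
    have hwd := hw.differentiable (by simp)
    have hχd := hχ.differentiable (by simp)
    have hcell : ∫⁻ x, ‖w x‖ₑ ^ 6 ∂torus.μ ≤ ∫⁻ x, ‖χ x * w x‖ₑ ^ 6 := by
      refine le_trans (le_of_eq ?_) (lintegral_mono' (Measure.restrict_le_self (s := torus.region)) le_rfl)
      refine lintegral_congr_ae ?_
      filter_upwards [ae_mem_region hG] with x hx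
      rw [hχ1 x hx, one_mul]
    refine hcell.trans ((hC _ (hχ.mul hw) hχc.mul_right).trans ?_)
    rw [ENNReal.coe_mul, mul_assoc]
    gcongr
    set F : E3 → ℝ≥0∞ := fun x => ‖fderiv ℝ w x‖ₑ ^ 2 + ‖w x‖ₑ ^ 2 with hF
    have hper : ∀ k x, w (x + latticeVec k) = w x := fun k x => by simp only [hwdef, hφ.2 k x]
    have hFper : ∀ k x, F (x + latticeVec k) = F x := fun k x => by
      have h1 : fderiv ℝ w (x + latticeVec k) = fderiv ℝ w x := by
        rw [← fderiv_comp_add_right, funext (hper k)]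
      simp only [hF, h1, hper]
    have hpt : ∀ x, ‖fderiv ℝ (fun x => χ x * w x) x‖ₑ ^ 2 ≤
        (tsupport χ).indicator (fun x => 2 * (1 + (M.toNNReal : ℝ≥0∞) ^ 2) * F x) x := by
      intro x
      have hfd : fderiv ℝ (fun x => χ x * w x) x = χ x • fderiv ℝ w x + w x • fderiv ℝ χ x :=
        fderiv_fun_mul (hχd x) (hwd x)
      by_cases hx : x ∈ tsupport χ
      · rw [indicator_of_mem hx, hfd]
        refine (enorm_add_sq_le _ _).trans ?_
        rw [mul_assoc]
        gcongr
        rw [enorm_smul, enorm_smul, mul_pow, mul_pow]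
        have e1 : ‖χ x‖ₑ ≤ 1 := by
          rw [Real.enorm_eq_ofReal (hχ01 x).1]; simpa using (hχ01 x).2
        have e2 : ‖fderiv ℝ χ x‖ₑ ≤ M.toNNReal := by
          rw [← ofReal_norm]; exact ENNReal.ofReal_le_ofReal (hM x)
        calc ‖χ x‖ₑ ^ 2 * ‖fderiv ℝ w x‖ₑ ^ 2 + ‖w x‖ₑ ^ 2 * ‖fderiv ℝ χ x‖ₑ ^ 2
            ≤ 1 ^ 2 * ‖fderiv ℝ w x‖ₑ ^ 2 + ‖w x‖ₑ ^ 2 * (M.toNNReal : ℝ≥0∞) ^ 2 := by gcongr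
          _ ≤ (1 ^ 2 * ‖fderiv ℝ w x‖ₑ ^ 2 + ‖w x‖ₑ ^ 2 * (M.toNNReal : ℝ≥0∞) ^ 2) +
              ((M.toNNReal : ℝ≥0∞) ^ 2 * ‖fderiv ℝ w x‖ₑ ^ 2 + ‖w x‖ₑ ^ 2) := le_self_add
          _ = _ := by simp only [hF]; ring
      · rw [indicator_of_notMem hx, hfd, image_eq_zero_of_notMem_tsupport hx]
        have : fderiv ℝ χ x = 0 := image_eq_zero_of_notMem_tsupport fun h =>
          hx (tsupport_fderiv_subset ℝ h)
        rw [this, zero_smul, smul_zero, add_zero, ← ofReal_norm, norm_zero]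
        simp
    calc ∫⁻ x, ‖fderiv ℝ (fun x => χ x * w x) x‖ₑ ^ 2
        ≤ ∫⁻ x in tsupport χ, 2 * (1 + (M.toNNReal : ℝ≥0∞) ^ 2) * F x := by
          rw [← lintegral_indicator (isClosed_tsupport χ).measurableSet]
          exact lintegral_mono hpt
      _ = 2 * (1 + (M.toNNReal : ℝ≥0∞) ^ 2) * ∫⁻ x in tsupport χ, F x := by
          rw [lintegral_const_mul' _ _ (by
            exact ENNReal.mul_ne_top (by simp) (by simp))]
      _ ≤ 2 * (1 + (M.toNNReal : ℝ≥0∞) ^ 2) * (27 * ∫⁻ x, F x ∂torus.μ) := by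
          gcongr
          exact setLIntegral_periodic_le hFper hχs
      _ = _ := by
          have : Measurable fun x => ‖fderiv ℝ w x‖ₑ ^ 2 :=
            (hw.continuous_fderiv one_ne_zero).enorm.measurable.pow_const 2
          rw [hF, lintegral_add_left this]
          simp only [hwdef, fderiv_comp_norm_sq (hφ1.differentiable (by simp))
            (hψ.differentiable (by simp))]
          push_cast
          ring

/-- Test functions converging in `H¹` and almost everywhere. -/
lemma exists_seq_test_ae (hG : G.Admissible) (u : G.H1) : ∃ φ : ℕ → E3 → ℝ,
    (∀ n, G.IsTest (φ n)) ∧ (∀ᵐ x ∂G.μ, Tendsto (fun n => φ n x) atTop (𝓝 (val u x))) ∧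
    Tendsto (fun n => ∫⁻ x, ‖φ n x - val u x‖ₑ ^ 2 ∂G.μ) atTop (𝓝 0) ∧
    Tendsto (fun n => ∫⁻ x, ‖gradient (φ n) x - grad u x‖ₑ ^ 2 ∂G.μ) atTop (𝓝 0) := by
  obtain ⟨φ, hφ, hlim⟩ := exists_seq_test hG u
  have h1 : Tendsto (fun n => G.toL2 (φ n)) atTop (𝓝 (val u)) :=
    (WithLp.fstL 2 ℝ G.L2 G.L2Vec).continuous.continuousAt.tendsto.comp hlim
  have h2 : Tendsto (fun n => G.toL2 (gradient (φ n))) atTop (𝓝 (grad u)) :=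
    (WithLp.sndL 2 ℝ G.L2 G.L2Vec).continuous.continuousAt.tendsto.comp hlim
  have e1 : ∀ n, ∫⁻ x, ‖φ n x - val u x‖ₑ ^ 2 ∂G.μ = ‖G.toL2 (φ n) - val u‖ₑ ^ 2 := fun n => by
    rw [← lintegral_enorm_sq]
    refine lintegral_congr_ae ?_
    filter_upwards [coeFn_toL2 ((hφ n).memLp hG), Lp.coeFn_sub (G.toL2 (φ n)) (val u)] with x hx hx'
    rw [hx', Pi.sub_apply, hx]
  have e2 : ∀ n, ∫⁻ x, ‖gradient (φ n) x - grad u x‖ₑ ^ 2 ∂G.μ =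
      ‖G.toL2 (gradient (φ n)) - grad u‖ₑ ^ 2 := fun n => by
    rw [← lintegral_enorm_sq]
    refine lintegral_congr_ae ?_
    filter_upwards [coeFn_toL2 ((hφ n).memLp_gradient hG),
      Lp.coeFn_sub (G.toL2 (gradient (φ n))) (grad u)] with x hx hx'
    rw [hx', Pi.sub_apply, hx]
  have t1 : Tendsto (fun n => ‖G.toL2 (φ n) - val u‖ₑ ^ 2) atTop (𝓝 0) := by
    have := ENNReal.Tendsto.pow (n := 2) (h1.sub_const (val u)).enorm
    simpa using this
  have t2 : Tendsto (fun n => ‖G.toL2 (gradient (φ n)) - grad u‖ₑ ^ 2) atTop (𝓝 0) := by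
    have := ENNReal.Tendsto.pow (n := 2) (h2.sub_const (grad u)).enorm
    simpa using this
  -- L² convergence implies convergence in measure, so a subsequence converges almost everywhere.
  obtain ⟨ns, hns, hae⟩ := (tendstoInMeasure_of_tendsto_Lp h1).exists_seq_tendsto_ae
  refine ⟨fun n => φ (ns n), fun n => hφ _, ?_, ?_, ?_⟩
  · have hall : ∀ᵐ x ∂G.μ, ∀ n, G.toL2 (φ n) x = φ n x :=
      ae_all_iff.2 fun n => coeFn_toL2 ((hφ n).memLp hG)
    filter_upwards [hae, hall] with x hx hx'
    simpa only [hx'] using hx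
  · simp only [e1]; exact t1.comp hns.tendsto_atTop
  · simp only [e2]; exact t2.comp hns.tendsto_atTop

/-- Sobolev's inequality for compositions of members of `H¹` with `C¹` functions of bounded
derivative. -/
lemma exists_sobolev (hG : G.Admissible) : ∃ C : ℝ≥0, ∀ u : G.H1, ∀ (ψ : ℝ → ℝ) (K : ℝ≥0),
    ContDiff ℝ 1 ψ → ψ 0 = 0 → (∀ r, ‖deriv ψ r‖ ≤ K) → ∫⁻ x, ‖ψ (val u x)‖ₑ ^ 6 ∂G.μ ≤
      (C * (∫⁻ x, ‖deriv ψ (val u x)‖ₑ ^ 2 * ‖grad u x‖ₑ ^ 2 ∂G.μ +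
        ∫⁻ x, ‖ψ (val u x)‖ₑ ^ 2 ∂G.μ)) ^ 3 := by
  obtain ⟨C, hC⟩ := exists_sobolev_test hG
  refine ⟨C * 2, fun u ψ K hψ hψ0 hK => ?_⟩
  obtain ⟨φ, hφ, hae, hv, hg⟩ := exists_seq_test_ae hG u
  have hψd := hψ.differentiable (by simp)
  have hdc : Continuous (deriv ψ) := hψ.continuous_deriv le_rfl
  have hlip : ∀ a b, ‖ψ a - ψ b‖ₑ ≤ K * ‖a - b‖ₑ := fun a b => by
    have := lipschitzWith_of_nnnorm_deriv_le hψd (fun r => hK r) a b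
    simpa [edist_eq_enorm_sub] using this
  have hKe : ∀ r, ‖deriv ψ r‖ₑ ≤ K := fun r => by
    rw [← ofReal_norm]; exact (ENNReal.ofReal_le_ofReal (hK r)).trans (by simp)
  have hum : AEMeasurable (fun x => val u x) G.μ := (Lp.aestronglyMeasurable (val u)).aemeasurable
  have hgm : AEMeasurable (fun x => ‖grad u x‖ₑ ^ 2) G.μ :=
    (Lp.aestronglyMeasurable (grad u)).enorm.pow_const 2
  have hφm : ∀ n, Measurable (φ n) := fun n => (hφ n).contDiff.continuous.measurable
  have hdm : ∀ n, AEMeasurable (fun x => ‖deriv ψ (φ n x)‖ₑ ^ 2 * ‖grad u x‖ₑ ^ 2) G.μ := fun n =>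
    ((hdc.measurable.comp (hφm n)).enorm.pow_const 2).aemeasurable.mul hgm
  have hψm : AEMeasurable (fun x => ‖ψ (val u x)‖ₑ ^ 2) G.μ :=
    (hψ.continuous.measurable.comp_aemeasurable hum).enorm.pow_const 2
  -- The smooth inequality with ∇φₙ and ψ(φₙ) replaced by their limits, at the price of errors
  -- controlled by the bound K on ψ'.
  set rhs : ℕ → ℝ≥0∞ := fun n => (C * (2 * (∫⁻ x, ‖deriv ψ (φ n x)‖ₑ ^ 2 * ‖grad u x‖ₑ ^ 2 ∂G.μ +
      K ^ 2 * ∫⁻ x, ‖gradient (φ n) x - grad u x‖ₑ ^ 2 ∂G.μ) +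
      2 * (∫⁻ x, ‖ψ (val u x)‖ₑ ^ 2 ∂G.μ + K ^ 2 * ∫⁻ x, ‖φ n x - val u x‖ₑ ^ 2 ∂G.μ))) ^ 3 with hrhs
  have hn : ∀ n, ∫⁻ x, ‖ψ (φ n x)‖ₑ ^ 6 ∂G.μ ≤ rhs n := by
    intro n
    refine (hC (φ n) (hφ n) ψ hψ hψ0).trans ?_
    refine pow_le_pow_left' (mul_le_mul' le_rfl (add_le_add ?_ ?_)) 3
    · rw [← lintegral_const_mul' _ _ (by simp), ← lintegral_add_left' (hdm n),
        ← lintegral_const_mul' _ _ (by simp)]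
      refine lintegral_mono fun x => ?_
      have h1 : ‖gradient (φ n) x‖ₑ ^ 2 ≤
          2 * (‖grad u x‖ₑ ^ 2 + ‖gradient (φ n) x - grad u x‖ₑ ^ 2) := by
        simpa using enorm_add_sq_le (grad u x) (gradient (φ n) x - grad u x)
      calc ‖deriv ψ (φ n x)‖ₑ ^ 2 * ‖gradient (φ n) x‖ₑ ^ 2
          ≤ ‖deriv ψ (φ n x)‖ₑ ^ 2 * (2 * (‖grad u x‖ₑ ^ 2 + ‖gradient (φ n) x - grad u x‖ₑ ^ 2)) := by
            gcongr
        _ = 2 * (‖deriv ψ (φ n x)‖ₑ ^ 2 * ‖grad u x‖ₑ ^ 2 +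
            ‖deriv ψ (φ n x)‖ₑ ^ 2 * ‖gradient (φ n) x - grad u x‖ₑ ^ 2) := by ring
        _ ≤ _ := by gcongr; exact hKe _
    · rw [← lintegral_const_mul' _ _ (by simp), ← lintegral_add_left' hψm,
        ← lintegral_const_mul' _ _ (by simp)]
      refine lintegral_mono fun x => ?_
      have h1 : ‖ψ (φ n x)‖ₑ ^ 2 ≤ 2 * (‖ψ (val u x)‖ₑ ^ 2 + ‖ψ (φ n x) - ψ (val u x)‖ₑ ^ 2) := by
        simpa using enorm_add_sq_le (ψ (val u x)) (ψ (φ n x) - ψ (val u x))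
      refine h1.trans ?_
      rw [← mul_pow]
      gcongr
      exact hlip _ _
  -- The weight ψ'(φₙ) converges only almost everywhere; K²|∇u|² dominates.
  have hdom : Tendsto (fun n => ∫⁻ x, ‖deriv ψ (φ n x)‖ₑ ^ 2 * ‖grad u x‖ₑ ^ 2 ∂G.μ) atTop
      (𝓝 (∫⁻ x, ‖deriv ψ (val u x)‖ₑ ^ 2 * ‖grad u x‖ₑ ^ 2 ∂G.μ)) := by
    refine tendsto_lintegral_of_dominated_convergence' (fun x => (K : ℝ≥0∞) ^ 2 * ‖grad u x‖ₑ ^ 2)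
      hdm (fun n => ae_of_all _ fun x => mul_le_mul' (pow_le_pow_left' (hKe _) 2) le_rfl) ?_ ?_
    · rw [lintegral_const_mul' _ _ (by simp), lintegral_enorm_sq]
      exact ENNReal.mul_ne_top (by simp) (by simp)
    · filter_upwards [hae] with x hx
      refine ENNReal.Tendsto.mul_const ?_ (Or.inr (by simp))
      exact ENNReal.Tendsto.pow (hdc.continuousAt.tendsto.comp hx).enorm
  have hlim : Tendsto rhs atTop (𝓝 ((C * (2 * (∫⁻ x, ‖deriv ψ (val u x)‖ₑ ^ 2 * ‖grad u x‖ₑ ^ 2 ∂G.μ +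
      K ^ 2 * 0) + 2 * (∫⁻ x, ‖ψ (val u x)‖ₑ ^ 2 ∂G.μ + K ^ 2 * 0))) ^ 3)) := by
    refine ((ENNReal.continuous_pow 3).tendsto _).comp
      (ENNReal.Tendsto.const_mul (Tendsto.add ?_ ?_) (Or.inr (by simp)))
    · exact ENNReal.Tendsto.const_mul (hdom.add (ENNReal.Tendsto.const_mul hg (Or.inr (by simp))))
        (Or.inr (by simp))
    · exact ENNReal.Tendsto.const_mul (tendsto_const_nhds.add
        (ENNReal.Tendsto.const_mul hv (Or.inr (by simp)))) (Or.inr (by simp))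
  calc ∫⁻ x, ‖ψ (val u x)‖ₑ ^ 6 ∂G.μ = ∫⁻ x, liminf (fun n => ‖ψ (φ n x)‖ₑ ^ 6) atTop ∂G.μ := by
        refine lintegral_congr_ae ?_
        filter_upwards [hae] with x hx
        exact (ENNReal.Tendsto.pow ((hψ.continuous.tendsto _).comp hx).enorm).liminf_eq.symm
    _ ≤ liminf (fun n => ∫⁻ x, ‖ψ (φ n x)‖ₑ ^ 6 ∂G.μ) atTop :=
        lintegral_liminf_le fun n => (hψ.continuous.measurable.comp (hφm n)).enorm.pow_const 6
    _ ≤ liminf rhs atTop := liminf_le_liminf (Eventually.of_forall hn)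
    _ = _ := hlim.liminf_eq
    _ = _ := by
        congr 1
        push_cast
        ring

/-- The embedding of `H¹` in `L⁶`. -/
lemma exists_lintegral_val_pow_six_le (hG : G.Admissible) : ∃ C : ℝ≥0, ∀ u : G.H1,
    ∫⁻ x, ‖val u x‖ₑ ^ 6 ∂G.μ ≤ (C * ‖u‖ₑ ^ 2) ^ 3 := by
  obtain ⟨C, hC⟩ := exists_sobolev hG
  refine ⟨C, fun u => ?_⟩
  have h := hC u id 1 contDiff_id rfl (fun r => by simp)
  simp only [id, deriv_id', enorm_one, one_pow, one_mul] at h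
  refine h.trans (le_of_eq ?_)
  rw [lintegral_enorm_sq, lintegral_enorm_sq]
  congr 2
  rw [← ofReal_norm, ← ofReal_norm, ← ofReal_norm, ← ENNReal.ofReal_pow (norm_nonneg _),
    ← ENNReal.ofReal_pow (norm_nonneg _), ← ENNReal.ofReal_pow (norm_nonneg _), norm_sq_H1,
    ← ENNReal.ofReal_add (by positivity) (by positivity), add_comm]

/-- A primitive of the truncated power `min(|s|, k)^{2/3}`. -/
def truncPow (k r : ℝ) : ℝ := ∫ s in (0 : ℝ)..r, min |s| k ^ (2 / 3 : ℝ)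

lemma continuous_min_abs_rpow (k : ℝ) : Continuous fun s : ℝ => min |s| k ^ (2 / 3 : ℝ) :=
  (continuous_abs.min continuous_const).rpow_const fun _ => Or.inr (by norm_num)

lemma hasDerivAt_truncPow (k r : ℝ) : HasDerivAt (truncPow k) (min |r| k ^ (2 / 3 : ℝ)) r :=
  have h := continuous_min_abs_rpow k
  intervalIntegral.integral_hasDerivAt_right (h.intervalIntegrable _ _)
    (h.stronglyMeasurableAtFilter _ _) h.continuousAt

lemma deriv_truncPow (k : ℝ) : deriv (truncPow k) = fun r => min |r| k ^ (2 / 3 : ℝ) :=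
  funext fun r => (hasDerivAt_truncPow k r).deriv

lemma contDiff_truncPow (k : ℝ) : ContDiff ℝ 1 (truncPow k) := by
  rw [contDiff_one_iff_deriv, deriv_truncPow]
  exact ⟨fun r => (hasDerivAt_truncPow k r).differentiableAt, continuous_min_abs_rpow k⟩

lemma min_abs_rpow_le {k : ℝ} (hk : 0 ≤ k) (r : ℝ) :
    ‖min |r| k ^ (2 / 3 : ℝ)‖ ≤ |r| ^ (2 / 3 : ℝ) ∧ ‖min |r| k ^ (2 / 3 : ℝ)‖ ≤ k ^ (2 / 3 : ℝ) := by
  have h0 : 0 ≤ min |r| k := le_min (abs_nonneg _) hk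
  rw [Real.norm_of_nonneg (by positivity)]
  exact ⟨Real.rpow_le_rpow h0 (min_le_left _ _) (by norm_num),
    Real.rpow_le_rpow h0 (min_le_right _ _) (by norm_num)⟩

lemma abs_truncPow_le {k : ℝ} (hk : 0 ≤ k) (r : ℝ) : ‖truncPow k r‖ ≤ |r| ^ (5 / 3 : ℝ) := by
  have h := intervalIntegral.norm_integral_le_of_norm_le_const (a := 0) (b := r)
    (f := fun s : ℝ => min |s| k ^ (2 / 3 : ℝ)) (C := |r| ^ (2 / 3 : ℝ)) (fun s hs => by
      refine (min_abs_rpow_le hk s).1.trans (Real.rpow_le_rpow (abs_nonneg _) ?_ (by norm_num))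
      rcases mem_uIoc.1 hs with hs | hs
      · rw [abs_of_pos hs.1, abs_of_nonneg (hs.1.le.trans hs.2)]; exact hs.2
      · rw [abs_of_nonpos hs.2, abs_of_neg (hs.1.trans_le hs.2)]; linarith [hs.1])
  refine h.trans (le_of_eq ?_)
  rw [sub_zero]
  rcases eq_or_ne r 0 with rfl | hr
  · simp
  · conv_lhs => rw [← Real.rpow_one |r|, ← Real.rpow_mul (abs_nonneg _),
      ← Real.rpow_add (abs_pos.2 hr)]
    norm_num

lemma truncPow_neg (k r : ℝ) : truncPow k (-r) = -truncPow k r := by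
  have h := intervalIntegral.integral_comp_neg (a := 0) (b := r)
    (fun s : ℝ => min |s| k ^ (2 / 3 : ℝ))
  simp only [abs_neg, neg_zero] at h
  rw [truncPow, truncPow, h, intervalIntegral.integral_symm]

/-- For |r| ≤ k the truncation is inactive, and oddness reduces the claim to r ≥ 0. -/
lemma abs_truncPow_eq {k r : ℝ} (hr : |r| ≤ k) : |truncPow k r| = 3 / 5 * |r| ^ (5 / 3 : ℝ) := by
  have hpos : ∀ r, 0 ≤ r → r ≤ k → truncPow k r = 3 / 5 * r ^ (5 / 3 : ℝ) := by
    intro r h0 hk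
    have : truncPow k r = ∫ s in (0 : ℝ)..r, s ^ (2 / 3 : ℝ) := by
      refine intervalIntegral.integral_congr fun s hs => ?_
      rw [uIcc_of_le h0] at hs
      simp only [abs_of_nonneg hs.1, min_eq_left (hs.2.trans hk)]
    rw [this, integral_rpow (Or.inl (by norm_num))]
    norm_num
    ring
  rcases le_total 0 r with h | h
  · rw [abs_of_nonneg h] at hr ⊢
    rw [hpos r h hr, abs_of_nonneg (by positivity)]
  · rw [abs_of_nonpos h] at hr ⊢
    rw [← neg_neg r, truncPow_neg, abs_neg, hpos (-r) (by linarith) hr, abs_of_nonneg, neg_neg]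
    have : 0 ≤ -r := by linarith
    positivity

/-- Hölder's inequality with weights 2/9 + 1/9 + 2/3 = 1. The first two factors are bounded in the
energy space. The last exponent 2/3 becomes 2 when Sobolev's inequality takes the cube, so that
∫|u|¹⁰ grows only quadratically in ∫|∇u|^{8/3}. -/
lemma lintegral_rpow_mul_sq_le {α : Type*} [MeasurableSpace α] {μ : Measure α} {a b : α → ℝ≥0∞}
    (ha : AEMeasurable a μ) (hb : AEMeasurable b μ) :
    ∫⁻ x, a x ^ (4 / 3 : ℝ) * b x ^ 2 ∂μ ≤ (∫⁻ x, a x ^ 6 ∂μ) ^ (2 / 9 : ℝ) *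
      (∫⁻ x, b x ^ 2 ∂μ) ^ (1 / 9 : ℝ) * (∫⁻ x, b x ^ (8 / 3 : ℝ) ∂μ) ^ (2 / 3 : ℝ) := by
  have h := ENNReal.lintegral_prod_norm_pow_le (μ := μ) (Finset.univ : Finset (Fin 3))
    (f := ![fun x => a x ^ 6, fun x => b x ^ 2, fun x => b x ^ (8 / 3 : ℝ)])
    (p := ![2 / 9, 1 / 9, 2 / 3]) (by
      intro i _
      fin_cases i
      · exact ha.pow_const 6
      · exact hb.pow_const 2
      · exact hb.pow_const _)
    (by simp [Fin.sum_univ_three]; norm_num) (by intro i _; fin_cases i <;> simp <;> norm_num)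
  simp only [Fin.prod_univ_three, Matrix.cons_val_zero, Matrix.cons_val_one, Matrix.cons_val] at h
  refine le_trans (le_of_eq (lintegral_congr fun x => ?_)) h
  rw [mul_assoc]
  congr 1
  · rw [← ENNReal.rpow_natCast, ← ENNReal.rpow_mul]; norm_num
  · rw [← ENNReal.rpow_natCast, ← ENNReal.rpow_mul, ← ENNReal.rpow_mul,
      ← ENNReal.rpow_add_of_nonneg _ _ (by norm_num) (by norm_num)]
    norm_num

/-- The Strichartz type bound `‖u‖₁₀⁵ ≤ C (1 + ‖u‖²_{H^{3/2}})` on bounded subsets of `H¹`. -/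
lemma exists_lintegral_val_pow_ten_le (hG : G.Admissible) (R : ℝ) : ∃ C : ℝ≥0, ∀ u : G.H1,
    ‖u‖ ≤ R → ∫⁻ x, ‖val u x‖ₑ ^ 10 ∂G.μ ≤ C * (1 + G.hThreeHalvesNormSq u) ^ 2 := by
  have := isFiniteMeasure_μ hG
  obtain ⟨C, hC⟩ := exists_sobolev hG
  obtain ⟨C₆, hC₆⟩ := exists_lintegral_val_pow_six_le hG
  obtain ⟨CQ, hCQ⟩ := exists_lintegral_grad_rpow_le hG R
  set U₀ : ℝ≥0∞ := (C₆ * ENNReal.ofReal R ^ 2) ^ 3 with hU₀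
  have hU₀t : U₀ ≠ ⊤ := by
    rw [hU₀]
    exact ENNReal.pow_ne_top (ENNReal.mul_ne_top (by simp) (by simp))
  set A : ℝ≥0∞ := C * (U₀ ^ (2 / 9 : ℝ) * (ENNReal.ofReal R ^ 2) ^ (1 / 9 : ℝ) * CQ ^ (2 / 3 : ℝ) +
    (G.μ univ + U₀)) with hA
  have hAt : A ≠ ⊤ := by
    refine ENNReal.mul_ne_top (by simp) (ENNReal.add_ne_top.2 ⟨?_, ENNReal.add_ne_top.2
      ⟨measure_ne_top _ _, hU₀t⟩⟩)
    refine ENNReal.mul_ne_top (ENNReal.mul_ne_top ?_ ?_) ?_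
    · exact ENNReal.rpow_ne_top_of_nonneg (by norm_num) hU₀t
    · exact ENNReal.rpow_ne_top_of_nonneg (by norm_num) (by simp)
    · exact ENNReal.rpow_ne_top_of_nonneg (by norm_num) (by simp)
  refine ⟨(64 * A ^ 3).toNNReal, fun u hu => ?_⟩
  rw [ENNReal.coe_toNNReal (ENNReal.mul_ne_top (by simp) (ENNReal.pow_ne_top hAt))]
  set X := 1 + G.hThreeHalvesNormSq u with hX
  have hX1 : 1 ≤ X := le_self_add
  have hum : AEMeasurable (fun x => ‖val u x‖ₑ) G.μ := (Lp.aestronglyMeasurable (val u)).enorm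
  have huv : AEMeasurable (fun x => val u x) G.μ := (Lp.aestronglyMeasurable (val u)).aemeasurable
  have hgm : AEMeasurable (fun x => ‖grad u x‖ₑ) G.μ := (Lp.aestronglyMeasurable (grad u)).enorm
  have hue : ‖u‖ₑ ≤ ENNReal.ofReal R := by rw [← ofReal_norm]; exact ENNReal.ofReal_le_ofReal hu
  have hge : ‖grad u‖ₑ ≤ ENNReal.ofReal R := by
    rw [← ofReal_norm]; exact ENNReal.ofReal_le_ofReal ((norm_grad_le u).trans hu)
  have hU : ∫⁻ x, ‖val u x‖ₑ ^ 6 ∂G.μ ≤ U₀ := (hC₆ u).trans (by rw [hU₀]; gcongr)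
  have hkey : ∫⁻ x, ‖val u x‖ₑ ^ (4 / 3 : ℝ) * ‖grad u x‖ₑ ^ 2 ∂G.μ ≤
      U₀ ^ (2 / 9 : ℝ) * (ENNReal.ofReal R ^ 2) ^ (1 / 9 : ℝ) * CQ ^ (2 / 3 : ℝ) * X ^ (2 / 3 : ℝ) := by
    refine (lintegral_rpow_mul_sq_le hum hgm).trans ?_
    rw [mul_assoc _ ((CQ : ℝ≥0∞) ^ (2 / 3 : ℝ)), ← ENNReal.mul_rpow_of_nonneg _ _ (by norm_num),
      lintegral_enorm_sq]
    gcongr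
    exact hCQ u hu
  -- The lower order term is controlled by L⁶, since 10/3 ≤ 6, and X ≥ 1 brings it into the form of
  -- the main term.
  have hlow : ∫⁻ x, ‖val u x‖ₑ ^ (10 / 3 : ℝ) ∂G.μ ≤ (G.μ univ + U₀) * X ^ (2 / 3 : ℝ) := by
    calc ∫⁻ x, ‖val u x‖ₑ ^ (10 / 3 : ℝ) ∂G.μ ≤ ∫⁻ x, (1 + ‖val u x‖ₑ ^ 6) ∂G.μ := by
          refine lintegral_mono fun x => ?_
          rcases le_total ‖val u x‖ₑ 1 with h | h
          · exact (ENNReal.rpow_le_one h (by norm_num)).trans le_self_add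
          · refine le_trans ?_ le_add_self
            rw [← ENNReal.rpow_natCast]
            exact ENNReal.rpow_le_rpow_of_exponent_le h (by norm_num)
      _ = G.μ univ + ∫⁻ x, ‖val u x‖ₑ ^ 6 ∂G.μ := by
          rw [lintegral_add_left measurable_const, lintegral_const, one_mul]
      _ ≤ (G.μ univ + U₀) * 1 := by rw [mul_one]; gcongr
      _ ≤ _ := by gcongr; exact ENNReal.one_le_rpow hX1 (by norm_num)
  -- The derivative of |r|^{2/3}r is unbounded, so Sobolev's inequality is applied to its
  -- truncations; the resulting bound does not depend on k, and Fatou's lemma removes the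
  -- truncation.
  have hk : ∀ k : ℕ, ∫⁻ x, 64 * ‖truncPow k (val u x)‖ₑ ^ 6 ∂G.μ ≤ 64 * A ^ 3 * X ^ 2 := by
    intro k
    have hk0 : (0 : ℝ) ≤ k := Nat.cast_nonneg k
    rw [lintegral_const_mul' _ _ (by simp), mul_assoc]
    gcongr
    refine (hC u (truncPow k) (Real.toNNReal ((k : ℝ) ^ (2 / 3 : ℝ))) (contDiff_truncPow k)
      (by simp [truncPow]) (fun r => by
        rw [deriv_truncPow, Real.coe_toNNReal _ (by positivity)]
        exact (min_abs_rpow_le hk0 r).2)).trans ?_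
    have e : A ^ 3 * X ^ 2 = (A * X ^ (2 / 3 : ℝ)) ^ 3 := by
      have h2 : (X ^ (2 / 3 : ℝ)) ^ 3 = X ^ 2 := by
        rw [← ENNReal.rpow_natCast, ← ENNReal.rpow_mul]
        norm_num
      rw [mul_pow A, h2]
    rw [e, hA, mul_assoc, add_mul]
    gcongr
    · refine le_trans (lintegral_mono fun x => ?_) hkey
      gcongr
      have h1 : ‖deriv (truncPow k) (val u x)‖ₑ ≤ ‖val u x‖ₑ ^ (2 / 3 : ℝ) := by
        rw [deriv_truncPow, ← ofReal_norm, ← ofReal_norm (val u x),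
          ENNReal.ofReal_rpow_of_nonneg (norm_nonneg _) (by norm_num)]
        exact ENNReal.ofReal_le_ofReal (min_abs_rpow_le hk0 _).1
      refine (pow_le_pow_left' h1 2).trans (le_of_eq ?_)
      rw [← ENNReal.rpow_natCast, ← ENNReal.rpow_mul]
      norm_num
    · refine le_trans (lintegral_mono fun x => ?_) hlow
      have h1 : ‖truncPow k (val u x)‖ₑ ≤ ‖val u x‖ₑ ^ (5 / 3 : ℝ) := by
        rw [← ofReal_norm, ← ofReal_norm (val u x),
          ENNReal.ofReal_rpow_of_nonneg (norm_nonneg _) (by norm_num)]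
        exact ENNReal.ofReal_le_ofReal (abs_truncPow_le hk0 _)
      refine (pow_le_pow_left' h1 2).trans (le_of_eq ?_)
      rw [← ENNReal.rpow_natCast, ← ENNReal.rpow_mul]
      norm_num
  calc ∫⁻ x, ‖val u x‖ₑ ^ 10 ∂G.μ
      ≤ ∫⁻ x, liminf (fun k : ℕ => 64 * ‖truncPow k (val u x)‖ₑ ^ 6) atTop ∂G.μ := by
        refine lintegral_mono fun x => le_liminf_of_le ?_ ?_
        · isBoundedDefault
        obtain ⟨n, hn⟩ := exists_nat_ge |val u x|
        filter_upwards [eventually_ge_atTop n] with k hkn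
        have h1 := abs_truncPow_eq (k := k) (r := val u x) (hn.trans (by exact_mod_cast hkn))
        -- The factor 64 absorbs the constant of `abs_truncPow_eq`, as 64 (3/5)⁶ ≥ 1.
        have h2 : ‖val u x‖ ^ 10 ≤ 64 * ‖truncPow k (val u x)‖ ^ 6 := by
          rw [Real.norm_eq_abs, Real.norm_eq_abs, h1, mul_pow, ← Real.rpow_natCast (_ ^ _),
            ← Real.rpow_mul (abs_nonneg _), ← Real.rpow_natCast |val u x|]
          norm_num
          have : 0 ≤ |val u x| ^ 10 := by positivity
          linarith
        rw [← ofReal_norm, ← ofReal_norm, ← ENNReal.ofReal_pow (norm_nonneg _),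
          ← ENNReal.ofReal_pow (norm_nonneg _),
          show (64 : ℝ≥0∞) = ENNReal.ofReal 64 by simp, ← ENNReal.ofReal_mul (by norm_num)]
        exact ENNReal.ofReal_le_ofReal h2
    _ ≤ liminf (fun k : ℕ => ∫⁻ x, 64 * ‖truncPow k (val u x)‖ₑ ^ 6 ∂G.μ) atTop :=
        lintegral_liminf_le' fun k => (((contDiff_truncPow k).continuous.measurable.comp_aemeasurable
          huv).enorm.pow_const 6).const_mul 64
    _ ≤ 64 * A ^ 3 * X ^ 2 := by
        refine (liminf_le_liminf (Eventually.of_forall hk)).trans ?_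
        simp

end Sobolev

end Geometry

namespace Geometry

variable {G : Geometry}

/-! ### Density of H¹ in L² and uniqueness of the weak gradient -/

section Density

lemma latticeVec_apply (k : Fin 3 → ℤ) (i : Fin 3) : latticeVec k i = 2 * Real.pi * k i := rfl

lemma latticeVec_add (k l : Fin 3 → ℤ) : latticeVec (k + l) = latticeVec k + latticeVec l := by
  ext i; simp [latticeVec_apply]; ring

/-- The open cell of the torus. -/
def openCell : Set E3 := {x | ∀ i, x i ∈ Ioo 0 (2 * Real.pi)}

/-- Periodization of a function supported in the open cell. -/
lemma exists_periodic_extension {φ : E3 → ℝ} (hφ : ContDiff ℝ ∞ φ) (hs : tsupport φ ⊆ openCell) :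
    ∃ ψ, torus.IsTest ψ ∧ ∀ x ∈ openCell, ψ x = φ x := by
  have hπ := Real.pi_pos
  have hsupp : ∀ x, φ x ≠ 0 → x ∈ openCell := fun x hx => hs (subset_tsupport _ hx)
  refine ⟨fun x => ∑ᶠ k : Fin 3 → ℤ, φ (x + latticeVec k), ⟨?_, fun m x => ?_⟩, fun x hx => ?_⟩
  · have hlf : LocallyFinite fun k : Fin 3 → ℤ => Function.support fun x => φ (x + latticeVec k) := by
      intro x₀
      refine ⟨Metric.ball x₀ 1, Metric.ball_mem_nhds _ one_pos, ?_⟩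
      set N : ℤ := ⌈‖x₀‖ + 3⌉ with hN
      have hNle : ‖x₀‖ + 3 ≤ N := Int.le_ceil _
      refine (Finset.finite_toSet (Fintype.piFinset fun _ : Fin 3 => Finset.Icc (-N) N)).subset ?_
      rintro k ⟨x, hx, hxb⟩
      rw [Finset.mem_coe, Fintype.mem_piFinset]
      intro i
      have h1 := hsupp _ hx i
      rw [PiLp.add_apply, latticeVec_apply, mem_Ioo] at h1
      have h2 : |x i| ≤ ‖x₀‖ + 1 := by
        refine (PiLp.norm_apply_le x i).trans ?_
        rw [Metric.mem_ball, dist_eq_norm] at hxb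
        have := norm_add_le (x - x₀) x₀
        rw [sub_add_cancel] at this
        linarith
      rw [abs_le] at h2
      have hπ3 := Real.pi_gt_three
      have hx0 := norm_nonneg x₀
      rw [Finset.mem_Icc]
      have e1 : -(N : ℝ) ≤ k i := by
        by_contra h
        push Not at h
        nlinarith
      have e2 : (k i : ℝ) ≤ N := by
        by_contra h
        push Not at h
        nlinarith
      exact ⟨by exact_mod_cast e1, by exact_mod_cast e2⟩
    rw [← contMDiff_iff_contDiff]
    exact contMDiff_finsum (fun k => contMDiff_iff_contDiff.2
      (hφ.comp (contDiff_id.add contDiff_const))) hlf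
  -- Shifting by a lattice vector merely reindexes the sum.
  · have := finsum_comp_equiv (Equiv.addLeft m) (f := fun k => φ (x + latticeVec k))
    simp only [← this, Equiv.coe_addLeft, latticeVec_add, add_assoc]
  · have h0 : latticeVec 0 = 0 := by ext i; simp [latticeVec]
    change ∑ᶠ k : Fin 3 → ℤ, φ (x + latticeVec k) = φ x
    -- Two points of the open cell that differ by a lattice vector coincide, so only k = 0
    -- contributes.
    rw [finsum_eq_single _ 0, h0, add_zero]
    intro k hk
    by_contra hne
    refine hk (funext fun i => ?_)
    have h1 := hsupp _ hne i
    have h2 := hx i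
    rw [PiLp.add_apply, latticeVec_apply, mem_Ioo] at h1
    rw [mem_Ioo] at h2
    have e1 : (-1 : ℝ) < k i := by by_contra h; push Not at h; nlinarith
    have e2 : (k i : ℝ) < 1 := by by_contra h; push Not at h; nlinarith
    have e1' : (-1 : ℤ) < k i := by exact_mod_cast e1
    have e2' : k i < (1 : ℤ) := by exact_mod_cast e2
    simp only [Pi.zero_apply]
    omega

/-- The closed cell is convex, its interior points have all coordinates strictly between 0 and 2π,
and the frontier of a convex set is a null set. -/
lemma volume_region_diff_openCell : volume (torus.region \ openCell) = 0 := by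
  have hconv : Convex ℝ torus.region := by
    have : torus.region = ⋂ i : Fin 3, (EuclideanSpace.proj i : E3 →L[ℝ] ℝ) ⁻¹' Icc 0 (2 * Real.pi) := by
      ext x; simp [region]
    rw [this]
    exact convex_iInter fun i => (convex_Icc _ _).linear_preimage (EuclideanSpace.proj i : E3 →L[ℝ] ℝ).toLinearMap
  refine measure_mono_null ?_ (hconv.addHaar_frontier volume)
  intro x hx
  refine ⟨subset_closure hx.1, fun hint => hx.2 fun i => ?_⟩
  obtain ⟨ε, hε, hball⟩ := Metric.isOpen_iff.1 isOpen_interior x hint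
  have hmem : ∀ c : ℝ, |c| < ε → x i + c ∈ Icc 0 (2 * Real.pi) := by
    intro c hc
    have : x + EuclideanSpace.single i c ∈ torus.region := interior_subset (hball (by
      rw [Metric.mem_ball, dist_eq_norm, add_sub_cancel_left, PiLp.norm_single]
      exact hc))
    simpa using this i
  have h1 := hmem (ε / 2) (by rw [abs_of_pos (by positivity)]; linarith)
  have h2 := hmem (-(ε / 2)) (by rw [abs_neg, abs_of_pos (by positivity)]; linarith)
  exact ⟨by linarith [h2.1], by linarith [h1.2]⟩

/-- An open set of full measure in which every compactly supported smooth function agrees with a test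
function. -/
lemma exists_open_full (hG : G.Admissible) : ∃ U : Set E3, IsOpen U ∧ U ⊆ G.region ∧
    (∀ᵐ x ∂G.μ, x ∈ U) ∧ ∀ φ : E3 → ℝ, ContDiff ℝ ∞ φ → HasCompactSupport φ → tsupport φ ⊆ U →
      ∃ ψ, G.IsTest ψ ∧ ∀ x ∈ U, ψ x = φ x := by
  cases G with
  | dirichlet Ω =>
    exact ⟨Ω, hG.isOpen, subset_rfl, ae_mem_region hG, fun φ h1 h2 h3 => ⟨φ, ⟨h1, h2, h3⟩,
      fun x _ => rfl⟩⟩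
  | torus =>
    refine ⟨openCell, ?_, fun x hx i => Ioo_subset_Icc_self (hx i), ?_,
      fun φ h1 _ h3 => exists_periodic_extension h1 h3⟩
    · have : openCell = ⋂ i : Fin 3, (fun x : E3 => x i) ⁻¹' Ioo 0 (2 * Real.pi) := by
        ext x; simp [openCell]
      rw [this]
      exact isOpen_iInter_of_finite fun i => isOpen_Ioo.preimage (by fun_prop)
    · rw [μ, ae_restrict_iff' (measurableSet_region hG)]
      filter_upwards [measure_eq_zero_iff_ae_notMem.1 volume_region_diff_openCell] with x hx hxr
      by_contra h
      exact hx ⟨hxr, h⟩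

lemma real_inner_eq_mul (a b : ℝ) : inner ℝ a b = a * b := by
  rw [real_inner_comm]; rfl

lemma locallyIntegrable_Lp (hG : G.Admissible) {F : Type*} [NormedAddCommGroup F] (w : Lp F 2 G.μ) :
    LocallyIntegrable w G.μ := by
  have := isFiniteMeasure_μ hG
  exact ((Lp.memLp w).integrable one_le_two).locallyIntegrable

/-- `H¹` is dense in `L²`: an element of `L²` orthogonal to `H¹` vanishes. -/
lemma eq_zero_of_inner_val (hG : G.Admissible) {w : G.L2} (h : ∀ q : G.H1, inner ℝ w (val q) = 0) :
    w = 0 := by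
  obtain ⟨U, hU, hUr, hUae, hUt⟩ := exists_open_full hG
  have := hU.ae_eq_zero_of_integral_contDiff_smul_eq_zero (μ := G.μ) (f := w)
    ((locallyIntegrable_Lp hG w).locallyIntegrableOn U) (by
      intro φ h1 h2 h3
      obtain ⟨ψ, hψ, hψφ⟩ := hUt φ h1 h2 h3
      have := h ⟨G.testPair ψ, testPair_mem_H1 hψ⟩
      change inner ℝ w (G.toL2 ψ) = 0 at this
      rw [← this, L2.inner_def]
      refine integral_congr_ae ?_
      filter_upwards [hUae, coeFn_toL2 (hψ.memLp hG)] with x hx hx'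
      rw [hx', hψφ x hx, real_inner_eq_mul, smul_eq_mul, mul_comm])
  refine Lp.eq_zero_iff_ae_eq_zero.2 ?_
  filter_upwards [this, hUae] with x hx hx' using hx hx'

lemma dense_range_valL (hG : G.Admissible) : DenseRange G.valL := by
  have h : (LinearMap.range G.valL.toLinearMap).topologicalClosure = ⊤ := by
    rw [Submodule.topologicalClosure_eq_top_iff, Submodule.eq_bot_iff]
    intro w hw
    refine eq_zero_of_inner_val hG fun q => ?_
    rw [real_inner_comm]
    exact (Submodule.mem_orthogonal _ _).1 hw _ ⟨q, rfl⟩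
  have h2 := Submodule.dense_iff_topologicalClosure_eq_top.2 h
  exact h2

/-- Integration by parts against compactly supported functions. -/
lemma inner_grad_eq_neg (hG : G.Admissible) {U : Set E3} (hUr : U ⊆ G.region) {χ : E3 → ℝ}
    (hχ : ContDiff ℝ ∞ χ) (hχc : HasCompactSupport χ) (hχs : tsupport χ ⊆ U) (v : E3) (u : G.H1) :
    inner ℝ (G.toL2 fun x => χ x • v) (grad u) =
      -inner ℝ (G.toL2 fun x => fderiv ℝ χ x v) (val u) := by
  have hχ1 : ContDiff ℝ 1 χ := hχ.of_le (by simp)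
  have m1 : MemLp (fun x => χ x • v) 2 G.μ :=
    memLp_of_continuous hG (hχ.continuous.smul continuous_const) 2
  have hc2 : Continuous fun x => fderiv ℝ χ x v := (hχ1.continuous_fderiv one_ne_zero).clm_apply continuous_const
  have m2 : MemLp (fun x => fderiv ℝ χ x v) 2 G.μ := memLp_of_continuous hG hc2 2
  have hz : ∀ x, x ∉ G.region → χ x = 0 := fun x hx => image_eq_zero_of_notMem_tsupport fun h =>
    hx (hUr (hχs h))
  have hz' : ∀ x, x ∉ G.region → fderiv ℝ χ x = 0 := fun x hx =>
    image_eq_zero_of_notMem_tsupport fun h => hx (hUr (hχs (tsupport_fderiv_subset ℝ h)))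
  -- For a test function this is classical integration by parts over ℝ³. The compact support of χ
  -- inside the region suffices; φ need not be compactly supported, which matters on the torus.
  have htest : ∀ φ, G.IsTest φ → inner ℝ (G.toL2 fun x => χ x • v) (G.toL2 (gradient φ)) =
      -inner ℝ (G.toL2 fun x => fderiv ℝ χ x v) (G.toL2 φ) := by
    intro φ hφ
    have hφ1 : ContDiff ℝ 1 φ := hφ.contDiff.of_le (by simp)
    have hcφ : Continuous fun x => fderiv ℝ φ x v :=
      (hφ1.continuous_fderiv one_ne_zero).clm_apply continuous_const
    have e1 : inner ℝ (G.toL2 fun x => χ x • v) (G.toL2 (gradient φ)) = ∫ x, χ x * fderiv ℝ φ x v := by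
      rw [← setIntegral_eq_integral_of_forall_compl_eq_zero (μ := volume)
        (s := G.region) (f := fun x => χ x * fderiv ℝ φ x v)
        (fun x hx => by rw [hz x hx, zero_mul]), L2.inner_def]
      refine integral_congr_ae ?_
      filter_upwards [coeFn_toL2 m1, coeFn_toL2 (hφ.memLp_gradient hG)] with x h1 h2
      rw [h1, h2, real_inner_smul_left, gradient, real_inner_comm,
        InnerProductSpace.toDual_symm_apply]
    have e2 : inner ℝ (G.toL2 fun x => fderiv ℝ χ x v) (G.toL2 φ) = ∫ x, fderiv ℝ χ x v * φ x := by
      rw [← setIntegral_eq_integral_of_forall_compl_eq_zero (μ := volume)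
        (s := G.region) (f := fun x => fderiv ℝ χ x v * φ x)
        (fun x hx => by rw [hz' x hx]; simp), L2.inner_def]
      refine integral_congr_ae ?_
      filter_upwards [coeFn_toL2 m2, coeFn_toL2 (hφ.memLp hG)] with x h1 h2
      rw [h1, h2, real_inner_eq_mul]
    rw [e1, e2]
    have hcd : HasCompactSupport fun x => fderiv ℝ χ x v := hχc.fderiv_apply (𝕜 := ℝ) v
    refine integral_mul_fderiv_eq_neg_fderiv_mul_of_integrable ?_ ?_ ?_
      (fun x _ => hχ1.differentiable (by simp) x) (fun x _ => hφ1.differentiable (by simp) x)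
    · exact (hc2.mul hφ1.continuous).integrable_of_hasCompactSupport hcd.mul_right
    · exact (hχ.continuous.mul hcφ).integrable_of_hasCompactSupport hχc.mul_right
    · exact (hχ.continuous.mul hφ1.continuous).integrable_of_hasCompactSupport hχc.mul_right
  obtain ⟨φ, hφ, hlim⟩ := exists_seq_test hG u
  have h1 : Tendsto (fun n => G.toL2 (φ n)) atTop (𝓝 (val u)) :=
    (WithLp.fstL 2 ℝ G.L2 G.L2Vec).continuous.continuousAt.tendsto.comp hlim
  have h2 : Tendsto (fun n => G.toL2 (gradient (φ n))) atTop (𝓝 (grad u)) :=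
    (WithLp.sndL 2 ℝ G.L2 G.L2Vec).continuous.continuousAt.tendsto.comp hlim
  refine tendsto_nhds_unique (tendsto_const_nhds.inner h2) ?_
  simp only [htest _ (hφ _)]
  exact (tendsto_const_nhds.inner h1).neg

/-- A member of `H¹` is determined by the underlying `L²`-function. -/
lemma val_injective (hG : G.Admissible) : Function.Injective (val : G.H1 → G.L2) := by
  have key : ∀ u : G.H1, val u = 0 → u = 0 := by
    intro u hu
    obtain ⟨U, hU, hUr, hUae, -⟩ := exists_open_full hG
    -- If the function vanishes, integration by parts shows that the gradient is orthogonal to every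
    -- χ v, hence zero.
    have hg : grad u = 0 := by
      have := hU.ae_eq_zero_of_integral_contDiff_smul_eq_zero (μ := G.μ) (f := grad u)
        ((locallyIntegrable_Lp hG (grad u)).locallyIntegrableOn U) (by
          intro χ h1 h2 h3
          refine ext_inner_left ℝ fun v => ?_
          have m1 : MemLp (fun x => χ x • v) 2 G.μ :=
            memLp_of_continuous hG (h1.continuous.smul continuous_const) 2
          have h := inner_grad_eq_neg hG hUr h1 h2 h3 v u
          rw [hu, inner_zero_right, neg_zero, L2.inner_def] at h
          have hfin := isFiniteMeasure_μ hG
          obtain ⟨C, hC⟩ := h2.exists_bound_of_continuous h1.continuous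
          rw [inner_zero_right, ← integral_inner, ← h]
          · refine integral_congr_ae ?_
            filter_upwards [coeFn_toL2 m1] with x hx
            rw [hx, real_inner_smul_left, real_inner_smul_right]
          · exact Integrable.bdd_smul ((Lp.memLp (grad u)).integrable one_le_two) C
              h1.continuous.aestronglyMeasurable (ae_of_all _ hC))
      refine Lp.eq_zero_iff_ae_eq_zero.2 ?_
      filter_upwards [this, hUae] with x hx hx' using hx hx'
    have h0 := norm_sq_H1 u
    rw [hu, hg, norm_zero, norm_zero] at h0
    simpa using h0
  intro u q h
  rw [← sub_eq_zero]
  refine key _ ?_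
  rw [← valL_apply, map_sub, valL_apply, valL_apply, h, sub_self]

end Density

end Geometry

/-! ### Strong convergence from norm bounds and weak convergence on a dense set -/

section StrongConvergence

/-- In a Hilbert space, a sequence converges strongly as soon as its norms do not exceed the norm of
the limit and it converges weakly against a dense set. -/
lemma tendsto_of_inner_dense {X : Type*} [NormedAddCommGroup X] [InnerProductSpace ℝ X] {ι : Type*}
    {l : Filter ι} {w : ι → X} {x : X} {D : Set X} (hD : Dense D) (hw : ∀ i, ‖w i‖ ≤ ‖x‖)
    (h : ∀ z ∈ D, Tendsto (fun i => inner ℝ (w i) z) l (𝓝 (inner ℝ x z))) :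
    Tendsto w l (𝓝 x) := by
  have hx : Tendsto (fun i => inner ℝ (w i) x) l (𝓝 (inner ℝ x x)) := by
    rw [Metric.tendsto_nhds]
    intro ε hε
    -- The tolerance makes ‖x‖ ‖x − z‖ < ε/4, which controls both terms containing x − z.
    obtain ⟨z, hzD, hz⟩ := hD.exists_dist_lt x (ε := ε / (4 * (‖x‖ + 1))) (by positivity)
    have h1 := (Metric.tendsto_nhds.1 (h z hzD)) (ε / 4) (by positivity)
    filter_upwards [h1] with i hi
    rw [Real.dist_eq] at hi ⊢
    rw [dist_eq_norm, lt_div_iff₀ (by positivity)] at hz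
    have e : inner ℝ (w i) x - inner ℝ x x = inner ℝ (w i) (x - z) +
        (inner ℝ (w i) z - inner ℝ x z) - inner ℝ x (x - z) := by
      simp only [inner_sub_right]; ring
    have b1 : |inner ℝ (w i) (x - z)| ≤ ‖x‖ * ‖x - z‖ :=
      (abs_real_inner_le_norm _ _).trans (by gcongr; exact hw i)
    have b2 : |inner ℝ x (x - z)| ≤ ‖x‖ * ‖x - z‖ := abs_real_inner_le_norm _ _
    have b3 : ‖x‖ * ‖x - z‖ < ε / 4 := by
      have := norm_nonneg (x - z)
      nlinarith
    rw [e]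
    rw [abs_lt] at hi ⊢
    rw [abs_le] at b1 b2
    constructor <;> linarith [b1.1, b1.2, b2.1, b2.2, hi.1, hi.2]
  rw [tendsto_iff_norm_sub_tendsto_zero]
  have h3 : Tendsto (fun i => ‖w i - x‖ ^ 2) l (𝓝 0) := by
    have hup : Tendsto (fun i => 2 * ‖x‖ ^ 2 - 2 * inner ℝ (w i) x) l (𝓝 0) := by
      have := (hx.const_mul 2).const_sub (2 * ‖x‖ ^ 2)
      rwa [real_inner_self_eq_norm_sq, sub_self] at this
    refine squeeze_zero (fun i => by positivity) (fun i => ?_) hup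
    rw [norm_sub_sq_real]
    have := pow_le_pow_left₀ (norm_nonneg _) (hw i) 2
    linarith
  simpa using h3.sqrt

end StrongConvergence

namespace Geometry

variable {G : Geometry}

/-! ### The resolvent (1 − εΔ)⁻¹ -/

section Resolvent

/-- `R = (1 - εΔ)⁻¹` as an operator from `L²` to `H¹`. -/
def IsResolvent (G : Geometry) (ε : ℝ) (R : G.L2 →L[ℝ] G.H1) : Prop :=
  ∀ w q, inner ℝ (val (R w)) (val q) + ε * inner ℝ (grad (R w)) (grad q) = inner ℝ w (val q)

lemma val_add (p q : G.H1) : val (p + q) = val p + val q := rfl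
lemma val_sub (p q : G.H1) : val (p - q) = val p - val q := rfl
lemma val_smul (c : ℝ) (p : G.H1) : val (c • p) = c • val p := rfl
lemma grad_add (p q : G.H1) : grad (p + q) = grad p + grad q := rfl
lemma grad_sub (p q : G.H1) : grad (p - q) = grad p - grad q := rfl
lemma grad_smul (c : ℝ) (p : G.H1) : grad (c • p) = c • grad p := rfl

/-- The bilinear form `(p, q) + ε (∇p, ∇q)` on `H¹`. -/
def resolventForm (G : Geometry) (ε : ℝ) : G.H1 →L[ℝ] G.H1 →L[ℝ] ℝ :=
  LinearMap.mkContinuous₂ (LinearMap.mk₂ ℝ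
    (fun p q : G.H1 => inner ℝ (val p) (val q) + ε * inner ℝ (grad p) (grad q))
    (fun p p' q => by simp only [val_add, grad_add, inner_add_left]; ring)
    (fun c p q => by
      simp only [val_smul, grad_smul, real_inner_smul_left, smul_eq_mul]; ring)
    (fun p q q' => by simp only [val_add, grad_add, inner_add_right]; ring)
    (fun c p q => by
      simp only [val_smul, grad_smul, real_inner_smul_right, smul_eq_mul]; ring)) (1 + |ε|)
    (fun p q => by
      rw [LinearMap.mk₂_apply]
      refine (norm_add_le _ _).trans ?_
      rw [norm_mul]
      have h1 : ‖inner ℝ (val p) (val q)‖ ≤ ‖p‖ * ‖q‖ := (norm_inner_le_norm _ _).trans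
        (mul_le_mul (norm_val_le p) (norm_val_le q) (norm_nonneg _) (norm_nonneg _))
      have h2 : ‖inner ℝ (grad p) (grad q)‖ ≤ ‖p‖ * ‖q‖ := (norm_inner_le_norm _ _).trans
        (mul_le_mul (norm_grad_le p) (norm_grad_le q) (norm_nonneg _) (norm_nonneg _))
      have h3 : ‖ε‖ * ‖inner ℝ (grad p) (grad q)‖ ≤ |ε| * (‖p‖ * ‖q‖) := by
        rw [Real.norm_eq_abs]; gcongr
      calc _ ≤ ‖p‖ * ‖q‖ + |ε| * (‖p‖ * ‖q‖) := add_le_add h1 h3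
        _ = _ := by ring)

lemma resolventForm_apply (ε : ℝ) (p q : G.H1) : G.resolventForm ε p q =
    inner ℝ (val p) (val q) + ε * inner ℝ (grad p) (grad q) := rfl

/-- Lax-Milgram: the form is coercive on H¹ with constant min(1, ε), and R inverts it after the
adjoint of the inclusion of H¹ in L². -/
lemma exists_isResolvent {ε : ℝ} (hε : 0 < ε) : ∃ R, G.IsResolvent ε R := by
  have hco : IsCoercive (G.resolventForm ε) := by
    refine ⟨min 1 ε, lt_min one_pos hε, fun u => ?_⟩
    rw [resolventForm_apply, real_inner_self_eq_norm_sq, real_inner_self_eq_norm_sq, mul_assoc,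
      ← pow_two, norm_sq_H1]
    have h1 : min 1 ε * ‖val u‖ ^ 2 ≤ 1 * ‖val u‖ ^ 2 := by gcongr; exact min_le_left _ _
    have h2 : min 1 ε * ‖grad u‖ ^ 2 ≤ ε * ‖grad u‖ ^ 2 := by gcongr; exact min_le_right _ _
    linarith
  refine ⟨(hco.continuousLinearEquivOfBilin.symm : G.H1 →L[ℝ] G.H1).comp
    (ContinuousLinearMap.adjoint G.valL), fun w q => ?_⟩
  rw [← resolventForm_apply, ← hco.continuousLinearEquivOfBilin_apply]
  simp only [ContinuousLinearMap.comp_apply, ContinuousLinearEquiv.coe_coe,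
    ContinuousLinearEquiv.apply_symm_apply, ContinuousLinearMap.adjoint_inner_left]
  rfl

variable {ε : ℝ} {R : G.L2 →L[ℝ] G.H1}

lemma IsResolvent.symm (hR : G.IsResolvent ε R) (w z : G.L2) :
    inner ℝ (val (R w)) z = inner ℝ w (val (R z)) := by
  have h1 := hR w (R z)
  have h2 := hR z (R w)
  rw [real_inner_comm (val (R w)), real_inner_comm (grad (R w))] at h2
  rw [← h1, real_inner_comm, ← h2]

lemma IsResolvent.norm_val_le (hε : 0 < ε) (hR : G.IsResolvent ε R) (w : G.L2) :
    ‖val (R w)‖ ≤ ‖w‖ := by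
  have h := hR w (R w)
  rw [real_inner_self_eq_norm_sq, real_inner_self_eq_norm_sq] at h
  have h2 := real_inner_le_norm w (val (R w))
  have h3 : 0 ≤ ε * ‖grad (R w)‖ ^ 2 := by positivity
  by_contra hlt
  push Not at hlt
  nlinarith [norm_nonneg w, norm_nonneg (val (R w))]

/-- Testing the resolvent equation with Rp − p gives ‖Rp − p‖² = −ε (∇Rp, ∇Rp − ∇p). Nonnegativity
of the left side yields the first bound, and Cauchy-Schwarz with the first bound yields the second.
-/
lemma IsResolvent.norm_grad_le (hε : 0 < ε) (hR : G.IsResolvent ε R) (p : G.H1) :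
    ‖grad (R (val p))‖ ≤ ‖grad p‖ ∧ ‖val (R (val p)) - val p‖ ^ 2 ≤ ε * ‖grad p‖ ^ 2 := by
  have h := hR (val p) (R (val p) - p)
  rw [val_sub, grad_sub] at h
  have h1 : ‖val (R (val p)) - val p‖ ^ 2 =
      -(ε * inner ℝ (grad (R (val p))) (grad (R (val p)) - grad p)) := by
    rw [← real_inner_self_eq_norm_sq, inner_sub_left]; linarith
  rw [inner_sub_right, real_inner_self_eq_norm_sq] at h1
  have h2 := real_inner_le_norm (grad (R (val p))) (grad p)
  have h3 : 0 ≤ ‖val (R (val p)) - val p‖ ^ 2 := by positivity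
  have h4 : ‖grad (R (val p))‖ ≤ ‖grad p‖ := by
    by_contra hlt
    push Not at hlt
    have : 0 < ‖grad (R (val p))‖ ^ 2 - inner ℝ (grad (R (val p))) (grad p) := by
      nlinarith [norm_nonneg (grad p)]
    nlinarith [mul_pos hε this]
  refine ⟨h4, ?_⟩
  rw [h1, ← mul_neg]
  gcongr
  nlinarith [norm_nonneg (grad p), norm_nonneg (grad (R (val p))), sq_nonneg ‖grad (R (val p))‖]

/-- This is −ΔR = ε⁻¹(1 − R): after smoothing, the Laplacian becomes a bounded operator of L². -/
lemma IsResolvent.inner_grad (hR : G.IsResolvent ε R) (hε : 0 < ε) (p : G.H1) (ψ : G.L2) :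
    inner ℝ (grad p) (grad (R ψ)) = ε⁻¹ * inner ℝ (val p - val (R (val p))) ψ := by
  have h := hR ψ p
  rw [real_inner_comm, real_inner_comm (grad p), real_inner_comm (val p) ψ] at h
  rw [inner_sub_left, hR.symm]
  field_simp
  linarith

lemma IsResolvent.eq_of_forall (hε : 0 < ε) (hR : G.IsResolvent ε R) {w : G.L2} {p : G.H1}
    (hp : ∀ q, inner ℝ (val p) (val q) + ε * inner ℝ (grad p) (grad q) = inner ℝ w (val q)) :
    R w = p := by
  have h1 := hR w (R w - p)
  have h2 := hp (R w - p)
  have h3 : inner ℝ (val (R w - p)) (val (R w - p)) +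
      ε * inner ℝ (grad (R w - p)) (grad (R w - p)) = 0 := by
    conv_lhs => rw [show val (R w - p) = val (R w) - val p from rfl,
      show grad (R w - p) = grad (R w) - grad p from rfl]
    rw [val_sub, grad_sub] at h1 h2
    rw [inner_sub_left, inner_sub_left]
    linarith
  rw [real_inner_self_eq_norm_sq, real_inner_self_eq_norm_sq] at h3
  have h4 : 0 ≤ ‖val (R w - p)‖ ^ 2 := by positivity
  have h5 : 0 ≤ ‖grad (R w - p)‖ ^ 2 := by positivity
  have h6 : ‖grad (R w - p)‖ ^ 2 = 0 := by nlinarith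
  have h7 : ‖R w - p‖ ^ 2 = 0 := by rw [norm_sq_H1]; nlinarith
  rwa [pow_eq_zero_iff two_ne_zero, norm_eq_zero, sub_eq_zero] at h7

/-- If Rw = 0, then w is orthogonal to the dense subspace H¹. Injectivity allows the velocity to be
recovered from its smoothed version. -/
lemma IsResolvent.val_injective (hG : G.Admissible) (hR : G.IsResolvent ε R) :
    Function.Injective ((G.valL).comp R) := by
  rw [injective_iff_map_eq_zero]
  intro w hw
  have h0 : R w = 0 := Geometry.val_injective hG hw
  refine eq_zero_of_inner_val hG fun q => ?_
  rw [← hR w q, h0]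
  change inner ℝ (0 : G.L2) _ + ε * inner ℝ (0 : G.L2Vec) _ = 0
  rw [inner_zero_left, inner_zero_left, mul_zero, add_zero]

/-- For ε = 1 the resolvent form is the inner product of H¹, so (Rψ, p) in H¹ equals (ψ, p) in L²;
only p = 0 is orthogonal to the range. -/
lemma dense_range_resolvent (hG : G.Admissible) {R : G.L2 →L[ℝ] G.H1} (hR : G.IsResolvent 1 R) :
    DenseRange R := by
  have h : (LinearMap.range R.toLinearMap).topologicalClosure = ⊤ := by
    rw [Submodule.topologicalClosure_eq_top_iff, Submodule.eq_bot_iff]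
    intro p hp
    have h0 : val p = 0 := by
      refine ext_inner_left ℝ fun ψ => ?_
      have h1 : inner ℝ (R ψ) p = 0 := (Submodule.mem_orthogonal _ _).1 hp _ ⟨ψ, rfl⟩
      rw [inner_zero_right, ← h1, ← hR ψ p, inner_H1, one_mul]
    exact Geometry.val_injective hG h0
  exact Submodule.dense_iff_topologicalClosure_eq_top.2 h

/-- On H¹ the error is at most √ε ‖∇p‖. Symmetry turns this into weak convergence against H¹ for
every w, and contractivity upgrades it to strong convergence. -/
lemma tendsto_resolvent (hG : G.Admissible) {ε : ℕ → ℝ} {R : ℕ → G.L2 →L[ℝ] G.H1}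
    (hε : ∀ n, 0 < ε n) (hε0 : Tendsto ε atTop (𝓝 0)) (hR : ∀ n, G.IsResolvent (ε n) (R n))
    (w : G.L2) : Tendsto (fun n => val (R n w)) atTop (𝓝 w) := by
  have hp : ∀ p : G.H1, Tendsto (fun n => val (R n (val p))) atTop (𝓝 (val p)) := by
    intro p
    rw [tendsto_iff_norm_sub_tendsto_zero]
    have h3 : Tendsto (fun n => ‖val (R n (val p)) - val p‖ ^ 2) atTop (𝓝 0) := by
      refine squeeze_zero (fun n => by positivity) (fun n => ((hR n).norm_grad_le (hε n) p).2) ?_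
      simpa using hε0.mul_const (‖grad p‖ ^ 2)
    simpa using h3.sqrt
  refine tendsto_of_inner_dense (dense_range_valL hG) (fun n => (hR n).norm_val_le (hε n) w) ?_
  rintro _ ⟨p, rfl⟩
  simp only [(hR _).symm]
  exact tendsto_const_nhds.inner (hp p)

/-- R is also a contraction in the H¹ norm. Against the dense range of R₁, the H¹ inner product
reduces to the L² inner product, where convergence is known. -/
lemma tendsto_resolvent_H1 (hG : G.Admissible) {ε : ℕ → ℝ} {R : ℕ → G.L2 →L[ℝ] G.H1}
    (hε : ∀ n, 0 < ε n) (hε0 : Tendsto ε atTop (𝓝 0)) (hR : ∀ n, G.IsResolvent (ε n) (R n))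
    (p : G.H1) : Tendsto (fun n => R n (val p)) atTop (𝓝 p) := by
  obtain ⟨R₁, hR₁⟩ := exists_isResolvent (G := G) one_pos
  refine tendsto_of_inner_dense (dense_range_resolvent hG hR₁) (fun n => ?_) ?_
  · refine abs_le_of_sq_le_sq' ?_ (norm_nonneg _) |>.2
    rw [norm_sq_H1, norm_sq_H1]
    gcongr
    · exact (hR n).norm_val_le (hε n) _
    · exact ((hR n).norm_grad_le (hε n) p).1
  · rintro _ ⟨ψ, rfl⟩
    have e : ∀ q : G.H1, inner ℝ q (R₁ ψ) = inner ℝ (val q) ψ := fun q => by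
      have := hR₁ ψ q
      rw [one_mul, ← inner_H1] at this
      rw [real_inner_comm, this, real_inner_comm]
    simp only [e]
    exact (tendsto_resolvent hG hε hε0 hR (val p)).inner tendsto_const_nhds

end Resolvent

/-! ### Spectral projections and fractional powers of −Δ -/

section Spectral

/-- A lift of a member of an eigenspace to `H¹`. -/
lemma exists_lift_of_mem_eigenspace {lam : ℝ} {w : G.L2} (hw : w ∈ G.eigenspace lam) :
    ∃ p : G.H1, val p = w ∧ ∀ q : G.H1, inner ℝ (grad p) (grad q) = lam * inner ℝ w (val q) := by
  obtain ⟨p, rfl, hp⟩ := hw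
  exact ⟨p, rfl, hp⟩

/-- Testing with the function itself gives ‖∇p‖² = lam ‖p‖². As the spectral sums run over all real
lam, this removes the negative ones, where the powers lam^θ have no spectral meaning. -/
lemma eq_zero_of_mem_eigenspace {lam : ℝ} (hlam : lam < 0) {w : G.L2} (hw : w ∈ G.eigenspace lam) :
    w = 0 := by
  obtain ⟨p, rfl, hp⟩ := exists_lift_of_mem_eigenspace hw
  have h := hp p
  rw [real_inner_self_eq_norm_sq, real_inner_self_eq_norm_sq] at h
  have h1 : 0 ≤ ‖grad p‖ ^ 2 := by positivity
  have h2 : 0 ≤ ‖val p‖ ^ 2 := by positivity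
  have h3 : ‖val p‖ ^ 2 = 0 := by nlinarith
  simpa using h3

lemma IsResolvent.val_of_mem_eigenspace {ε : ℝ} {R : G.L2 →L[ℝ] G.H1} (hε : 0 < ε)
    (hR : G.IsResolvent ε R) {lam : ℝ} (hlam : 0 ≤ lam) {w : G.L2} (hw : w ∈ G.eigenspace lam) :
    val (R w) = (1 + ε * lam)⁻¹ • w := by
  obtain ⟨p, rfl, hp⟩ := exists_lift_of_mem_eigenspace hw
  have hpos : 0 < 1 + ε * lam := by positivity
  rw [hR.eq_of_forall hε (p := (1 + ε * lam)⁻¹ • p) fun q => ?_]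
  · rfl
  · rw [val_smul, grad_smul, real_inner_smul_left, real_inner_smul_left, hp]
    field_simp

/-- For lam ≥ 0 the eigenspace is the eigenspace of a bounded operator, the resolvent, with
eigenvalue 1/(1 + lam). -/
lemma isClosed_eigenspace (lam : ℝ) : IsClosed (G.eigenspace lam : Set G.L2) := by
  rcases lt_or_ge lam 0 with h | h
  · have : (G.eigenspace lam : Set G.L2) = {0} := by
      ext w
      exact ⟨fun hw => eq_zero_of_mem_eigenspace h hw, fun hw => by
        rw [mem_singleton_iff] at hw; rw [hw]; exact (G.eigenspace lam).zero_mem⟩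
    rw [this]
    exact isClosed_singleton
  · obtain ⟨R, hR⟩ := exists_isResolvent (G := G) one_pos
    have hpos : 0 < 1 + lam := by positivity
    have : (G.eigenspace lam : Set G.L2) = {w | G.valL (R w) = (1 + lam)⁻¹ • w} := by
      ext w
      refine ⟨fun hw => ?_, fun hw => ?_⟩
      · have := hR.val_of_mem_eigenspace one_pos h hw
        rwa [one_mul] at this
      · have hw' : val ((1 + lam) • R w) = w := by
          rw [val_smul, ← valL_apply, hw, smul_inv_smul₀ hpos.ne']
        refine ⟨(1 + lam) • R w, hw', fun q => ?_⟩
        have h1 := hR w q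
        rw [hw', grad_smul, real_inner_smul_left]
        have h2 : inner ℝ (val (R w)) (val q) = (1 + lam)⁻¹ * inner ℝ w (val q) := by
          rw [← valL_apply (R w), hw, real_inner_smul_left]
        rw [h2] at h1
        have h3 : inner ℝ (grad (R w)) (grad q) = inner ℝ w (val q) - (1 + lam)⁻¹ * inner ℝ w (val q) := by
          linarith
        rw [h3]
        field_simp
        ring
    rw [this]
    exact isClosed_eq (G.valL.comp R).continuous (continuous_const_smul _)

lemma spectralProj_mem (lam : ℝ) (w : G.L2) : G.spectralProj lam w ∈ G.eigenspace lam := by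
  have h : G.spectralProj lam w ∈ (G.eigenspace lam).topologicalClosure :=
    Submodule.starProjection_apply_mem _ w
  rwa [(isClosed_eigenspace lam).submodule_topologicalClosure_eq] at h

lemma spectralProj_eq_self {lam : ℝ} {w : G.L2} (hw : w ∈ G.eigenspace lam) :
    G.spectralProj lam w = w :=
  Submodule.starProjection_eq_self_iff.2 (Submodule.le_topologicalClosure _ hw)

lemma inner_spectralProj_left (lam : ℝ) (w z : G.L2) :
    inner ℝ (G.spectralProj lam w) z = inner ℝ w (G.spectralProj lam z) :=
  Submodule.inner_starProjection_left_eq_right _ w z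

lemma spectralProj_of_neg {lam : ℝ} (h : lam < 0) (w : G.L2) : G.spectralProj lam w = 0 :=
  eq_zero_of_mem_eigenspace h (spectralProj_mem lam w)

lemma inner_self_spectralProj (lam : ℝ) (w : G.L2) :
    inner ℝ w (G.spectralProj lam w) = ‖G.spectralProj lam w‖ ^ 2 := by
  rw [← real_inner_self_eq_norm_sq, inner_spectralProj_left,
    spectralProj_eq_self (spectralProj_mem lam w)]

lemma inner_eq_zero_of_mem_eigenspace {lam mu : ℝ} (hne : lam ≠ mu) {w z : G.L2}
    (hw : w ∈ G.eigenspace lam) (hz : z ∈ G.eigenspace mu) : inner ℝ w z = 0 := by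
  obtain ⟨p, rfl, hp⟩ := exists_lift_of_mem_eigenspace hw
  obtain ⟨q, rfl, hq⟩ := exists_lift_of_mem_eigenspace hz
  have h1 := hp q
  have h2 := hq p
  rw [real_inner_comm, h1, real_inner_comm (val p)] at h2
  have h3 : (lam - mu) * inner ℝ (val p) (val q) = 0 := by linarith
  exact (mul_eq_zero.1 h3).resolve_left (sub_ne_zero.2 hne)

/-- The resolvent is symmetric and acts on the eigenspace as a scalar, so it can be moved onto the
projected test vector. -/
lemma spectralProj_resolvent {ε : ℝ} {R : G.L2 →L[ℝ] G.H1} (hε : 0 < ε)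
    (hR : G.IsResolvent ε R) {lam : ℝ} (hlam : 0 ≤ lam) (w : G.L2) :
    G.spectralProj lam (val (R w)) = (1 + ε * lam)⁻¹ • G.spectralProj lam w := by
  refine ext_inner_right ℝ fun z => ?_
  rw [inner_spectralProj_left, hR.symm, hR.val_of_mem_eigenspace hε hlam (spectralProj_mem lam z),
    real_inner_smul_right, real_inner_smul_left, inner_spectralProj_left]

/-- Bessel's inequality in `H¹`. -/
lemma sum_mul_norm_spectralProj_sq_le (p : G.H1) (F : Finset ℝ) :
    ∑ lam ∈ F, lam * ‖G.spectralProj lam (val p)‖ ^ 2 ≤ ‖grad p‖ ^ 2 := by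
  -- The gradients of the spectral components are mutually orthogonal, so S is both (∇p, s) and
  -- ‖s‖²; the claim is ‖∇p − s‖² ≥ 0.
  choose e he hee using fun lam => exists_lift_of_mem_eigenspace (spectralProj_mem lam (val p))
  set S := ∑ lam ∈ F, lam * ‖G.spectralProj lam (val p)‖ ^ 2 with hS
  set s := ∑ lam ∈ F, grad (e lam) with hs
  have h1 : inner ℝ (grad p) s = S := by
    rw [hs, inner_sum]
    refine Finset.sum_congr rfl fun lam _ => ?_
    rw [real_inner_comm, hee, real_inner_comm, inner_self_spectralProj]
  have h2 : inner ℝ s s = S := by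
    rw [hs, sum_inner]
    refine Finset.sum_congr rfl fun lam hlam => ?_
    rw [inner_sum, Finset.sum_eq_single lam]
    · rw [hee, he, real_inner_self_eq_norm_sq]
    · intro mu _ hne
      rw [hee, he, inner_eq_zero_of_mem_eigenspace hne.symm (spectralProj_mem _ _)
        (spectralProj_mem _ _), mul_zero]
    · exact fun h => absurd hlam h
  have h3 : 0 ≤ ‖grad p - s‖ ^ 2 := by positivity
  rw [norm_sub_sq_real, h1, ← real_inner_self_eq_norm_sq s, h2] at h3
  linarith

lemma rpow_mul_norm_spectralProj_sq_nonneg (θ lam : ℝ) (w : G.L2) :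
    0 ≤ lam ^ θ * ‖G.spectralProj lam w‖ ^ 2 := by
  rcases lt_or_ge lam 0 with h | h
  · rw [spectralProj_of_neg h]; simp
  · positivity

lemma norm_sq_rpow_smul_spectralProj (θ lam : ℝ) (w : G.L2) :
    ‖lam ^ θ • G.spectralProj lam w‖ ^ 2 = lam ^ (2 * θ) * ‖G.spectralProj lam w‖ ^ 2 := by
  rcases lt_or_ge lam 0 with h | h
  · rw [spectralProj_of_neg h]; simp
  · rw [norm_smul, mul_pow, Real.norm_of_nonneg (by positivity), ← Real.rpow_natCast,
      ← Real.rpow_mul h, mul_comm θ]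
    norm_num

/-- The eigenspaces are mutually orthogonal, so the series converges as soon as the squared norms
are summable. -/
lemma summable_rpow_smul_spectralProj {θ : ℝ} {w : G.L2}
    (h : Summable fun lam : ℝ => lam ^ (2 * θ) * ‖G.spectralProj lam w‖ ^ 2) :
    Summable fun lam : ℝ => lam ^ θ • G.spectralProj lam w := by
  have hV : OrthogonalFamily ℝ (fun lam : ℝ => G.eigenspace lam)
      fun lam => (G.eigenspace lam).subtypeₗᵢ := by
    refine OrthogonalFamily.of_pairwise fun lam mu hne => ?_
    rw [Function.onFun, Submodule.isOrtho_iff_inner_eq]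
    exact fun w hw z hz => inner_eq_zero_of_mem_eigenspace hne hw hz
  have := (hV.summable_iff_norm_sq_summable fun lam : ℝ =>
    (⟨lam ^ θ • G.spectralProj lam w, (G.eigenspace lam).smul_mem _ (spectralProj_mem lam w)⟩ :
      G.eigenspace lam)).2 (by
        refine h.congr fun lam => ?_
        rw [← norm_sq_rpow_smul_spectralProj]
        rfl)
  exact this

lemma inner_fracLap {θ : ℝ} {w : G.L2}
    (h : Summable fun lam : ℝ => lam ^ (2 * θ) * ‖G.spectralProj lam w‖ ^ 2) (z : G.L2) :
    inner ℝ z (G.fracLap θ w) = ∑' lam : ℝ, lam ^ θ * inner ℝ z (G.spectralProj lam w) := by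
  have h1 := ((summable_rpow_smul_spectralProj h).hasSum.mapL (innerSL ℝ z)).tsum_eq
  simp only [innerSL_apply_apply, real_inner_smul_right] at h1
  exact h1.symm

lemma norm_fracLap_sq {θ : ℝ} {w : G.L2}
    (h : Summable fun lam : ℝ => lam ^ (2 * θ) * ‖G.spectralProj lam w‖ ^ 2) :
    ‖G.fracLap θ w‖ ^ 2 = ∑' lam : ℝ, lam ^ (2 * θ) * ‖G.spectralProj lam w‖ ^ 2 := by
  rw [← real_inner_self_eq_norm_sq, inner_fracLap h]
  refine tsum_congr fun lam => ?_
  rw [real_inner_comm, inner_fracLap h, tsum_eq_single lam]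
  · rw [← norm_sq_rpow_smul_spectralProj, ← real_inner_self_eq_norm_sq, real_inner_smul_left,
      real_inner_smul_right]
  · intro mu hne
    rw [inner_eq_zero_of_mem_eigenspace hne.symm (spectralProj_mem _ _) (spectralProj_mem _ _),
      mul_zero]

lemma summable_mul_norm_spectralProj_sq (p : G.H1) :
    Summable (fun lam : ℝ => lam ^ (2 * (1 / 2 : ℝ)) * ‖G.spectralProj lam (val p)‖ ^ 2) ∧
    ∑' lam : ℝ, lam ^ (2 * (1 / 2 : ℝ)) * ‖G.spectralProj lam (val p)‖ ^ 2 ≤ ‖grad p‖ ^ 2 := by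
  have hb : ∀ F : Finset ℝ, ∑ lam ∈ F, lam ^ (2 * (1 / 2 : ℝ)) * ‖G.spectralProj lam (val p)‖ ^ 2 ≤
      ‖grad p‖ ^ 2 := fun F => by
    refine le_trans (le_of_eq (Finset.sum_congr rfl fun lam _ => ?_))
      (sum_mul_norm_spectralProj_sq_le p F)
    norm_num
  exact ⟨summable_of_sum_le (fun lam => rpow_mul_norm_spectralProj_sq_nonneg _ _ _) hb,
    Real.tsum_le_of_sum_le (fun lam => rpow_mul_norm_spectralProj_sq_nonneg _ _ _) hb⟩

/-- The operator `(-Δ)^{1/2} : H¹ → L²`. -/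
def sqrtLap (G : Geometry) : G.H1 →L[ℝ] G.L2 :=
  LinearMap.mkContinuous
    { toFun := fun p => G.fracLap (1 / 2) (val p)
      map_add' := fun p q => by
        have hp := summable_rpow_smul_spectralProj (summable_mul_norm_spectralProj_sq p).1
        have hq := summable_rpow_smul_spectralProj (summable_mul_norm_spectralProj_sq q).1
        rw [fracLap, fracLap, fracLap, ← hp.tsum_add hq]
        simp only [val_add, map_add, smul_add]
      map_smul' := fun c p => by
        rw [fracLap, fracLap, RingHom.id_apply, ← tsum_const_smul'']
        simp only [val_smul, map_smul, smul_comm c] } 1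
    (fun p => by
      have h := summable_mul_norm_spectralProj_sq p
      have h1 : ‖G.fracLap (1 / 2) (val p)‖ ^ 2 ≤ ‖grad p‖ ^ 2 := by
        rw [norm_fracLap_sq h.1]; exact h.2
      rw [one_mul]
      exact (abs_le_of_sq_le_sq' h1 (norm_nonneg _)).2.trans (Geometry.norm_grad_le p))

lemma sqrtLap_apply (p : G.H1) : G.sqrtLap p = G.fracLap (1 / 2) (val p) := rfl

lemma fracLap_smul (θ c : ℝ) (w : G.L2) : G.fracLap θ (c • w) = c • G.fracLap θ w := by
  rw [fracLap, fracLap, ← tsum_const_smul'']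
  simp only [map_smul, smul_comm c]

/-- The smoothed dissipation is diagonal, with weights (1 + ελ)⁻² that lie in [0,1] for λ ≥ 0 and
tend to 1 as ε → 0. Completeness of the eigenfunctions plays no role. -/
lemma inner_sqrtLap_resolvent {ε : ℝ} {R : G.L2 →L[ℝ] G.H1} (hε : 0 < ε)
    (hR : G.IsResolvent ε R) (v : G.L2) : inner ℝ v (G.sqrtLap (R (val (R v)))) =
      ∑' lam : ℝ, lam ^ (1 / 2 : ℝ) * ((1 + ε * lam)⁻¹ ^ 2 * ‖G.spectralProj lam v‖ ^ 2) := by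
  rw [sqrtLap_apply, inner_fracLap (summable_mul_norm_spectralProj_sq _).1]
  refine tsum_congr fun lam => ?_
  rcases lt_or_ge lam 0 with h | h
  · rw [spectralProj_of_neg h, spectralProj_of_neg h]; simp
  · rw [spectralProj_resolvent hε hR h, spectralProj_resolvent hε hR h, real_inner_smul_right,
      real_inner_smul_right, inner_self_spectralProj]
    ring

lemma summable_of_hDeltaNormSq {v : G.L2} (h : G.hDeltaNormSq (1 / 2) v ≠ ⊤) :
    Summable (fun lam : ℝ => lam ^ (1 / 2 : ℝ) * ‖G.spectralProj lam v‖ ^ 2) ∧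
    ∑' lam : ℝ, lam ^ (1 / 2 : ℝ) * ‖G.spectralProj lam v‖ ^ 2 ≤
      (G.hDeltaNormSq (1 / 2) v).toReal := by
  have hle : ∀ lam : ℝ, ENNReal.ofReal (lam ^ (1 / 2 : ℝ) * ‖G.spectralProj lam v‖ ^ 2) ≤
      ENNReal.ofReal ((1 + lam) ^ (1 / 2 : ℝ)) * ‖G.spectralProj lam v‖ₑ ^ 2 := by
    intro lam
    rcases lt_or_ge lam 0 with h | h
    · rw [spectralProj_of_neg h]; simp
    · rw [ENNReal.ofReal_mul (by positivity), ← ofReal_norm, ENNReal.ofReal_pow (norm_nonneg _)]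
      gcongr
      linarith
  have hsum : ∑' lam : ℝ, ENNReal.ofReal (lam ^ (1 / 2 : ℝ) * ‖G.spectralProj lam v‖ ^ 2) ≤
      G.hDeltaNormSq (1 / 2) v := ENNReal.tsum_le_tsum hle
  have hne := ne_top_of_le_ne_top h hsum
  have e := fun lam : ℝ => ENNReal.toReal_ofReal (rpow_mul_norm_spectralProj_sq_nonneg (1 / 2) lam v)
  have hs := ENNReal.summable_toReal hne
  simp only [e] at hs
  refine ⟨hs, ?_⟩
  have h2 := ENNReal.toReal_mono h hsum
  rw [ENNReal.tsum_toReal_eq (fun lam => ENNReal.ofReal_ne_top)] at h2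
  simpa only [e] using h2

lemma inner_sqrtLap_resolvent_bound {ε : ℝ} {R : G.L2 →L[ℝ] G.H1} (hε : 0 < ε)
    (hR : G.IsResolvent ε R) {v : G.L2} (h : G.hDeltaNormSq (1 / 2) v ≠ ⊤) :
    ‖inner ℝ v (G.sqrtLap (R (val (R v))))‖ ≤ (G.hDeltaNormSq (1 / 2) v).toReal := by
  obtain ⟨hs, hle⟩ := summable_of_hDeltaNormSq h
  rw [inner_sqrtLap_resolvent hε hR]
  refine (tsum_of_norm_bounded hs.hasSum fun lam => ?_).trans hle
  rcases lt_or_ge lam 0 with h | h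
  · rw [spectralProj_of_neg h]; simp
  · have h1 : (1 + ε * lam)⁻¹ ≤ 1 := inv_le_one_of_one_le₀ (by nlinarith)
    have h0 : 0 ≤ (1 + ε * lam)⁻¹ := by positivity
    rw [Real.norm_of_nonneg (by positivity)]
    gcongr
    exact mul_le_of_le_one_left (by positivity) (pow_le_one₀ h0 h1)

/-- Dominated convergence for series: the terms λ^{1/2}‖P_λ v‖² are summable exactly because v lies
in H^{1/2}_Δ. -/
lemma tendsto_inner_sqrtLap_resolvent {ε : ℕ → ℝ} {R : ℕ → G.L2 →L[ℝ] G.H1}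
    (hε : ∀ n, 0 < ε n) (hε0 : Tendsto ε atTop (𝓝 0)) (hR : ∀ n, G.IsResolvent (ε n) (R n))
    {v : G.L2} (h : G.hDeltaNormSq (1 / 2) v ≠ ⊤) :
    Tendsto (fun n => inner ℝ v (G.sqrtLap (R n (val (R n v))))) atTop
      (𝓝 (‖G.fracLap (1 / 4) v‖ ^ 2)) := by
  obtain ⟨hs, -⟩ := summable_of_hDeltaNormSq h
  have h4 : (2 * (1 / 4 : ℝ)) = 1 / 2 := by norm_num
  rw [norm_fracLap_sq (by rw [h4]; exact hs), h4]
  simp only [inner_sqrtLap_resolvent (hε _) (hR _)]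
  refine tendsto_tsum_of_dominated_convergence hs (fun lam => ?_)
    (Eventually.of_forall fun n lam => ?_)
  · have : Tendsto (fun n => (1 + ε n * lam)⁻¹ ^ 2) atTop (𝓝 1) := by
      have := (((hε0.mul_const lam).const_add 1).inv₀ (by simp)).pow 2
      simpa using this
    have := (this.mul_const (‖G.spectralProj lam v‖ ^ 2)).const_mul (lam ^ (1 / 2 : ℝ))
    simpa using this
  · rcases lt_or_ge lam 0 with h | h
    · rw [spectralProj_of_neg h]; simp
    · have hn := hε n
      have h1 : (1 + ε n * lam)⁻¹ ≤ 1 := inv_le_one_of_one_le₀ (by nlinarith)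
      have h0 : 0 ≤ (1 + ε n * lam)⁻¹ := by positivity
      rw [Real.norm_of_nonneg (by positivity)]
      gcongr
      exact mul_le_of_le_one_left (by positivity) (pow_le_one₀ h0 h1)

end Spectral

end Geometry

/-! ### Truncation of the nonlinearity -/

section Truncation

/-- An admissible nonlinearity grows at most like `|r|⁵`, and it is approximated by bounded Lipschitz
functions with the same growth that agree with it on large intervals. -/
theorem IsAdmissibleNonlinearity.exists_truncation {f : ℝ → ℝ} {C κ K : ℝ}
    (hf : IsAdmissibleNonlinearity f C κ K) :
    ∃ (C₁ : ℝ) (F : ℕ → ℝ → ℝ), 0 ≤ C₁ ∧ (∀ r, |f r| ≤ C₁ * (1 + |r| ^ 5)) ∧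
      (∀ n r, |F n r| ≤ C₁ * (1 + |r| ^ 5)) ∧ (∀ n, ∃ L : ℝ≥0, LipschitzWith L (F n)) ∧
      (∀ n, ∃ M, ∀ r, |F n r| ≤ M) ∧ ∀ (n : ℕ) (r : ℝ), |r| ≤ n → F n r = f r := by
  have hdiff : Differentiable ℝ f := hf.contDiff.differentiable (by norm_num)
  have hC := hf.C_pos
  -- Mean value inequality on [−a, a] with the growth bound for f'.
  have hlip (a x y : ℝ) (hx : |x| ≤ a) (hy : |y| ≤ a) : |f y - f x| ≤ C * (1 + a ^ 4) * |y - x| := by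
    have := (convex_closedBall (0 : ℝ) a).norm_image_sub_le_of_norm_deriv_le (f := f)
      (C := C * (1 + a ^ 4)) (fun z _ => hdiff z) (fun z hz => ?_)
      (by simpa using hx) (by simpa using hy)
    · simpa using this
    · have hz' : |z| ≤ a := by simpa using hz
      refine (hf.deriv_growth z).trans ?_
      gcongr
  have hgrow (r : ℝ) : |f r| ≤ (|f 0| + 2 * C) * (1 + |r| ^ 5) := by
    have h1 := hlip |r| 0 r (by simp) le_rfl
    have h2 : |f r| ≤ |f 0| + |f r - f 0| := by
      have := abs_add_le (f 0) (f r - f 0)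
      simpa using this
    rw [sub_zero] at h1
    have h3 : |r| ≤ 1 + |r| ^ 5 := by
      rcases le_total |r| 1 with h | h
      · have := pow_nonneg (abs_nonneg r) 5
        linarith
      · have := le_self_pow₀ h (n := 5) (by norm_num)
        linarith
    have h4 : C * (1 + |r| ^ 4) * |r| ≤ C * (2 * (1 + |r| ^ 5)) := by
      have : (1 + |r| ^ 4) * |r| = |r| + |r| ^ 5 := by ring
      rw [mul_assoc, this]
      gcongr
      linarith
    have h5 := mul_nonneg (abs_nonneg (f 0)) (pow_nonneg (abs_nonneg r) 5)
    linarith [h5]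
  -- Truncation is composition with the clamp to [−n, n], a contraction that does not increase |r|;
  -- hence the growth bound is inherited uniformly in n.
  let p : ℕ → ℝ → ℝ := fun n r => max (-(n : ℝ)) (min (n : ℝ) r)
  have hp1 (n : ℕ) (r : ℝ) : |p n r| ≤ n := by
    have h0 : (0 : ℝ) ≤ n := n.cast_nonneg
    exact abs_le.2 ⟨le_max_left _ _, max_le (by linarith) (min_le_left _ _)⟩
  have hp2 (n : ℕ) (r : ℝ) (h : |r| ≤ n) : p n r = r := by
    have := abs_le.1 h
    simp only [p]
    rw [min_eq_right this.2, max_eq_right this.1]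
  have hp3 (n : ℕ) (r : ℝ) : |p n r| ≤ |r| := by
    rcases le_total |r| n with h | h
    · rw [hp2 n r h]
    · exact (hp1 n r).trans h
  have hp4 (n : ℕ) : LipschitzWith 1 (p n) := (LipschitzWith.id.const_min _).const_max _
  refine ⟨|f 0| + 2 * C, fun n r => f (p n r), by positivity, hgrow, fun n r => ?_, fun n => ?_,
    fun n => ?_, fun n r h => by simp only [hp2 n r h]⟩
  · refine (hgrow _).trans ?_
    have := hp3 n r
    gcongr
  · refine ⟨(C * (1 + (n : ℝ) ^ 4)).toNNReal, LipschitzWith.of_dist_le_mul fun x y => ?_⟩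
    rw [Real.dist_eq, Real.coe_toNNReal _ (by positivity)]
    refine (hlip n _ _ (hp1 n y) (hp1 n x)).trans ?_
    gcongr
    have := (hp4 n).dist_le_mul x y
    rwa [NNReal.coe_one, one_mul, Real.dist_eq] at this
  · refine ⟨(|f 0| + 2 * C) * (1 + (n : ℝ) ^ 5), fun r => (hgrow _).trans ?_⟩
    gcongr
    exact hp1 n r

end Truncation

namespace Geometry

/-! ### Pointwise estimates for the primitive of the nonlinearity -/

section Potential

theorem abs_potential_le {f : ℝ → ℝ} {C₁ : ℝ} (h : ∀ r, |f r| ≤ C₁ * (1 + |r| ^ 5)) (hC : 0 ≤ C₁)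
    (r : ℝ) : |potential f r| ≤ C₁ * (1 + |r| ^ 5) * |r| := by
  have := intervalIntegral.norm_integral_le_of_norm_le_const (a := 0) (b := r) (f := f)
    (C := C₁ * (1 + |r| ^ 5)) (fun s hs => ?_)
  · simpa [potential] using this
  · refine (h s).trans ?_
    have : |s| ≤ |r| := by
      rcases le_total 0 r with h0 | h0
      · rw [uIoc_of_le h0] at hs
        rw [abs_of_pos hs.1, abs_of_nonneg h0]
        exact hs.2
      · rw [uIoc_of_ge h0] at hs
        rw [abs_of_nonpos hs.2, abs_of_nonpos h0]
        linarith [hs.1]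
    gcongr

/-- The remainder is the integral of f(s) − f(a) from a to b. Its quadratic size makes the potential
energy differentiable on L². -/
theorem abs_potential_sub_sub_le {f : ℝ → ℝ} {L : ℝ≥0} (h : LipschitzWith L f) (a b : ℝ) :
    |potential f b - potential f a - f a * (b - a)| ≤ L * |b - a| ^ 2 := by
  have hi (x y) : IntervalIntegrable f volume x y := h.continuous.intervalIntegrable _ _
  have h1 : potential f b - potential f a - f a * (b - a) = ∫ s in a..b, (f s - f a) := by
    rw [intervalIntegral.integral_sub (hi _ _) (by simp), potential, potential,
      intervalIntegral.integral_interval_sub_left (hi _ _) (hi _ _)]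
    simp [mul_comm]
  rw [h1, pow_two, ← mul_assoc, ← Real.norm_eq_abs]
  refine intervalIntegral.norm_integral_le_of_norm_le_const fun s hs => ?_
  rw [← dist_eq_norm]
  refine (h.dist_le_mul s a).trans ?_
  gcongr
  rw [Real.dist_eq]
  exact abs_sub_left_of_mem_uIcc (uIoc_subset_uIcc hs)

theorem abs_potential_sub_le {f : ℝ → ℝ} {M : ℝ} (h : ∀ r, |f r| ≤ M) (hc : Continuous f) (a b : ℝ) :
    |potential f b - potential f a| ≤ M * |b - a| := by
  have hi (x y) : IntervalIntegrable f volume x y := hc.intervalIntegrable _ _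
  rw [potential, potential, intervalIntegral.integral_interval_sub_left (hi _ _) (hi _ _)]
  exact intervalIntegral.norm_integral_le_of_norm_le_const (f := f) fun s _ => h s

theorem continuous_potential {f : ℝ → ℝ} (hc : Continuous f) : Continuous (potential f) :=
  intervalIntegral.continuous_primitive (fun _ _ => hc.intervalIntegrable _ _) 0

theorem potential_congr {f F : ℝ → ℝ} {n : ℝ} (h : ∀ r, |r| ≤ n → F r = f r) {r : ℝ} (hr : |r| ≤ n) :
    potential F r = potential f r := by
  refine intervalIntegral.integral_congr fun s hs => h s ?_
  have := abs_sub_left_of_mem_uIcc hs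
  simp only [sub_zero] at this
  exact this.trans hr

end Potential

variable {G : Geometry}

/-! ### Superposition operators on L² -/

section Nemytskii

variable (G) in
/-- The superposition operator `w ↦ f ∘ w` of `L²`; it is meant for `w` with `f ∘ w ∈ L²`. -/
def superposition (f : ℝ → ℝ) (w : G.L2) : G.L2 := G.toL2 fun x => f (w x)

theorem memLp_comp_of_bounded (hG : G.Admissible) {f : ℝ → ℝ} (hc : Continuous f) {M : ℝ}
    (h : ∀ r, |f r| ≤ M) (w : G.L2) : MemLp (fun x => f (w x)) 2 G.μ := by
  have := isFiniteMeasure_μ hG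
  exact MemLp.of_bound (hc.comp_aestronglyMeasurable (Lp.aestronglyMeasurable w)) M
    (Eventually.of_forall fun x => h _)

theorem coeFn_superposition {f : ℝ → ℝ} {w : G.L2} (h : MemLp (fun x => f (w x)) 2 G.μ) :
    G.superposition f w =ᵐ[G.μ] fun x => f (w x) := coeFn_toL2 h

theorem lipschitz_superposition {f : ℝ → ℝ} {L : ℝ≥0} (hL : LipschitzWith L f)
    (h : ∀ w : G.L2, MemLp (fun x => f (w x)) 2 G.μ) : LipschitzWith L (G.superposition f) := by
  refine LipschitzWith.of_dist_le_mul fun a b => ?_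
  rw [dist_eq_norm, dist_eq_norm]
  refine Lp.norm_le_mul_norm_of_ae_le_mul ?_
  filter_upwards [coeFn_superposition (h a), coeFn_superposition (h b),
    Lp.coeFn_sub (G.superposition f a) (G.superposition f b), Lp.coeFn_sub a b] with x h1 h2 h3 h4
  rw [h3, h4, Pi.sub_apply, Pi.sub_apply, h1, h2]
  simpa [dist_eq_norm] using hL.dist_le_mul (a x) (b x)

theorem integral_inner_superposition {f : ℝ → ℝ} {w : G.L2} (h : MemLp (fun x => f (w x)) 2 G.μ)
    (z : G.L2) : inner ℝ (G.superposition f w) z = ∫ x, f (w x) * z x ∂G.μ := by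
  rw [L2.inner_def]
  refine integral_congr_ae ?_
  filter_upwards [coeFn_superposition h] with x hx
  rw [hx, real_inner_eq_mul]

/-- Square root of the L¹⁰ bound, since the squared L² norm of |u|⁵ is ∫|u|¹⁰. The right side is
linear in the squared H^{3/2} norm, hence integrable in time: the critical nonlinearity lands in
L¹(0,T; L²). -/
theorem exists_eLpNorm_one_add_pow_five_le (hG : G.Admissible) (R : ℝ) : ∃ C : ℝ≥0, ∀ u : G.H1,
    ‖u‖ ≤ R → eLpNorm (fun x => 1 + |val u x| ^ 5) 2 G.μ ≤ C * (1 + G.hThreeHalvesNormSq u) := by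
  have := isFiniteMeasure_μ hG
  obtain ⟨C, hC⟩ := exists_lintegral_val_pow_ten_le hG R
  set m : ℝ≥0∞ := eLpNorm (fun _ : E3 => (1 : ℝ)) 2 G.μ with hm
  have hm' : m ≠ ⊤ := (memLp_const (1 : ℝ)).eLpNorm_ne_top
  refine ⟨m.toNNReal + NNReal.sqrt C, fun u hu => ?_⟩
  have hv : AEStronglyMeasurable (val u) G.μ := Lp.aestronglyMeasurable _
  have hv5 : AEStronglyMeasurable (fun x => |val u x| ^ 5) G.μ :=
    Continuous.comp_aestronglyMeasurable (g := fun r : ℝ => |r| ^ 5) (by fun_prop) hv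
  have hadd : eLpNorm (fun x => 1 + |val u x| ^ 5) 2 G.μ ≤
      m + eLpNorm (fun x => |val u x| ^ 5) 2 G.μ :=
    eLpNorm_add_le (f := fun _ : E3 => (1 : ℝ)) aestronglyMeasurable_const hv5 (by norm_num)
  refine hadd.trans ?_
  rw [ENNReal.coe_add, ENNReal.coe_toNNReal hm', add_mul]
  refine add_le_add (le_mul_of_one_le_right' le_self_add) ?_
  have h2 : eLpNorm (fun x => |val u x| ^ 5) 2 G.μ ^ 2 = ∫⁻ x, ‖val u x‖ₑ ^ 10 ∂G.μ := by
    have := eLpNorm_nnreal_pow_eq_lintegral (μ := G.μ) (f := fun x => |val u x| ^ 5)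
      (p := 2) (by norm_num)
    simp only [ENNReal.coe_ofNat, NNReal.coe_ofNat, ENNReal.rpow_ofNat] at this
    rw [this]
    refine lintegral_congr fun x => ?_
    rw [enorm_pow, ← Real.norm_eq_abs, enorm_norm, ← pow_mul]
  refine (ENNReal.pow_right_strictMono two_ne_zero).le_iff_le.1 ?_
  rw [h2, mul_pow, ← ENNReal.coe_pow, NNReal.sq_sqrt]
  exact hC u hu

theorem memLp_comp_of_le {f : ℝ → ℝ} (hc : Continuous f) {C₁ : ℝ}
    (h : ∀ r, |f r| ≤ C₁ * (1 + |r| ^ 5)) {w : G.L2}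
    (hw : MemLp (fun x => 1 + |w x| ^ 5) 2 G.μ) : MemLp (fun x => f (w x)) 2 G.μ := by
  refine (hw.const_mul C₁).mono' (hc.comp_aestronglyMeasurable (Lp.aestronglyMeasurable w))
    (Eventually.of_forall fun x => h _)

theorem norm_superposition_le {f : ℝ → ℝ} (hc : Continuous f) {C₁ : ℝ} (hC₁ : 0 ≤ C₁)
    (h : ∀ r, |f r| ≤ C₁ * (1 + |r| ^ 5)) {w : G.L2}
    (hw : MemLp (fun x => 1 + |w x| ^ 5) 2 G.μ) :
    ‖G.superposition f w‖ ≤ C₁ * (eLpNorm (fun x => 1 + |w x| ^ 5) 2 G.μ).toReal := by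
  have hm := memLp_comp_of_le hc h hw
  rw [superposition, toL2_eq hm, Lp.norm_toLp]
  have h2 : eLpNorm (fun x => f (w x)) 2 G.μ ≤
      ENNReal.ofReal C₁ * eLpNorm (fun x => 1 + |w x| ^ 5) 2 G.μ := by
    refine eLpNorm_le_mul_eLpNorm_of_ae_le_mul (Eventually.of_forall fun x => ?_) 2
    refine (h _).trans (le_of_eq ?_)
    rw [Real.norm_of_nonneg (by positivity)]
  refine (ENNReal.toReal_mono (ENNReal.mul_ne_top ENNReal.ofReal_ne_top hw.eLpNorm_ne_top)
    h2).trans (le_of_eq ?_)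
  rw [ENNReal.toReal_mul, ENNReal.toReal_ofReal hC₁]

/-- At each point the truncations are eventually equal to f, and twice the common growth bound
dominates the difference in L². -/
theorem tendsto_superposition {f : ℝ → ℝ} {F : ℕ → ℝ → ℝ} (hc : Continuous f)
    (hF : ∀ n, Continuous (F n)) {C₁ : ℝ} (h : ∀ r, |f r| ≤ C₁ * (1 + |r| ^ 5))
    (hFle : ∀ n r, |F n r| ≤ C₁ * (1 + |r| ^ 5))
    (heq : ∀ (n : ℕ) (r : ℝ), |r| ≤ n → F n r = f r) {w : G.L2}
    (hw : MemLp (fun x => 1 + |w x| ^ 5) 2 G.μ) :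
    Tendsto (fun n => G.superposition (F n) w) atTop (𝓝 (G.superposition f w)) := by
  have hm := memLp_comp_of_le hc h hw
  have hmn (n) := memLp_comp_of_le (hF n) (hFle n) hw
  have hb := hw.const_mul (2 * C₁)
  have hlim : Tendsto (fun n => ∫⁻ x, ‖F n (w x) - f (w x)‖ₑ ^ 2 ∂G.μ) atTop
      (𝓝 (∫⁻ _, 0 ∂G.μ)) := by
    refine tendsto_lintegral_of_dominated_convergence'
      (fun x => ‖2 * C₁ * (1 + |w x| ^ 5)‖ₑ ^ 2) (fun n => ?_) (fun n => ?_) ?_ ?_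
    · exact ((hmn n).1.sub hm.1).enorm.pow_const 2
    · refine Eventually.of_forall fun x => ?_
      refine pow_le_pow_left₀ (by positivity) (enorm_le_iff_norm_le.2 ?_) 2
      have h1 := h (w x)
      have h2 := hFle n (w x)
      have h3 := abs_sub (F n (w x)) (f (w x))
      rw [Real.norm_eq_abs, Real.norm_eq_abs]
      refine le_trans ?_ (le_abs_self _)
      linarith
    · have := lintegral_rpow_enorm_lt_top_of_eLpNorm_lt_top (p := 2) (by norm_num) (by norm_num) hb.2
      simpa using this.ne
    · refine Eventually.of_forall fun x => ?_
      obtain ⟨N, hN⟩ := exists_nat_ge |w x|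
      refine tendsto_const_nhds.congr' ?_
      filter_upwards [eventually_ge_atTop N] with n hn
      rw [heq n _ (hN.trans (by exact_mod_cast hn))]
      simp
  rw [tendsto_iff_norm_sub_tendsto_zero]
  rw [lintegral_zero] at hlim
  have heq2 (n) : ∫⁻ x, ‖F n (w x) - f (w x)‖ₑ ^ 2 ∂G.μ =
      ENNReal.ofReal (‖G.superposition (F n) w - G.superposition f w‖ ^ 2) := by
    rw [ENNReal.ofReal_pow (norm_nonneg _), ofReal_norm, ← lintegral_enorm_sq]
    refine lintegral_congr_ae ?_
    filter_upwards [coeFn_superposition (hmn n), coeFn_superposition hm,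
      Lp.coeFn_sub (G.superposition (F n) w) (G.superposition f w)] with x h1 h2 h3
    rw [h3, Pi.sub_apply, h1, h2]
  simp_rw [heq2] at hlim
  have h3 := (ENNReal.tendsto_toReal ENNReal.zero_ne_top).comp hlim
  have h4 := (Real.continuous_sqrt.tendsto _).comp h3
  simpa [Function.comp_def, ENNReal.toReal_ofReal, sq_nonneg, Real.sqrt_sq] using h4

end Nemytskii

/-! ### The potential energy and its chain rule -/

section PotentialEnergy

/-- Integrating the pointwise quadratic remainder gives at most L ‖z − w‖², which is of smaller
order than ‖z − w‖. -/
theorem hasFDerivAt_integral_potential (hG : G.Admissible) {f : ℝ → ℝ} {L : ℝ≥0} {M : ℝ}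
    (hL : LipschitzWith L f) (hM : ∀ r, |f r| ≤ M) (w : G.L2) :
    HasFDerivAt (fun w : G.L2 => ∫ x, potential f (w x) ∂G.μ)
      (innerSL ℝ (G.superposition f w)) w := by
  have := isFiniteMeasure_μ hG
  have hm := memLp_comp_of_bounded hG hL.continuous hM
  have hint (w : G.L2) : Integrable (fun x => potential f (w x)) G.μ := by
    have hw : Integrable w G.μ := (Lp.memLp w).integrable (by norm_num)
    refine (hw.norm.const_mul M).mono'
      ((continuous_potential hL.continuous).comp_aestronglyMeasurable hw.1)
      (Eventually.of_forall fun x => ?_)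
    have := abs_potential_sub_le hM hL.continuous 0 (w x)
    simpa [potential] using this
  rw [hasFDerivAt_iff_isLittleO]
  refine Asymptotics.IsBigO.trans_isLittleO (g := fun z => ‖z - w‖ ^ 2) ?_ ?_
  · refine Asymptotics.IsBigO.of_bound L (Eventually.of_forall fun z => ?_)
    have hz := Lp.memLp (z - w)
    have h1 : (∫ x, potential f (z x) ∂G.μ) - (∫ x, potential f (w x) ∂G.μ)
        - innerSL ℝ (G.superposition f w) (z - w) =
        ∫ x, (potential f (z x) - potential f (w x) - f (w x) * (z - w) x) ∂G.μ := by
      have e1 := integral_sub ((hint z).sub (hint w)) ((hm w).integrable_mul hz)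
      have e2 := integral_sub (hint z) (hint w)
      simp only [Pi.sub_apply, Pi.mul_apply] at e1
      rw [innerSL_apply_apply, integral_inner_superposition (hm w), e1, e2]
    rw [h1, norm_pow, norm_norm, ← real_inner_self_eq_norm_sq, L2.inner_def, ← integral_const_mul]
    refine (norm_integral_le_integral_norm _).trans ?_
    refine integral_mono_of_nonneg (Eventually.of_forall fun x => norm_nonneg _)
      ((L2.integrable_inner (z - w) (z - w)).const_mul _) ?_
    filter_upwards [Lp.coeFn_sub z w] with x hx
    rw [hx, Pi.sub_apply, real_inner_self_eq_norm_sq]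
    exact abs_potential_sub_sub_le hL (w x) (z x)
  · have h2 : (fun z : G.L2 => ‖z - w‖ ^ 2) =o[𝓝 w] fun z => ‖z - w‖ ^ 1 := by
      have h0 : Tendsto (fun z : G.L2 => ‖z - w‖) (𝓝 w) (𝓝 0) :=
        tendsto_iff_norm_sub_tendsto_zero.1 tendsto_id
      exact (Asymptotics.isLittleO_pow_pow (𝕜 := ℝ) one_lt_two).comp_tendsto h0
    simpa using h2

/-- The primitive is M-Lipschitz pointwise, and Cauchy-Schwarz against the constant M gives its L²
norm as Lipschitz constant. -/
theorem lipschitz_integral_potential (hG : G.Admissible) {f : ℝ → ℝ} {M : ℝ}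
    (hc : Continuous f) (hM : ∀ r, |f r| ≤ M) :
    ∃ k : ℝ≥0, LipschitzWith k (fun w : G.L2 => ∫ x, potential f (w x) ∂G.μ) := by
  have := isFiniteMeasure_μ hG
  have hM0 : 0 ≤ M := (abs_nonneg _).trans (hM 0)
  have hint (w : G.L2) : Integrable (fun x => potential f (w x)) G.μ := by
    have hw : Integrable w G.μ := (Lp.memLp w).integrable (by norm_num)
    refine (hw.norm.const_mul M).mono'
      ((continuous_potential hc).comp_aestronglyMeasurable hw.1)
      (Eventually.of_forall fun x => ?_)
    have := abs_potential_sub_le hM hc 0 (w x)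
    simpa [potential] using this
  have hone : MemLp (fun _ : E3 => M) 2 G.μ := memLp_const M
  refine ⟨‖hone.toLp‖₊, LipschitzWith.of_dist_le_mul fun a b => ?_⟩
  rw [dist_eq_norm, dist_eq_norm, ← integral_sub (hint a) (hint b), coe_nnnorm,
    ← norm_abs_eq_norm (a - b)]
  refine (norm_integral_le_integral_norm _).trans ?_
  refine le_trans ?_ (real_inner_le_norm _ _)
  rw [L2.inner_def]
  refine integral_mono_of_nonneg (Eventually.of_forall fun x => norm_nonneg _)
      (L2.integrable_inner _ _) ?_
  filter_upwards [Lp.coeFn_sub a b, hone.coeFn_toLp, Lp.coeFn_abs (a - b)] with x h1 h2 h3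
  rw [h2, h3, h1, real_inner_eq_mul]
  exact abs_potential_sub_le hM hc (b x) (a x)

/-- The growth of the potential is |u| + |u|⁶, exactly what the embedding of H¹ in L⁶ controls; no
H^{3/2} regularity is needed, so the potential energy is finite at every time. -/
theorem integrable_growth (hG : G.Admissible) (u : G.H1) :
    Integrable (fun x => (1 + |val u x| ^ 5) * |val u x|) G.μ := by
  have := isFiniteMeasure_μ hG
  obtain ⟨C, hC⟩ := exists_lintegral_val_pow_six_le hG
  have h1 : Integrable (val u) G.μ := (Lp.memLp (val u)).integrable (by norm_num)
  have h2 : Integrable (fun x => |val u x| ^ 6) G.μ := by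
    refine ⟨(continuous_abs.pow 6).comp_aestronglyMeasurable h1.1, ?_⟩
    refine lt_of_le_of_lt (le_of_eq (lintegral_congr fun x => ?_)) ((hC u).trans_lt ?_)
    · rw [enorm_pow, ← Real.norm_eq_abs, enorm_norm]
    · exact ENNReal.pow_lt_top (ENNReal.mul_lt_top ENNReal.coe_lt_top
        (ENNReal.pow_lt_top enorm_lt_top))
  refine (h1.norm.add h2).congr (Eventually.of_forall fun x => ?_)
  simp only [Pi.add_apply, Real.norm_eq_abs]
  ring

theorem integrable_potential (hG : G.Admissible) {f : ℝ → ℝ} (hc : Continuous f) {C₁ : ℝ}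
    (hC : 0 ≤ C₁) (h : ∀ r, |f r| ≤ C₁ * (1 + |r| ^ 5)) (u : G.H1) :
    Integrable (fun x => potential f (val u x)) G.μ := by
  refine ((integrable_growth hG u).const_mul C₁).mono'
    ((continuous_potential hc).comp_aestronglyMeasurable (Lp.aestronglyMeasurable _))
    (Eventually.of_forall fun x => ?_)
  rw [← mul_assoc]
  exact abs_potential_le h hC _

theorem tendsto_integral_potential (hG : G.Admissible) {f : ℝ → ℝ} {F : ℕ → ℝ → ℝ}
    (hF : ∀ n, Continuous (F n)) {C₁ : ℝ} (hC : 0 ≤ C₁)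
    (hFle : ∀ n r, |F n r| ≤ C₁ * (1 + |r| ^ 5))
    (heq : ∀ (n : ℕ) (r : ℝ), |r| ≤ n → F n r = f r) (u : G.H1) :
    Tendsto (fun n => ∫ x, potential (F n) (val u x) ∂G.μ) atTop
      (𝓝 (∫ x, potential f (val u x) ∂G.μ)) := by
  refine tendsto_integral_of_dominated_convergence _
    (fun n => (integrable_potential hG (hF n) hC (hFle n) u).1)
    ((integrable_growth hG u).const_mul C₁) (fun n => Eventually.of_forall fun x => ?_)
    (Eventually.of_forall fun x => ?_)
  · rw [← mul_assoc]
    exact abs_potential_le (hFle n) hC _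
  · obtain ⟨N, hN⟩ := exists_nat_ge |val u x|
    refine tendsto_const_nhds.congr' ?_
    filter_upwards [eventually_ge_atTop N] with n hn
    exact (potential_congr (heq n) (hN.trans (by exact_mod_cast hn))).symm

/-- Superposition with an admissible nonlinearity maps a bounded curve in `L²(0,T; H^{3/2})` to a
curve in `L¹(0,T; L²)`, and the chain rule for the potential energy holds along it. -/
theorem integral_potential_eq (hG : G.Admissible) {f : ℝ → ℝ} {C κ K : ℝ}
    (hf : IsAdmissibleNonlinearity f C κ K) {T R : ℝ} (hT : 0 < T) {u : ℝ → G.H1} {v : ℝ → G.L2}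
    (hreg : G.MemL2HThreeHalves T u) (hu : ∀ t ∈ Icc 0 T, ‖u t‖ ≤ R)
    (hv : AEStronglyMeasurable v (timeMeasure T)) (hvR : ∀ᵐ t ∂timeMeasure T, ‖v t‖ ≤ R)
    (hut : ∀ t ∈ Icc 0 T, val (u t) = val (u 0) + ∫ s in (0 : ℝ)..t, v s) :
    Integrable (fun t => G.superposition f (val (u t))) (timeMeasure T) ∧
    (∀ᵐ t ∂timeMeasure T, MemLp (fun x => f (val (u t) x)) 2 G.μ) ∧
    Integrable (fun t => inner ℝ (G.superposition f (val (u t))) (v t)) (timeMeasure T) ∧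
    ∀ t ∈ Icc 0 T, ∫ x, potential f (val (u t) x) ∂G.μ = (∫ x, potential f (val (u 0) x) ∂G.μ) +
      ∫ s in (0 : ℝ)..t, inner ℝ (G.superposition f (val (u s))) (v s) := by
  have := isFiniteMeasure_μ hG
  obtain ⟨C₁, F, hC₁, hfle, hFle, hFL, hFM, heq⟩ := hf.exists_truncation
  obtain ⟨C₂, hC₂⟩ := exists_eLpNorm_one_add_pow_five_le hG R
  have hfc : Continuous f := hf.contDiff.continuous
  have hFc (n) : Continuous (F n) := (hFL n).choose_spec.continuous
  have hR : 0 ≤ R := (norm_nonneg _).trans (hu 0 ⟨le_rfl, hT.le⟩)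
  obtain ⟨hmeas, hNmeas, hNfin⟩ := hreg
  set N : ℝ → ℝ := fun t => (G.hThreeHalvesNormSq (u t)).toReal with hN
  have hNint : Integrable N (timeMeasure T) := integrable_toReal_of_lintegral_ne_top hNmeas hNfin.ne
  have hfinite : IsFiniteMeasure (timeMeasure T) := ⟨by simp [timeMeasure]⟩
  -- At almost every time the H^{3/2} norm is finite, and 1 + |u|⁵ is then in L² with norm at most
  -- linear in N(t).
  have hae : ∀ᵐ t ∂timeMeasure T, MemLp (fun x => 1 + |val (u t) x| ^ 5) 2 G.μ ∧
      (eLpNorm (fun x => 1 + |val (u t) x| ^ 5) 2 G.μ).toReal ≤ C₂ * (1 + N t) := by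
    have hIoo : ∀ᵐ t ∂timeMeasure T, t ∈ Ioo 0 T := ae_restrict_mem measurableSet_Ioo
    filter_upwards [hIoo, ae_lt_top' hNmeas hNfin.ne] with t ht hlt
    have hle := hC₂ (u t) (hu t (Ioo_subset_Icc_self ht))
    have hfin : (C₂ : ℝ≥0∞) * (1 + G.hThreeHalvesNormSq (u t)) ≠ ⊤ :=
      ENNReal.mul_ne_top ENNReal.coe_ne_top (ENNReal.add_ne_top.2 ⟨ENNReal.one_ne_top, hlt.ne⟩)
    refine ⟨⟨?_, hle.trans_lt hfin.lt_top⟩, ?_⟩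
    · exact (Continuous.comp_aestronglyMeasurable (g := fun r : ℝ => 1 + |r| ^ 5) (by fun_prop)
        (Lp.aestronglyMeasurable _))
    · refine (ENNReal.toReal_mono hfin hle).trans (le_of_eq ?_)
      rw [ENNReal.toReal_mul, ENNReal.toReal_add ENNReal.one_ne_top hlt.ne]
      rfl
  have hval : AEStronglyMeasurable (fun t => val (u t)) (timeMeasure T) :=
    (G.valL.continuous.comp_aestronglyMeasurable hmeas)
  have hFmeas (n) : AEStronglyMeasurable (fun t => G.superposition (F n) (val (u t)))
      (timeMeasure T) := by
    obtain ⟨L, hL⟩ := hFL n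
    obtain ⟨M, hM⟩ := hFM n
    exact (lipschitz_superposition hL
      (memLp_comp_of_bounded hG (hFc n) hM)).continuous.comp_aestronglyMeasurable hval
  have hlim : ∀ᵐ t ∂timeMeasure T, Tendsto (fun n => G.superposition (F n) (val (u t))) atTop
      (𝓝 (G.superposition f (val (u t)))) := by
    filter_upwards [hae] with t ht
    exact tendsto_superposition hfc hFc hfle hFle heq ht.1
  -- Measurability in time is inherited from the truncations, which are Lipschitz operators on L².
  have hfmeas : AEStronglyMeasurable (fun t => G.superposition f (val (u t))) (timeMeasure T) :=
    aestronglyMeasurable_of_tendsto_ae atTop hFmeas hlim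
  have hbound {h : ℝ → ℝ} (hc : Continuous h) (hle : ∀ r, |h r| ≤ C₁ * (1 + |r| ^ 5)) :
      ∀ᵐ t ∂timeMeasure T, ‖G.superposition h (val (u t))‖ ≤ C₁ * (C₂ * (1 + N t)) := by
    filter_upwards [hae] with t ht
    refine (norm_superposition_le hc hC₁ hle ht.1).trans ?_
    gcongr
    exact ht.2
  have hBint : Integrable (fun t => C₁ * (C₂ * (1 + N t))) (timeMeasure T) :=
    (((integrable_const 1).add hNint).const_mul _).const_mul _
  have hbound2 {h : ℝ → ℝ} (hc : Continuous h) (hle : ∀ r, |h r| ≤ C₁ * (1 + |r| ^ 5)) :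
      ∀ᵐ t ∂timeMeasure T, ‖inner ℝ (G.superposition h (val (u t))) (v t)‖
        ≤ C₁ * (C₂ * (1 + N t)) * R := by
    filter_upwards [hbound hc hle, hvR] with t h1 h2
    exact (norm_inner_le_norm _ _).trans (mul_le_mul h1 h2 (norm_nonneg _)
      ((norm_nonneg _).trans h1))
  have hii {h : ℝ → ℝ} (hh : Integrable h (timeMeasure T)) : IntervalIntegrable h volume 0 T := by
    rw [intervalIntegrable_iff_integrableOn_Ioo_of_le hT.le]
    exact hh
  have hIoc (t) (ht : t ∈ Icc 0 T) {p : ℝ → Prop} (h : ∀ᵐ s ∂timeMeasure T, p s) :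
      ∀ᵐ s ∂volume, s ∈ uIoc 0 t → p s := by
    rw [timeMeasure, restrict_Ioo_eq_restrict_Ioc, ae_restrict_iff' measurableSet_Ioc] at h
    filter_upwards [h] with s hs hs'
    rw [uIoc_of_le ht.1] at hs'
    exact hs ⟨hs'.1, hs'.2.trans ht.2⟩
  have hle0 (t) (ht : t ∈ Icc 0 T) : volume.restrict (uIoc 0 t) ≤ timeMeasure T := by
    rw [timeMeasure, restrict_Ioo_eq_restrict_Ioc, uIoc_of_le ht.1]
    exact Measure.restrict_mono (Ioc_subset_Ioc_right ht.2) le_rfl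
  refine ⟨hBint.mono' hfmeas (hbound hfc hfle), ?_,
    (hBint.mul_const R).mono' (hfmeas.inner hv) (hbound2 hfc hfle), fun t ht => ?_⟩
  · filter_upwards [hae] with t ht
    exact memLp_comp_of_le hfc hfle ht.1
  -- For the truncation, the potential energy is a differentiable Lipschitz functional and u is
  -- absolutely continuous in L².
  have hn (n) : ∫ x, potential (F n) (val (u t) x) ∂G.μ =
      (∫ x, potential (F n) (val (u 0) x) ∂G.μ) +
      ∫ s in (0 : ℝ)..t, inner ℝ (G.superposition (F n) (val (u s))) (v s) := by
    obtain ⟨L, hL⟩ := hFL n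
    obtain ⟨M, hM⟩ := hFM n
    have hint := hii ((hBint.mul_const R).mono' ((hFmeas n).inner hv) (hbound2 (hFc n) (hFle n)))
    have hvint : IntervalIntegrable v volume 0 T := by
      rw [intervalIntegrable_iff_integrableOn_Ioo_of_le hT.le]
      exact (integrable_const R).mono' hv hvR
    obtain ⟨k, hk⟩ := lipschitz_integral_potential hG (hFc n) hM
    rw [← uIcc_of_le hT.le] at ht hut
    exact functional_eq_add_integral (b := T) (t := t) (w := fun t => val (u t)) (h := v)
      (Φ := fun w : G.L2 => ∫ x, potential (F n) (w x) ∂G.μ) (val (u 0)) hvint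
      (hasFDerivAt_integral_potential hG hL hM) (fun R => ⟨k, hk.lipschitzOnWith⟩) hut hint ht
  have h1 := tendsto_integral_potential hG hFc hC₁ hFle heq (u t)
  have h2 := tendsto_integral_potential hG hFc hC₁ hFle heq (u 0)
  -- The truncation is removed on both sides; the majorant C₁C₂(1 + N)R is integrable in time and
  -- independent of n.
  refine tendsto_nhds_unique h1 ?_
  simp_rw [hn]
  refine h2.add (intervalIntegral.tendsto_integral_filter_of_dominated_convergence
    (fun s => C₁ * (C₂ * (1 + N s)) * R) (Eventually.of_forall fun n => ?_)
    (Eventually.of_forall fun n => hIoc t ht (hbound2 (hFc n) (hFle n))) ?_ (hIoc t ht ?_))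
  · exact ((hFmeas n).inner hv).mono_measure (hle0 t ht)
  · refine (hii (hBint.mul_const R)).mono_set ?_
    rw [uIcc_of_le ht.1, uIcc_of_le hT.le]
    exact Icc_subset_Icc_right ht.2
  · filter_upwards [hlim] with s hs
    exact hs.inner tendsto_const_nhds

end PotentialEnergy

end Geometry

namespace Geometry

variable {G : Geometry}

/-! ### The equation for the smoothed velocity -/

section WeakEquation

theorem isSpaceTimeTest_mul {T : ℝ} (hT : 0 < T) {η : ℝ → ℝ} (hη : ContDiff ℝ ∞ η)
    (hc : HasCompactSupport η) (hs : tsupport η ⊆ Ioo 0 T) {ψ : E3 → ℝ} (hψ : G.IsTest ψ) :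
    G.IsSpaceTimeTest T (fun t x => η t * ψ x) := by
  have hsm : ContDiff ℝ ∞ (fun p : ℝ × E3 => η p.1 * ψ p.2) :=
    (hη.comp contDiff_fst).mul (hψ.contDiff.comp contDiff_snd)
  cases G with
  | dirichlet Ω =>
    have hsub : tsupport (fun p : ℝ × E3 => η p.1 * ψ p.2) ⊆ tsupport η ×ˢ tsupport ψ := by
      refine closure_minimal (fun p hp => ?_)
        ((isClosed_tsupport η).prod (isClosed_tsupport ψ))
      exact ⟨subset_tsupport _ (left_ne_zero_of_mul hp),
        subset_tsupport _ (right_ne_zero_of_mul hp)⟩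
    exact ⟨hsm, (hc.isCompact.prod hψ.2.1.isCompact).of_isClosed_subset (isClosed_tsupport _) hsub,
      hsub.trans (prod_mono hs hψ.2.2)⟩
  | torus =>
    refine ⟨hsm, ?_, fun t k x => by simp only [hψ.2]⟩
    rcases (tsupport η).eq_empty_or_nonempty with h | h
    · refine ⟨T / 2, T / 2, by linarith, by linarith, fun t _ x => ?_⟩
      have : t ∉ tsupport η := by simp [h]
      simp only [image_eq_zero_of_notMem_tsupport this, zero_mul]
    · obtain ⟨a, ha⟩ := hc.isCompact.exists_isLeast h
      obtain ⟨b, hb⟩ := hc.isCompact.exists_isGreatest h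
      refine ⟨a, b, (hs ha.1).1, (hs hb.1).2, fun t ht x => ?_⟩
      have : t ∉ tsupport η := fun h' => ht ⟨ha.2 h', hb.2 h'⟩
      simp only [image_eq_zero_of_notMem_tsupport this, zero_mul]

variable {γ α T : ℝ} {f : ℝ → ℝ} {g : G.L2} {ξ : ℝ → G.EnergySpace}

/-- Test functions with separated variables turn the equation into an identity between time
averages. Every term is continuous in the spatial factor for the H¹ norm, so that factor may be any
member of H¹, in particular a resolvent Rz. -/
theorem IsWeakEquation.eq_of_product (hG : G.Admissible) (hT : 0 < T)
    (h : G.IsWeakEquation γ α f g T ξ)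
    (hu : Integrable (fun t => (ξ t).1) (timeMeasure T))
    (hv : Integrable (fun t => (ξ t).2) (timeMeasure T))
    (hfm : ∀ᵐ t ∂timeMeasure T, MemLp (fun x => f (val (ξ t).1 x)) 2 G.μ)
    (hfi : Integrable (fun t => G.superposition f (val (ξ t).1)) (timeMeasure T))
    {η : ℝ → ℝ} (hη : ContDiff ℝ ∞ η) (hc : HasCompactSupport η) (hs : tsupport η ⊆ Ioo 0 T)
    (q : G.H1) :
    -inner ℝ (∫ t, deriv η t • (ξ t).2 ∂timeMeasure T) (val q)
      + inner ℝ (grad (∫ t, η t • (ξ t).1 ∂timeMeasure T)) (grad q)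
      + α * inner ℝ (∫ t, η t • (ξ t).2 ∂timeMeasure T) (val q)
      + γ * inner ℝ (∫ t, η t • (ξ t).2 ∂timeMeasure T) (G.sqrtLap q)
      + inner ℝ (∫ t, η t • G.superposition f (val (ξ t).1) ∂timeMeasure T) (val q)
      = inner ℝ (∫ t, η t • g ∂timeMeasure T) (val q) := by
  have hfinite : IsFiniteMeasure (timeMeasure T) := ⟨by simp [timeMeasure]⟩
  have hsmul {E : Type} [NormedAddCommGroup E] [NormedSpace ℝ E] {ρ : ℝ → ℝ} (hρ : Continuous ρ)
      (hρc : HasCompactSupport ρ) {w : ℝ → E} (hw : Integrable w (timeMeasure T)) :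
      Integrable (fun t => ρ t • w t) (timeMeasure T) := by
    obtain ⟨B, hB⟩ := hρc.exists_bound_of_continuous hρ
    exact hw.bdd_smul B hρ.aestronglyMeasurable (Eventually.of_forall hB)
  have hη' : Continuous (deriv η) := hη.continuous_deriv (by simp)
  have h1 := hsmul hη' hc.deriv hv
  have h2 := hsmul hη.continuous hc hu
  have h3 := hsmul hη.continuous hc hv
  have h4 := hsmul hη.continuous hc hfi
  have h5 := hsmul hη.continuous hc (integrable_const g)
  -- The case of a smooth spatial factor, where η(t)ψ(x) is an admissible test function.
  have key (ψ : E3 → ℝ) (hψ : G.IsTest ψ) (q : G.H1)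
      (hq : (q : WithLp 2 (G.L2 × G.L2Vec)) = G.testPair ψ) :
      -inner ℝ (∫ t, deriv η t • (ξ t).2 ∂timeMeasure T) (val q)
      + inner ℝ (grad (∫ t, η t • (ξ t).1 ∂timeMeasure T)) (grad q)
      + α * inner ℝ (∫ t, η t • (ξ t).2 ∂timeMeasure T) (val q)
      + γ * inner ℝ (∫ t, η t • (ξ t).2 ∂timeMeasure T) (G.sqrtLap q)
      + inner ℝ (∫ t, η t • G.superposition f (val (ξ t).1) ∂timeMeasure T) (val q)
      = inner ℝ (∫ t, η t • g ∂timeMeasure T) (val q) := by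
    have hvq : val q = G.toL2 ψ := by rw [val, hq]; rfl
    have hgq : grad q = G.toL2 (gradient ψ) := by rw [grad, hq]; rfl
    have hw := h _ (isSpaceTimeTest_mul hT hη hc hs hψ)
    have e1 (c : ℝ) : G.toL2 (fun x => c * ψ x) = c • val q := by
      rw [hvq]; exact toL2_smul (hψ.memLp hG) c
    have e2 (c : ℝ) : G.toL2 (gradient fun x => c * ψ x) = c • grad q := by
      rw [hgq, ← toL2_smul (hψ.memLp_gradient hG),
        ← gradient_smul (hψ.contDiff.differentiable (by simp))]
      rfl
    have e3 (t : ℝ) (x : E3) : deriv (fun s => η s * ψ x) t = deriv η t * ψ x :=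
      deriv_mul_const (hη.differentiable (by simp) t) _
    have e4 : ∫ t, (∫ x, f (val (ξ t).1 x) * (η t * ψ x) ∂G.μ) ∂timeMeasure T =
        ∫ t, η t * inner ℝ (G.superposition f (val (ξ t).1)) (val q) ∂timeMeasure T := by
      refine integral_congr_ae ?_
      filter_upwards [hfm] with t ht
      rw [integral_inner_superposition ht, hvq, ← integral_const_mul]
      refine integral_congr_ae ?_
      filter_upwards [coeFn_toL2 (hψ.memLp hG)] with x hx
      rw [hx]
      ring
    simp only [e1, e2, e3, e4, fracLap_smul, inner_smul_right] at hw
    rw [← G.gradL_apply (∫ t, η t • (ξ t).1 ∂timeMeasure T), ← G.gradL.integral_comp_comm h2]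
    simp only [real_inner_comm (val q), real_inner_comm (grad q), real_inner_comm (G.sqrtLap q)]
    rw [← integral_inner h1, ← integral_inner h3, ← integral_inner (G.gradL.integrable_comp h2),
      ← integral_inner h3, ← integral_inner h4, ← integral_inner h5]
    simp only [map_smul, inner_smul_right, gradL_apply]
    simp only [real_inner_comm _ (val q), real_inner_comm _ (grad q),
      real_inner_comm _ (G.sqrtLap q)]
    exact hw
  obtain ⟨φ, hφ, hlim⟩ := exists_seq_test hG q
  let p : ℕ → G.H1 := fun n => ⟨G.testPair (φ n), testPair_mem_H1 (hφ n)⟩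
  have hp : Tendsto p atTop (𝓝 q) := tendsto_subtype_rng.2 hlim
  have hpv : Tendsto (fun n => val (p n)) atTop (𝓝 (val q)) :=
    (G.valL.continuous.tendsto q).comp hp
  have hpg : Tendsto (fun n => grad (p n)) atTop (𝓝 (grad q)) :=
    (G.gradL.continuous.tendsto q).comp hp
  have hps : Tendsto (fun n => G.sqrtLap (p n)) atTop (𝓝 (G.sqrtLap q)) :=
    (G.sqrtLap.continuous.tendsto q).comp hp
  -- Extension by density: `sqrtLap` is bounded on H¹, so the damping term passes to the limit as
  -- well.
  refine tendsto_nhds_unique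
    (((((tendsto_const_nhds.inner hpv).neg.add (tendsto_const_nhds.inner hpg)).add
      ((tendsto_const_nhds.inner hpv).const_mul α)).add
      ((tendsto_const_nhds.inner hps).const_mul γ)).add (tendsto_const_nhds.inner hpv)) ?_
  simp only [fun n => key (φ n) (hφ n) (p n) rfl]
  exact tendsto_const_nhds.inner hpv

variable (γ α f g ξ) in
/-- The time derivative of the smoothed velocity `(1 - εΔ)⁻¹ ∂ₜu` prescribed by the equation. -/
def smoothedForce (ε : ℝ) (R : G.L2 →L[ℝ] G.H1) (t : ℝ) : G.L2 :=
  val (R g) - val (R (G.superposition f (val (ξ t).1)))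
    - γ • ContinuousLinearMap.adjoint (G.sqrtLap.comp R) (ξ t).2 - α • val (R (ξ t).2)
    - ε⁻¹ • (val (ξ t).1 - val (R (val (ξ t).1)))

theorem integrable_smoothedForce {ε : ℝ} (R : G.L2 →L[ℝ] G.H1)
    (hu : Integrable (fun t => (ξ t).1) (timeMeasure T))
    (hv : Integrable (fun t => (ξ t).2) (timeMeasure T))
    (hfi : Integrable (fun t => G.superposition f (val (ξ t).1)) (timeMeasure T)) :
    Integrable (smoothedForce γ α f g ξ ε R) (timeMeasure T) := by
  have hfinite : IsFiniteMeasure (timeMeasure T) := ⟨by simp [timeMeasure]⟩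
  have hval := G.valL.integrable_comp hu
  exact (((((integrable_const _).sub ((G.valL.comp R).integrable_comp hfi)).sub
    (((ContinuousLinearMap.adjoint (G.sqrtLap.comp R)).integrable_comp hv).smul γ)).sub
    (((G.valL.comp R).integrable_comp hv).smul α)).sub
    ((hval.sub ((G.valL.comp R).integrable_comp hval)).smul ε⁻¹))

/-- With spatial factor Rz, symmetry moves R onto the other argument, the damping goes through an
adjoint, and `IsResolvent.inner_grad` turns the gradient term into a bounded operator. All terms
then act on z in L², which identifies the weak time derivative of the smoothed velocity. -/
theorem IsWeakEquation.exists_smoothed (hG : G.Admissible) (hT : 0 < T)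
    (h : G.IsWeakEquation γ α f g T ξ)
    (hu : Integrable (fun t => (ξ t).1) (timeMeasure T))
    (hv : Integrable (fun t => (ξ t).2) (timeMeasure T))
    (hfm : ∀ᵐ t ∂timeMeasure T, MemLp (fun x => f (val (ξ t).1 x)) 2 G.μ)
    (hfi : Integrable (fun t => G.superposition f (val (ξ t).1)) (timeMeasure T))
    {ε : ℝ} (hε : 0 < ε) {R : G.L2 →L[ℝ] G.H1} (hR : G.IsResolvent ε R) :
    ∃ c, ∀ᵐ t ∂timeMeasure T, val (R (ξ t).2) =
      c + ∫ s in (0 : ℝ)..t, smoothedForce γ α f g ξ ε R s := by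
  have hfinite : IsFiniteMeasure (timeMeasure T) := ⟨by simp [timeMeasure]⟩
  refine exists_eq_const_add_integral hT ((G.valL.comp R).integrable_comp hv)
    (integrable_smoothedForce R hu hv hfi) fun η hη hc hs => ?_
  have hsmul {E : Type} [NormedAddCommGroup E] [NormedSpace ℝ E] {ρ : ℝ → ℝ} (hρ : Continuous ρ)
      (hρc : HasCompactSupport ρ) {w : ℝ → E} (hw : Integrable w (timeMeasure T)) :
      Integrable (fun t => ρ t • w t) (timeMeasure T) := by
    obtain ⟨B, hB⟩ := hρc.exists_bound_of_continuous hρ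
    exact hw.bdd_smul B hρ.aestronglyMeasurable (Eventually.of_forall hB)
  have hη' : Continuous (deriv η) := hη.continuous_deriv (by simp)
  have h1 := hsmul hη' hc.deriv hv
  have h2 := hsmul hη.continuous hc hu
  have h3 := hsmul hη.continuous hc hv
  have h4 := hsmul hη.continuous hc hfi
  have h5 := hsmul hη.continuous hc (integrable_const g)
  set V₁ := ∫ t, deriv η t • (ξ t).2 ∂timeMeasure T with hV₁
  set U := ∫ t, η t • (ξ t).1 ∂timeMeasure T with hU
  set V := ∫ t, η t • (ξ t).2 ∂timeMeasure T with hV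
  set W := ∫ t, η t • G.superposition f (val (ξ t).1) ∂timeMeasure T with hW
  set Z := ∫ t, η t • g ∂timeMeasure T with hZ
  let J : G.L2 →L[ℝ] G.L2 := G.valL.comp R
  let D : G.L2 →L[ℝ] G.L2 := ContinuousLinearMap.adjoint (G.sqrtLap.comp R)
  have hleft : ∫ t, deriv η t • val (R (ξ t).2) ∂timeMeasure T = J V₁ := by
    rw [hV₁, ← J.integral_comp_comm h1]
    simp only [map_smul]
    rfl
  let S : G.H1 →L[ℝ] G.L2 := ε⁻¹ • (G.valL - J.comp G.valL)
  have hright : ∫ t, η t • smoothedForce γ α f g ξ ε R t ∂timeMeasure T =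
      J Z - J W - γ • D V - α • J V - S U := by
    have i1 := J.integrable_comp h5
    have i2 := J.integrable_comp h4
    have i3 : Integrable (fun t => γ • D (η t • (ξ t).2)) (timeMeasure T) :=
      (D.integrable_comp h3).smul γ
    have i4 : Integrable (fun t => α • J (η t • (ξ t).2)) (timeMeasure T) :=
      (J.integrable_comp h3).smul α
    have j1 : Integrable (fun t => J (η t • g) - J (η t • G.superposition f (val (ξ t).1)))
        (timeMeasure T) := i1.sub i2
    have j2 : Integrable (fun t => J (η t • g) - J (η t • G.superposition f (val (ξ t).1))
        - γ • D (η t • (ξ t).2)) (timeMeasure T) := j1.sub i3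
    have j3 : Integrable (fun t => J (η t • g) - J (η t • G.superposition f (val (ξ t).1))
        - γ • D (η t • (ξ t).2) - α • J (η t • (ξ t).2)) (timeMeasure T) := j2.sub i4
    have i5 := S.integrable_comp h2
    rw [hZ, hW, hV, hU, ← J.integral_comp_comm h5, ← J.integral_comp_comm h4,
      ← D.integral_comp_comm h3, ← J.integral_comp_comm h3, ← S.integral_comp_comm h2,
      ← integral_smul γ, ← integral_smul α, ← integral_sub i1 i2, ← integral_sub j1 i3,
      ← integral_sub j2 i4, ← integral_sub j3 i5]
    refine integral_congr_ae (Eventually.of_forall fun t => ?_)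
    have hS : S (ξ t).1 = ε⁻¹ • (val (ξ t).1 - val (R (val (ξ t).1))) := rfl
    simp only [map_smul, hS, smoothedForce, smul_sub, smul_comm (η t)]
    rfl
  change ∫ t, deriv η t • val (R (ξ t).2) ∂timeMeasure T =
    -∫ t, η t • smoothedForce γ α f g ξ ε R t ∂timeMeasure T
  rw [hleft, hright]
  refine ext_inner_right ℝ fun z => ?_
  have hw := h.eq_of_product hG hT hu hv hfm hfi hη hc hs (R z)
  rw [← hV₁, ← hU, ← hV, ← hW, ← hZ, ← hR.symm, ← hR.symm, ← hR.symm, ← hR.symm,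
    hR.inner_grad hε] at hw
  have hD : inner ℝ (D V) z = inner ℝ V (G.sqrtLap (R z)) :=
    ContinuousLinearMap.adjoint_inner_left _ _ _
  have hS : inner ℝ (S U) z = ε⁻¹ * inner ℝ (val U - val (R (val U))) z := by
    rw [← real_inner_smul_left]
    rfl
  rw [inner_neg_left, inner_sub_left, inner_sub_left, inner_sub_left, inner_sub_left,
    real_inner_smul_left, real_inner_smul_left, hD, hS]
  change inner ℝ (val (R V₁)) z = -(inner ℝ (val (R Z)) z - inner ℝ (val (R W)) z - _ -
    α * inner ℝ (val (R V)) z - _)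
  linarith

end WeakEquation

end Geometry

/-! ### Squared norms and weakly continuous curves -/

section HilbertCurves

variable {E : Type*} [NormedAddCommGroup E] [InnerProductSpace ℝ E]

/-- The chain rule for the squared norm along an absolutely continuous curve. -/
theorem half_norm_sq_eq_add_integral [CompleteSpace E] {w h : ℝ → E} {b : ℝ} {w₀ : E}
    (hh : IntervalIntegrable h volume 0 b)
    (hw : ∀ t ∈ uIcc 0 b, w t = w₀ + ∫ s in (0 : ℝ)..t, h s) :
    IntervalIntegrable (fun s => inner ℝ (w s) (h s)) volume 0 b ∧
    ∀ t ∈ uIcc 0 b, 1 / 2 * ‖w t‖ ^ 2 =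
      1 / 2 * ‖w 0‖ ^ 2 + ∫ s in (0 : ℝ)..t, inner ℝ (w s) (h s) := by
  have hcont : ContinuousOn w (uIcc 0 b) :=
    (absolutelyContinuousOnInterval_integral hh w₀).continuousOn.congr hw
  have hint : IntervalIntegrable (fun s => inner ℝ (w s) (h s)) volume 0 b := by
    obtain ⟨B, hB⟩ := isCompact_uIcc.exists_bound_of_continuousOn hcont
    rw [intervalIntegrable_iff] at hh ⊢
    refine (hh.norm.const_mul B).mono' (((hcont.mono uIoc_subset_uIcc).aestronglyMeasurable
      measurableSet_uIoc).inner hh.1) ?_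
    filter_upwards [ae_restrict_mem measurableSet_uIoc] with s hs
    exact (norm_inner_le_norm _ _).trans
      (mul_le_mul_of_nonneg_right (hB s (uIoc_subset_uIcc hs)) (norm_nonneg _))
  refine ⟨hint, fun t ht => ?_⟩
  have h0 : w 0 = w₀ := by rw [hw 0 left_mem_uIcc]; simp
  rw [h0]
  refine functional_eq_add_integral (Φ := fun x : E => 1 / 2 * ‖x‖ ^ 2)
    (Φ' := fun x => innerSL ℝ x) w₀ hh (fun x => ?_) (fun R => ?_) hw hint ht
  · have := ((hasStrictFDerivAt_norm_sq (F := E) x).hasFDerivAt).const_mul (1 / 2 : ℝ)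
    refine this.congr_fderiv ?_
    ext z
    simp
  · refine ⟨R.toNNReal, LipschitzOnWith.of_dist_le_mul fun x hx y hy => ?_⟩
    rw [mem_closedBall_zero_iff] at hx hy
    have hR : 0 ≤ R := (norm_nonneg x).trans hx
    rw [Real.coe_toNNReal _ hR, Real.dist_eq, dist_eq_norm]
    have h1 : 1 / 2 * ‖x‖ ^ 2 - 1 / 2 * ‖y‖ ^ 2 = 1 / 2 * (‖x‖ + ‖y‖) * (‖x‖ - ‖y‖) := by ring
    rw [h1, abs_mul, abs_of_nonneg (by positivity)]
    refine mul_le_mul (by linarith) (abs_norm_sub_norm_le x y) (abs_nonneg _) hR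

/-- Two weakly continuous curves that agree almost everywhere agree. -/
theorem eqOn_Icc_of_weak {T : ℝ} (hT : 0 < T) {v w : ℝ → E}
    (hv : ∀ z, ContinuousOn (fun t => inner ℝ (v t) z) (Icc 0 T))
    (hw : ∀ z, ContinuousOn (fun t => inner ℝ (w t) z) (Icc 0 T))
    (h : ∀ᵐ t ∂volume.restrict (Ioo 0 T), v t = w t) : ∀ t ∈ Icc 0 T, v t = w t := by
  intro t ht
  refine ext_inner_right ℝ fun z => ?_
  refine Measure.eqOn_Icc_of_ae_eq volume hT.ne ?_ (hv z) (hw z) ht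
  rw [← restrict_Ioo_eq_restrict_Icc]
  filter_upwards [h] with s hs
  rw [hs]

end HilbertCurves

/-- Right neighbourhoods contain intervals of positive measure, so essential limits from the right
are unique. -/
theorem neBot_nhdsGT_inf_ae (a : ℝ) : (𝓝[>] a ⊓ ae (volume : Measure ℝ)).NeBot := by
  rw [Filter.inf_neBot_iff]
  intro s hs t ht
  obtain ⟨b, hb, hsub⟩ := (mem_nhdsGT_iff_exists_Ioo_subset).1 hs
  have hb' : a < b := hb
  by_contra hne
  rw [not_nonempty_iff_eq_empty] at hne
  have h1 : Ioo a b ⊆ tᶜ := fun x hx hxt => by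
    have : x ∈ s ∩ t := ⟨hsub hx, hxt⟩
    rw [hne] at this
    exact this
  have h2 := measure_mono_null h1 (mem_ae_iff.1 ht)
  rw [Real.volume_Ioo, ENNReal.ofReal_eq_zero] at h2
  linarith

namespace Geometry

variable {G : Geometry}

/-! ### Balance of the quadratic energy by smoothing -/

section EnergyIdentity

variable {γ α T : ℝ} {f : ℝ → ℝ} {g : G.L2} {ξ : ℝ → G.EnergySpace}

variable (γ α f g ξ) in
/-- The time derivative of the quadratic part of the energy. -/
def energyRate (t : ℝ) : ℝ :=
  inner ℝ (ξ t).2 g - inner ℝ (ξ t).2 (G.superposition f (val (ξ t).1))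
    - α * ‖(ξ t).2‖ ^ 2 - γ * ‖G.fracLap (1 / 4) (ξ t).2‖ ^ 2

variable (γ α f g ξ) in
/-- The time derivative of the quadratic part of the energy of the smoothed solution. -/
def smoothedEnergyRate (R : G.L2 →L[ℝ] G.H1) (t : ℝ) : ℝ :=
  inner ℝ (val (R (ξ t).2)) (val (R g))
    - inner ℝ (val (R (ξ t).2)) (val (R (G.superposition f (val (ξ t).1))))
    - α * ‖val (R (ξ t).2)‖ ^ 2 - γ * inner ℝ (ξ t).2 (G.sqrtLap (R (val (R (ξ t).2))))

/-- The elastic terms cancel: by symmetry of R, pairing Rv with ε⁻¹(u − Ru) gives the inner product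
of ∇Ru and ∇Rv. -/
theorem inner_smoothedForce_add {ε : ℝ} (hε : 0 < ε) {R : G.L2 →L[ℝ] G.H1}
    (hR : G.IsResolvent ε R) (t : ℝ) :
    inner ℝ (val (R (ξ t).2)) (smoothedForce γ α f g ξ ε R t)
      + inner ℝ (grad (R (val (ξ t).1))) (grad (R (ξ t).2))
      = smoothedEnergyRate γ α f g ξ R t := by
  have h1 := hR.inner_grad hε (R (val (ξ t).1)) (ξ t).2
  have h2 : inner ℝ (val (R (ξ t).2))
      (ContinuousLinearMap.adjoint (G.sqrtLap.comp R) (ξ t).2) =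
      inner ℝ (ξ t).2 (G.sqrtLap (R (val (R (ξ t).2)))) := by
    rw [ContinuousLinearMap.adjoint_inner_right, real_inner_comm]
    rfl
  have h3 : inner ℝ (val (R (val (ξ t).1)) - val (R (val (R (val (ξ t).1))))) (ξ t).2 =
      inner ℝ (val (R (ξ t).2)) (val (ξ t).1 - val (R (val (ξ t).1))) := by
    rw [hR.symm, map_sub, val_sub, real_inner_comm]
  rw [h1, h3, smoothedForce, smoothedEnergyRate]
  simp only [inner_sub_right, real_inner_smul_right, h2, real_inner_self_eq_norm_sq]
  ring

theorem tendsto_smoothedEnergyRate (hG : G.Admissible) {ε : ℕ → ℝ} {R : ℕ → G.L2 →L[ℝ] G.H1}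
    (hε : ∀ n, 0 < ε n) (hε0 : Tendsto ε atTop (𝓝 0)) (hR : ∀ n, G.IsResolvent (ε n) (R n)) {t : ℝ}
    (h : G.hDeltaNormSq (1 / 2) (ξ t).2 ≠ ⊤) :
    Tendsto (fun n => smoothedEnergyRate γ α f g ξ (R n) t) atTop
      (𝓝 (energyRate γ α f g ξ t)) := by
  have h1 := tendsto_resolvent hG hε hε0 hR (ξ t).2
  have h2 := tendsto_resolvent hG hε hε0 hR g
  have h3 := tendsto_resolvent hG hε hε0 hR (G.superposition f (val (ξ t).1))
  have h4 := tendsto_inner_sqrtLap_resolvent hε hε0 hR h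
  exact (((h1.inner h2).sub (h1.inner h3)).sub ((h1.norm.pow 2).const_mul α)).sub (h4.const_mul γ)

/-- Contractivity of R makes the bound independent of ε. It is integrable in time when f(u) is in
L¹(0,T; L²) and the velocity in L²(0,T; H^{1/2}_Δ). -/
theorem norm_smoothedEnergyRate_le (hγ : 0 < γ) (hα : 0 < α) {ε : ℝ} (hε : 0 < ε)
    {R : G.L2 →L[ℝ] G.H1} (hR : G.IsResolvent ε R) {t B : ℝ} (hB : ‖(ξ t).2‖ ≤ B)
    (h : G.hDeltaNormSq (1 / 2) (ξ t).2 ≠ ⊤) :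
    ‖smoothedEnergyRate γ α f g ξ R t‖ ≤ B * ‖g‖ + B * ‖G.superposition f (val (ξ t).1)‖
      + α * B ^ 2 + γ * (G.hDeltaNormSq (1 / 2) (ξ t).2).toReal := by
  have hJ := (hR.norm_val_le hε (ξ t).2).trans hB
  have hB0 : 0 ≤ B := (norm_nonneg _).trans hB
  have hle (w : G.L2) : ‖inner ℝ (val (R (ξ t).2)) (val (R w))‖ ≤ B * ‖w‖ :=
    (norm_inner_le_norm _ _).trans (mul_le_mul hJ (hR.norm_val_le hε w) (norm_nonneg _) hB0)
  refine (norm_sub_le _ _).trans (add_le_add ((norm_sub_le _ _).trans (add_le_add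
    ((norm_sub_le _ _).trans (add_le_add (hle _) (hle _))) ?_)) ?_)
  · rw [norm_mul, norm_pow, norm_norm, Real.norm_of_nonneg hα.le]
    gcongr
  · rw [norm_mul, Real.norm_of_nonneg hγ.le]
    exact mul_le_mul_of_nonneg_left (inner_sqrtLap_resolvent_bound hε hR h) hγ.le

/-- The balance of the quadratic part of the energy. -/
theorem quadratic_energy_eq (hG : G.Admissible) (hT : 0 < T) (hγ : 0 < γ) (hα : 0 < α)
    (h : G.IsWeakEquation γ α f g T ξ)
    (hu : Integrable (fun t => (ξ t).1) (timeMeasure T))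
    (hv : Integrable (fun t => (ξ t).2) (timeMeasure T))
    (hfm : ∀ᵐ t ∂timeMeasure T, MemLp (fun x => f (val (ξ t).1 x)) 2 G.μ)
    (hfi : Integrable (fun t => G.superposition f (val (ξ t).1)) (timeMeasure T))
    (hΔ : G.MemL2HDelta (1 / 2) T (fun t => (ξ t).2)) {B : ℝ}
    (hB : ∀ᵐ t ∂timeMeasure T, ‖(ξ t).2‖ ≤ B) {u : ℝ → G.H1} {v : ℝ → G.L2}
    (huξ : ∀ᵐ t ∂timeMeasure T, u t = (ξ t).1) (hvξ : ∀ᵐ t ∂timeMeasure T, v t = (ξ t).2)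
    (hut : ∀ t ∈ Icc 0 T, val (u t) = val (u 0) + ∫ s in (0 : ℝ)..t, (ξ s).2)
    (hvw : ∀ z, ContinuousOn (fun t => inner ℝ (v t) z) (Icc 0 T)) :
    Integrable (energyRate γ α f g ξ) (timeMeasure T) ∧
    ∀ t ∈ Icc 0 T, 1 / 2 * ‖v t‖ ^ 2 + 1 / 2 * ‖grad (u t)‖ ^ 2 =
      1 / 2 * ‖v 0‖ ^ 2 + 1 / 2 * ‖grad (u 0)‖ ^ 2
        + ∫ s in (0 : ℝ)..t, energyRate γ α f g ξ s := by
  have hfinite : IsFiniteMeasure (timeMeasure T) := ⟨by simp [timeMeasure]⟩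
  let ε : ℕ → ℝ := fun n => 1 / ((n : ℝ) + 1)
  have hε : ∀ n, 0 < ε n := fun n => by positivity
  have hε0 : Tendsto ε atTop (𝓝 0) := tendsto_one_div_add_atTop_nhds_zero_nat
  choose R hR using fun n => exists_isResolvent (G := G) (hε n)
  have hii {E : Type} [NormedAddCommGroup E] {k : ℝ → E} (hk : Integrable k (timeMeasure T)) :
      IntervalIntegrable k volume 0 T := by
    rw [intervalIntegrable_iff_integrableOn_Ioo_of_le hT.le]
    exact hk
  have hIoc (t) (ht : t ∈ Icc 0 T) {p : ℝ → Prop} (h : ∀ᵐ s ∂timeMeasure T, p s) :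
      ∀ᵐ s ∂volume, s ∈ uIoc 0 t → p s := by
    rw [timeMeasure, restrict_Ioo_eq_restrict_Ioc, ae_restrict_iff' measurableSet_Ioc] at h
    filter_upwards [h] with s hs hs'
    rw [uIoc_of_le ht.1] at hs'
    exact hs ⟨hs'.1, hs'.2.trans ht.2⟩
  have hle0 (t) (ht : t ∈ Icc 0 T) : volume.restrict (uIoc 0 t) ≤ timeMeasure T := by
    rw [timeMeasure, restrict_Ioo_eq_restrict_Ioc, uIoc_of_le ht.1]
    exact Measure.restrict_mono (Ioc_subset_Ioc_right ht.2) le_rfl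
  obtain ⟨hΔ1, hΔ2, hΔ3⟩ := hΔ
  have hfin := ae_lt_top' hΔ2 hΔ3.ne
  have hBint : Integrable (fun t => B * ‖g‖ + B * ‖G.superposition f (val (ξ t).1)‖
      + α * B ^ 2 + γ * (G.hDeltaNormSq (1 / 2) (ξ t).2).toReal) (timeMeasure T) :=
    (((integrable_const _).add (hfi.norm.const_mul B)).add (integrable_const _)).add
      ((integrable_toReal_of_lintegral_ne_top hΔ2 hΔ3.ne).const_mul γ)
  have hbound (n) : ∀ᵐ t ∂timeMeasure T, ‖smoothedEnergyRate γ α f g ξ (R n) t‖ ≤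
      B * ‖g‖ + B * ‖G.superposition f (val (ξ t).1)‖
      + α * B ^ 2 + γ * (G.hDeltaNormSq (1 / 2) (ξ t).2).toReal := by
    filter_upwards [hB, hfin] with t h1 h2
    exact norm_smoothedEnergyRate_le hγ hα (hε n) (hR n) h1 h2.ne
  have hmeas (n) : AEStronglyMeasurable (smoothedEnergyRate γ α f g ξ (R n)) (timeMeasure T) := by
    have m1 := (G.valL.comp (R n)).continuous.comp_aestronglyMeasurable hv.1
    have m2 := (G.valL.comp (R n)).continuous.comp_aestronglyMeasurable hfi.1
    have m3 := (G.sqrtLap.comp (R n)).continuous.comp_aestronglyMeasurable m1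
    exact (((m1.inner aestronglyMeasurable_const).sub (m1.inner m2)).sub
      ((m1.norm.pow 2).const_mul α)).sub ((hv.1.inner m3).const_mul γ)
  have hlim : ∀ᵐ t ∂timeMeasure T, Tendsto (fun n => smoothedEnergyRate γ α f g ξ (R n) t) atTop
      (𝓝 (energyRate γ α f g ξ t)) := by
    filter_upwards [hfin] with t h2
    exact tendsto_smoothedEnergyRate hG hε hε0 hR h2.ne
  have hrate : Integrable (energyRate γ α f g ξ) (timeMeasure T) := by
    refine hBint.mono' (aestronglyMeasurable_of_tendsto_ae atTop hmeas hlim) ?_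
    filter_upwards [ae_all_iff.2 hbound, hlim] with t h1 h2
    exact le_of_tendsto h2.norm (Eventually.of_forall h1)
  refine ⟨hrate, fun t ht => ?_⟩
  have hn (n) : 1 / 2 * ‖val (R n (v t))‖ ^ 2 + 1 / 2 * ‖grad (R n (val (u t)))‖ ^ 2 =
      1 / 2 * ‖val (R n (v 0))‖ ^ 2 + 1 / 2 * ‖grad (R n (val (u 0)))‖ ^ 2
        + ∫ s in (0 : ℝ)..t, smoothedEnergyRate γ α f g ξ (R n) s := by
    obtain ⟨c, hc⟩ := h.exists_smoothed hG hT hu hv hfm hfi (hε n) (hR n)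
    have hforce := hii (integrable_smoothedForce (γ := γ) (α := α) (g := g) (ε := ε n) (R n)
      hu hv hfi)
    have hcont : ContinuousOn
        (fun t => c + ∫ s in (0 : ℝ)..t, smoothedForce γ α f g ξ (ε n) (R n) s) (Icc 0 T) := by
      have := (absolutelyContinuousOnInterval_integral hforce c).continuousOn
      rwa [uIcc_of_le hT.le] at this
    -- The primitive formula is known almost everywhere; both sides are weakly continuous, so it
    -- holds at every time, which is what the balance at fixed t and at 0 requires.
    have hJ : ∀ t ∈ uIcc 0 T, val (R n (v t)) =
        c + ∫ s in (0 : ℝ)..t, smoothedForce γ α f g ξ (ε n) (R n) s := by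
      rw [uIcc_of_le hT.le]
      refine eqOn_Icc_of_weak hT (fun z => ?_) (fun z => hcont.inner continuousOn_const) ?_
      · simp only [(hR n).symm]
        exact hvw _
      · filter_upwards [hvξ, hc] with s h1 h2
        rw [h1, h2]
    -- The bounded operator ∇R is applied to the integral formula for u; thus ∇Ru is absolutely
    -- continuous in L².
    have hK : ∀ t ∈ uIcc 0 T, grad (R n (val (u t))) =
        grad (R n (val (u 0))) + ∫ s in (0 : ℝ)..t, grad (R n (ξ s).2) := by
      rw [uIcc_of_le hT.le]
      intro t ht
      have hvt : IntervalIntegrable (fun s => (ξ s).2) volume 0 t := by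
        refine (hii hv).mono_set ?_
        rw [uIcc_of_le ht.1, uIcc_of_le hT.le]
        exact Icc_subset_Icc_right ht.2
      have := (G.gradL.comp (R n)).intervalIntegral_comp_comm hvt
      rw [hut t ht, map_add, grad_add]
      congr 1
      exact this.symm
    obtain ⟨i1, e1⟩ := half_norm_sq_eq_add_integral hforce hJ
    obtain ⟨i2, e2⟩ := half_norm_sq_eq_add_integral
      (hii ((G.gradL.comp (R n)).integrable_comp hv)) hK
    have ht' : t ∈ uIcc 0 T := by rwa [uIcc_of_le hT.le]
    have hsub : uIcc 0 t ⊆ uIcc 0 T := uIcc_subset_uIcc_left ht'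
    have hsum := intervalIntegral.integral_add (i1.mono_set hsub) (i2.mono_set hsub)
    have hcongr : ∫ s in (0 : ℝ)..t, (inner ℝ (val (R n (v s)))
          (smoothedForce γ α f g ξ (ε n) (R n) s)
        + inner ℝ (grad (R n (val (u s)))) (grad (R n (ξ s).2))) =
        ∫ s in (0 : ℝ)..t, smoothedEnergyRate γ α f g ξ (R n) s := by
      refine intervalIntegral.integral_congr_ae ?_
      refine hIoc t ht ?_
      filter_upwards [huξ, hvξ] with s h1 h2
      rw [h1, h2]
      exact inner_smoothedForce_add (hε n) (hR n) s
    have e1' := e1 t ht'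
    have e2' := e2 t ht'
    rw [← hcongr]
    refine Eq.trans ?_ (congrArg _ hsum.symm)
    rw [e1', e2']
    exact add_add_add_comm _ _ _ _
  have hl (t : ℝ) : Tendsto (fun n => 1 / 2 * ‖val (R n (v t))‖ ^ 2
      + 1 / 2 * ‖grad (R n (val (u t)))‖ ^ 2) atTop
      (𝓝 (1 / 2 * ‖v t‖ ^ 2 + 1 / 2 * ‖grad (u t)‖ ^ 2)) := by
    have h1 := tendsto_resolvent hG hε hε0 hR (v t)
    have h2 : Tendsto (fun n => grad (R n (val (u t)))) atTop (𝓝 (grad (u t))) :=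
      (G.gradL.continuous.tendsto _).comp (tendsto_resolvent_H1 hG hε hε0 hR (u t))
    exact ((h1.norm.pow 2).const_mul _).add ((h2.norm.pow 2).const_mul _)
  -- Limit ε → 0: strong convergence of the resolvents at the times t and 0, dominated convergence
  -- for the rate in between.
  refine tendsto_nhds_unique (hl t) ?_
  simp_rw [hn]
  refine (hl 0).add (intervalIntegral.tendsto_integral_filter_of_dominated_convergence _
    (Eventually.of_forall fun n => (hmeas n).mono_measure (hle0 t ht))
    (Eventually.of_forall fun n => hIoc t ht (hbound n)) ?_ (hIoc t ht hlim))
  refine (hii hBint).mono_set ?_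
  rw [uIcc_of_le ht.1, uIcc_of_le hT.le]
  exact Icc_subset_Icc_right ht.2

end EnergyIdentity

end Geometry

namespace Geometry

variable {G : Geometry}

/-! ### Continuity in the energy space and the energy equality -/

section Continuity

/-- A weakly continuous curve in the energy space whose quadratic energy is continuous is strongly
continuous. -/
theorem continuousOn_energySpace {s : Set ℝ} {u : ℝ → G.H1} {v : ℝ → G.L2}
    (hu : ∀ z, ContinuousOn (fun t => inner ℝ (u t) z) s)
    (hv : ∀ z, ContinuousOn (fun t => inner ℝ (v t) z) s)
    (hval : ContinuousOn (fun t => val (u t)) s)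
    (he : ContinuousOn (fun t => 1 / 2 * ‖v t‖ ^ 2 + 1 / 2 * ‖grad (u t)‖ ^ 2) s) :
    ContinuousOn (fun t => ((u t, v t) : G.EnergySpace)) s := by
  intro t ht
  have hw : Tendsto (fun r => WithLp.toLp 2 (u r, v r)) (𝓝[s] t)
      (𝓝 (WithLp.toLp 2 (u t, v t))) := by
    -- The Hilbert product norm is used instead of the maximum norm: its square is ‖u‖² in L² plus
    -- twice the quadratic energy, both continuous.
    refine tendsto_of_weak_of_norm ?_ ?_
    · simp only [WithLp.prod_inner_apply]
      exact ((hu (u t)) t ht).add ((hv (v t)) t ht)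
    · simp only [WithLp.prod_norm_sq_eq_of_L2, norm_sq_H1]
      have h : Tendsto (fun r => ‖val (u r)‖ ^ 2
          + 2 * (1 / 2 * ‖v r‖ ^ 2 + 1 / 2 * ‖grad (u r)‖ ^ 2)) (𝓝[s] t)
          (𝓝 (‖val (u t)‖ ^ 2 + 2 * (1 / 2 * ‖v t‖ ^ 2 + 1 / 2 * ‖grad (u t)‖ ^ 2))) :=
        ((hval t ht).norm.pow 2).add ((he t ht).const_mul 2)
      change Tendsto (fun r => ‖val (u r)‖ ^ 2 + ‖grad (u r)‖ ^ 2 + ‖v r‖ ^ 2) (𝓝[s] t)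
        (𝓝 (‖val (u t)‖ ^ 2 + ‖grad (u t)‖ ^ 2 + ‖v t‖ ^ 2))
      convert h using 2 <;> ring
  exact ((WithLp.prod_continuous_ofLp 2 G.H1 G.L2).tendsto _).comp hw

end Continuity

variable {γ α T : ℝ} {f : ℝ → ℝ} {g : G.L2} {ξ₀ : G.EnergySpace} {ξ : ℝ → G.EnergySpace}

theorem IsEnergySolution.exists_bound (hξ : G.IsEnergySolution γ α f g T ξ₀ ξ) :
    ∃ B, ∀ᵐ t ∂timeMeasure T, ‖ξ t‖ ≤ B := by
  have h := hξ.memLp_top.2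
  rw [eLpNorm_exponent_top] at h
  refine ⟨(eLpNormEssSup ξ (timeMeasure T)).toReal, ?_⟩
  filter_upwards [enorm_ae_le_eLpNormEssSup ξ (timeMeasure T)] with t ht
  rw [← toReal_enorm]
  exact ENNReal.toReal_mono h.ne ht

/-- A continuous representative of an energy solution attains the initial data. -/
theorem IsEnergySolution.initial_eq (hG : G.Admissible) (hT : 0 < T)
    (hξ : G.IsEnergySolution γ α f g T ξ₀ ξ) {ζ : ℝ → G.EnergySpace}
    (hζ : ∀ᵐ t ∂timeMeasure T, ζ t = ξ t) (hc : ContinuousOn ζ (Icc 0 T)) : ζ 0 = ξ₀ := by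
  have hne := neBot_nhdsGT_inf_ae 0
  have heq : ∀ᶠ t in 𝓝[>] (0 : ℝ) ⊓ ae volume, ζ t = ξ t := by
    rw [timeMeasure, ae_restrict_iff' measurableSet_Ioo] at hζ
    filter_upwards [Filter.mem_inf_of_left (Ioo_mem_nhdsGT hT), Filter.mem_inf_of_right hζ]
      with t h1 h2
    exact h2 h1
  have hlim : Tendsto ζ (𝓝[>] (0 : ℝ) ⊓ ae volume) (𝓝 (ζ 0)) := by
    refine (hc 0 ⟨le_rfl, hT.le⟩).mono_left (inf_le_left.trans ?_)
    rw [← nhdsWithin_Ioc_eq_nhdsGT hT]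
    exact nhdsWithin_mono _ Ioc_subset_Icc_self
  have hfst : Tendsto (fun t => val (ζ t).1) (𝓝[>] (0 : ℝ) ⊓ ae volume) (𝓝 (val (ζ 0).1)) :=
    ((G.valL.continuous.comp continuous_fst).tendsto _).comp hlim
  have hsnd : Tendsto (fun t => (ζ t).2) (𝓝[>] (0 : ℝ) ⊓ ae volume) (𝓝 (ζ 0).2) :=
    (continuous_snd.tendsto _).comp hlim
  -- The limit in L² determines the member of H¹.
  refine Prod.ext (val_injective hG (tendsto_nhds_unique hfst
    (hξ.initial_fst.congr' ?_))) ?_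
  · filter_upwards [heq] with t ht
    rw [ht]
  · rw [← sub_eq_zero]
    -- The velocities are compared only as functionals on H¹, which suffices because H¹ is dense in
    -- L².
    refine eq_zero_of_inner_val hG fun q => ?_
    rw [inner_sub_left, sub_eq_zero]
    refine tendsto_nhds_unique (hsnd.inner tendsto_const_nhds) (Tendsto.congr' ?_
      (((ContinuousLinearMap.apply ℝ ℝ q).continuous.tendsto _).comp hξ.initial_snd))
    filter_upwards [heq] with t ht
    rw [ht]
    rfl

/-- Energy solutions with values in `L²(0,T; H^{3/2})` are continuous in time and satisfy the energy
equality. -/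
theorem IsEnergySolution.exists_continuous_energy_equality (hG : G.Admissible) (hγ : 0 < γ)
    (hα : 0 < α) {C κ K : ℝ} (hf : IsAdmissibleNonlinearity f C κ K) (hT : 0 < T)
    (hξ : G.IsEnergySolution γ α f g T ξ₀ ξ) (hreg : G.MemL2HThreeHalves T (fun t => (ξ t).1)) :
    ∃ ζ : ℝ → G.EnergySpace, (∀ᵐ t ∂timeMeasure T, ζ t = ξ t) ∧ ζ 0 = ξ₀ ∧
      ContinuousOn ζ (Icc 0 T) ∧
      (∀ t ∈ Icc 0 T, Integrable (fun x => potential f (val (ζ t).1 x)) G.μ) ∧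
      AbsolutelyContinuousOnInterval (fun t => G.energy f g (ζ t)) 0 T ∧
      ∀ᵐ t ∂timeMeasure T, HasDerivAt (fun s => G.energy f g (ζ s))
        (-(α * ‖(ζ t).2‖ ^ 2 + γ * ‖G.fracLap (1 / 4) (ζ t).2‖ ^ 2)) t := by
  have hfinite : IsFiniteMeasure (timeMeasure T) := ⟨by simp [timeMeasure]⟩
  have hii {E : Type} [NormedAddCommGroup E] {k : ℝ → E} (hk : Integrable k (timeMeasure T)) :
      IntervalIntegrable k volume 0 T := by
    rw [intervalIntegrable_iff_integrableOn_Ioo_of_le hT.le]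
    exact hk
  have hcont {E : Type} [NormedAddCommGroup E] [NormedSpace ℝ E] {k : ℝ → E} (c : E)
      (hk : Integrable k (timeMeasure T)) :
      ContinuousOn (fun t => c + ∫ s in (0 : ℝ)..t, k s) (Icc 0 T) := by
    have := (absolutelyContinuousOnInterval_integral (hii hk) c).continuousOn
    rwa [uIcc_of_le hT.le] at this
  have h0 : (0 : ℝ) ∈ Icc 0 T := ⟨le_rfl, hT.le⟩
  obtain ⟨B, hB⟩ := hξ.exists_bound
  have hB1 : ∀ᵐ t ∂timeMeasure T, ‖(ξ t).1‖ ≤ B := hB.mono fun t ht => (norm_fst_le _).trans ht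
  have hB2 : ∀ᵐ t ∂timeMeasure T, ‖(ξ t).2‖ ≤ B := hB.mono fun t ht => (norm_snd_le _).trans ht
  have hu : Integrable (fun t => (ξ t).1) (timeMeasure T) :=
    (integrable_const B).mono' (continuous_fst.comp_aestronglyMeasurable hξ.memLp_top.1) hB1
  have hv : Integrable (fun t => (ξ t).2) (timeMeasure T) :=
    (integrable_const B).mono' (continuous_snd.comp_aestronglyMeasurable hξ.memLp_top.1) hB2
  obtain ⟨c, hc⟩ := exists_eq_const_add_integral hT (G.valL.integrable_comp hu) hv
    hξ.isTimeDeriv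
  -- Bounded in H¹ and continuous in L², the displacement is weakly continuous in H¹.
  obtain ⟨u, huc, huξ, huw⟩ := exists_weakly_continuous_representative hT G.valL
    (val_injective hG) (hcont c hv) hc hB1
  have hu0 : val (u 0) = c := by
    have := (huc 0 h0).1
    simpa [valL_apply] using this
  have hut : ∀ t ∈ Icc 0 T, val (u t) = val (u 0) + ∫ s in (0 : ℝ)..t, (ξ s).2 := fun t ht => by
    rw [hu0]
    exact (huc t ht).1
  have hregu : G.MemL2HThreeHalves T u := by
    obtain ⟨r1, r2, r3⟩ := hreg
    have hN : (fun t => G.hThreeHalvesNormSq (ξ t).1) =ᵐ[timeMeasure T]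
        fun t => G.hThreeHalvesNormSq (u t) := by
      filter_upwards [huξ] with t ht
      rw [ht]
    refine ⟨r1.congr ?_, r2.congr hN, ?_⟩
    · filter_upwards [huξ] with t ht
      exact ht.symm
    · rwa [← lintegral_congr_ae hN]
  -- Here the H^{3/2} hypothesis enters: f(u) lies in L¹(0,T; L²) and the chain rule for the
  -- potential energy holds.
  obtain ⟨p1, p2, p3, p4⟩ := integral_potential_eq hG hf hT hregu (fun t ht => (huc t ht).2) hv.1
    hB2 hut
  have hfm : ∀ᵐ t ∂timeMeasure T, MemLp (fun x => f (val (ξ t).1 x)) 2 G.μ := by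
    filter_upwards [p2, huξ] with t h1 h2
    rwa [← h2]
  have hfi : Integrable (fun t => G.superposition f (val (ξ t).1)) (timeMeasure T) := by
    refine p1.congr ?_
    filter_upwards [huξ] with t h2
    rw [h2]
  obtain ⟨R, hR⟩ := exists_isResolvent (G := G) one_pos
  -- Any fixed ε serves for the weak continuity of the velocity: R is injective, the smoothed
  -- velocity is continuous, and the velocity itself is bounded in L².
  obtain ⟨c', hc'⟩ := hξ.weak_equation.exists_smoothed hG hT hu hv hfm hfi one_pos hR
  obtain ⟨v, hvc, hvξ, hvw⟩ := exists_weakly_continuous_representative hT (G.valL.comp R)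
    (hR.val_injective hG) (hcont c' (integrable_smoothedForce R hu hv hfi)) hc' hB2
  obtain ⟨hrate, hquad⟩ := quadratic_energy_eq hG hT hγ hα hξ.weak_equation hu hv hfm hfi
    hξ.memL2_half hB2 huξ hvξ hut hvw
  have hζ : ContinuousOn (fun t => ((u t, v t) : G.EnergySpace)) (Icc 0 T) :=
    continuousOn_energySpace huw hvw ((hcont c hv).congr fun t ht => (huc t ht).1)
      ((hcont _ hrate).congr hquad)
  have hζξ : ∀ᵐ t ∂timeMeasure T, ((u t, v t) : G.EnergySpace) = ξ t := by
    filter_upwards [huξ, hvξ] with t h1 h2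
    exact Prod.ext h1 h2
  obtain ⟨C₁, -, hC₁, hle, -⟩ := hf.exists_truncation
  have hgi : Integrable (fun t => inner ℝ g (ξ t).2) (timeMeasure T) := hv.const_inner g
  -- The sum of the rates of the quadratic, potential and source parts; the terms with f(u) and with
  -- g cancel, leaving minus the dissipation.
  set D : ℝ → ℝ := fun t => energyRate γ α f g ξ t +
    inner ℝ (G.superposition f (val (u t))) (ξ t).2 - inner ℝ g (ξ t).2 with hD
  have hDint : Integrable D (timeMeasure T) := (hrate.add p3).sub hgi
  have henergy : ∀ t ∈ Icc 0 T, G.energy f g (u t, v t) =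
      G.energy f g (u 0, v 0) + ∫ s in (0 : ℝ)..t, D s := by
    intro t ht
    have hsub : uIcc 0 t ⊆ uIcc 0 T := by
      rw [uIcc_of_le ht.1, uIcc_of_le hT.le]
      exact Icc_subset_Icc_right ht.2
    have j1 := (hii hrate).mono_set hsub
    have j2 := (hii p3).mono_set hsub
    have j3 := (hii hgi).mono_set hsub
    have hg : inner ℝ g (val (u t)) = inner ℝ g (val (u 0)) +
        ∫ s in (0 : ℝ)..t, inner ℝ g (ξ s).2 := by
      have := (innerSL ℝ g).intervalIntegral_comp_comm ((hii hv).mono_set hsub)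
      rw [hut t ht, inner_add_right]
      congr 1
      exact this.symm
    have hsum : ∫ s in (0 : ℝ)..t, D s = (∫ s in (0 : ℝ)..t, energyRate γ α f g ξ s)
        + (∫ s in (0 : ℝ)..t, inner ℝ (G.superposition f (val (u s))) (ξ s).2)
        - ∫ s in (0 : ℝ)..t, inner ℝ g (ξ s).2 := by
      rw [hD, intervalIntegral.integral_sub (j1.add j2) j3, intervalIntegral.integral_add j1 j2]
    have hq := hquad t ht
    have hp := p4 t ht
    simp only [energy]
    rw [hsum, hg, hp, hq]
    ring
  have hDeq : ∀ᵐ t ∂timeMeasure T,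
      D t = -(α * ‖v t‖ ^ 2 + γ * ‖G.fracLap (1 / 4) (v t)‖ ^ 2) := by
    filter_upwards [huξ, hvξ] with t h1 h2
    simp only [hD, energyRate]
    rw [h1, h2, real_inner_comm (ξ t).2 g, real_inner_comm (ξ t).2 (G.superposition _ _)]
    ring
  have hac := absolutelyContinuousOnInterval_integral (hii hDint) (G.energy f g (u 0, v 0))
  refine ⟨fun t => (u t, v t), hζξ, hξ.initial_eq hG hT hζξ hζ, hζ, fun t _ =>
    integrable_potential hG hf.contDiff.continuous hC₁ hle _, ?_, ?_⟩
  -- The energy equals the primitive only on [0,T], which contains all endpoints occurring in the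
  -- definition.
  · rw [absolutelyContinuousOnInterval_iff] at hac ⊢
    intro ε hε
    obtain ⟨δ, hδ, h⟩ := hac ε hε
    refine ⟨δ, hδ, fun I hI hlt => lt_of_eq_of_lt (Finset.sum_congr rfl fun i hi => ?_)
      (h I hI hlt)⟩
    obtain ⟨h1, h2⟩ := hI.1 i hi
    rw [uIcc_of_le hT.le] at h1 h2
    rw [henergy _ h1, henergy _ h2]
  · have hder := (hii hDint).ae_hasDerivAt_integral
    rw [timeMeasure, ae_restrict_iff' measurableSet_Ioo] at hDeq ⊢
    filter_upwards [hder, hDeq] with t h1 h2 ht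
    rw [← h2 ht]
    have h3 := (h1 (by rw [uIcc_of_le hT.le]; exact Ioo_subset_Icc_self ht) 0
      left_mem_uIcc).const_add (G.energy f g (u 0, v 0))
    refine h3.congr_of_eventuallyEq ?_
    filter_upwards [Ioo_mem_nhds ht.1 ht.2] with s hs
    exact henergy s (Ioo_subset_Icc_self hs)

end Geometry

end DampedWave

end

theorem corollary2p4 (G : DampedWave.Geometry) (hG : G.Admissible)
    (γ α : ℝ) (hγ : 0 < γ) (hα : 0 < α)
    (f : ℝ → ℝ) (C κ K : ℝ) (hf : DampedWave.IsAdmissibleNonlinearity f C κ K)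
    (g : G.L2) (T : ℝ) (hT : 0 < T) (ξ₀ : G.EnergySpace) (ξ : ℝ → G.EnergySpace)
    (hξ : G.IsEnergySolution γ α f g T ξ₀ ξ)
    (hreg : G.MemL2HThreeHalves T (fun t => (ξ t).1)) :
    ∃ ζ : ℝ → G.EnergySpace,
      (∀ᵐ t ∂(volume.restrict (Ioo 0 T)), ζ t = ξ t) ∧
      ζ 0 = ξ₀ ∧
      ContinuousOn ζ (Icc 0 T) ∧
      (∀ t ∈ Icc 0 T,
        Integrable (fun x => DampedWave.Geometry.potential f
          (DampedWave.Geometry.val (ζ t).1 x)) G.μ) ∧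
      AbsolutelyContinuousOnInterval (fun t => G.energy f g (ζ t)) 0 T ∧
      ∀ᵐ t ∂(volume.restrict (Ioo 0 T)),
        HasDerivAt (fun s => G.energy f g (ζ s))
          (-(α * ‖(ζ t).2‖ ^ 2 + γ * ‖G.fracLap (1 / 4) (ζ t).2‖ ^ 2)) t :=
  hξ.exists_continuous_energy_equality hG hγ hα hf hT hreg
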